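/- For positive integers $m,n$ let $s(m,n)$ and $c(m,n)$ denote the number of all subgroups and of all cyclic subgroups of $\mathbb{Z}_m\times\mathbb{Z}_n$, respectively. Let $\gamma_0,\gamma_1,\dots$ be the Stieltjes constants, given by the Laurent expansion $\zeta(z)=\frac1{z-1}+\sum_{n\ge0}\frac{(-1)^n\gamma_n}{n!}(z-1)^n$ at $z=1$, and put $$A(t)=1+\sum_{n\ge 0}\frac{(-1)^n\gamma_n}{n!}\,t^{n+1},\qquad Z(t)=\sum_{k\ge 0}\frac{\zeta^{(k)}(2)}{k!}\,(2t)^k .$$ Let $\widetilde P_4(u)$ and $\widetilde R_4(u)$ be the coefficients of $t^4$ in the power series expansions in $t$ of $$e^{ut}\,\frac{A(t)^4A(2t)}{2\,Z(t)\,(1+t)^2}\qquad\text{and}\qquad e^{ut}\,\frac{A(t)^4A(2t)}{2\,Z(t)^2\,(1+t)^2},$$ respectively; their coefficients are thus explicit rational expressions in $\gamma_0,\gamma_1,\gamma_2,\gamma_3$ and $\zeta(2),\zeta'(2),\dots,\zeta^{(4)}(2)$. Then $\widetilde P_4$ and $\widetilde R_4$ are polynomials in $u$ of degree $4$, and for all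 real $x>2$ $$\sum_{mn\le x}s(m,n)\log\frac{x}{mn}=x\,\widetilde P_4(\log x)+O\!\left(x^{1/2}\log x\right),\qquad \sum_{mn\le x}c(m,n)\log\frac{x}{mn}=x\,\widetilde R_4(\log x)+O\!\left(x^{1/2}\log x\right),$$ where the sums run over pairs of positive integers $m,n$ and the implied constants are absolute. -/

import Mathlib

noncomputable section

namespace SubgroupCount

/-- The number `s(m,n)` of all subgroups of `ℤ_m × ℤ_n` (used for `m, n ≥ 1`). -/
def s (m n : ℕ) : ℕ := Nat.card (AddSubgroup (ZMod m × ZMod n))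

/-- The number `c(m,n)` of cyclic subgroups of `ℤ_m × ℤ_n` (used for `m, n ≥ 1`). -/
def c (m n : ℕ) : ℕ := Nat.card {H : AddSubgroup (ZMod m × ZMod n) // IsAddCyclic H}

/-- `∑_{mn ≤ x} f(m,n) log(x / mn)`, over all pairs of positive integers `m, n` with `mn ≤ x`
(such pairs have `m, n ≤ ⌊x⌋`). -/
def logWeightedSum (f : ℕ → ℕ → ℕ) (x : ℝ) : ℝ :=
  ∑ p ∈ (Finset.Icc 1 ⌊x⌋₊ ×ˢ Finset.Icc 1 ⌊x⌋₊).filter (fun p => (p.1 : ℝ) * (p.2 : ℝ) ≤ x),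
    (f p.1 p.2 : ℝ) * Real.log (x / ((p.1 : ℝ) * (p.2 : ℝ)))

/-- The entire function `ζ(z) - 1/(z-1)`, with its limit (Euler's constant) as value at `z = 1`. -/
def zetaRegularPart : ℂ → ℂ :=
  Function.update (fun z => riemannZeta z - 1 / (z - 1)) 1 (Real.eulerMascheroniConstant : ℂ)

/-- The Stieltjes constants `γ_n`, in the usual normalization
`ζ(z) = 1/(z-1) + ∑_{n ≥ 0} (-1)^n γ_n (z-1)^n / n!`. (They are real.) -/
def stieltjes (n : ℕ) : ℝ := (-1) ^ n * (iteratedDeriv n zetaRegularPart 1).re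

/-- The derivatives `ζ^{(k)}(2)`. (They are real.) -/
def zetaDerivTwo (k : ℕ) : ℝ := (iteratedDeriv k riemannZeta 2).re

open PowerSeries in
/-- `A(t) = 1 + γ_0 t - γ_1 t^2 + (γ_2 / 2!) t^3 - …`, the expansion of `t ζ(1+t)` at `t = 0`. -/
def seriesA : PowerSeries ℝ :=
  1 + X * PowerSeries.mk (fun n => (-1) ^ n * stieltjes n / (n.factorial : ℝ))

/-- `Z(t) = ∑_k ζ^{(k)}(2) (2t)^k / k!`, the expansion of `ζ(2+2t)` at `t = 0`. -/
def seriesZ : PowerSeries ℝ :=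
  PowerSeries.mk (fun k => zetaDerivTwo k * 2 ^ k / (k.factorial : ℝ))

open PowerSeries in
/-- `H_j(t) = A(t)^4 · (A(2t)/2) / (Z(t)^j (1+t)^2)`; the constant term of the denominator is
`ζ(2)^j ≠ 0`. -/
def seriesH (j : ℕ) : PowerSeries ℝ :=
  seriesA ^ 4 * (PowerSeries.C (1 / 2 : ℝ) * PowerSeries.rescale (2 : ℝ) seriesA)
    * (seriesZ ^ j * (1 + X) ^ 2)⁻¹

/-- The polynomial in `u` which is the coefficient of `t^4` in `e^{ut} H_j(t)`, that is,
`∑_{k=0}^{4} h_{4-k} u^k / k!` with `H_j(t) = ∑ h_i t^i`. -/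
def mainPoly (j : ℕ) : Polynomial ℝ :=
  ∑ k ∈ Finset.range 5,
    Polynomial.monomial k (PowerSeries.coeff (4 - k) (seriesH j) / (k.factorial : ℝ))

/-- The main-term polynomial for all subgroups. -/
def polyP : Polynomial ℝ := mainPoly 1

/-- The main-term polynomial for cyclic subgroups. -/
def polyR : Polynomial ℝ := mainPoly 2

end SubgroupCount

end

/-!
A subgroup of `ℤ_m × ℤ_n` is the graph of a homomorphism from a subgroup of the first factor to a
quotient of the second, so `s(m,n) = ∑ gcd(i,j)` over `i ∣ m`, `j ∣ n`; counting generators gives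
`c(m,n) = ∑ φ(gcd(i,j))` over the same pairs. Hence `∑_{mn=N} s(m,n)` and `∑_{mn=N} c(m,n)` are the
coefficients of `ζ(z)⁴ ζ(2z-1) / ζ(2z)^j` with `j = 1` and `j = 2` (`logWeightedSum_s`,
`logWeightedSum_c`), and the weighted sums are Riesz means of order one of these series.

The factor `1 / ζ(2z)^j` is put aside, because bounding it near `Re z = 1/2` would need a zero-free
region. For the remaining series `ζ(z)⁴ ζ(2z-1)`, Perron's formula with the kernel `x^z / z²`
expresses the Riesz mean as an absolutely convergent integral over `Re z = 3/2`
(`integral_zetaKernel_mul_cpow`). The line is moved to `Re z = 0.49`, across a pole of order five at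
`1` (`integral_vertical_sub_integral_vertical`), whose residue is `x` times the coefficient of `t⁴`
in `e^{ut} A(t)⁴ A(2t) / (2 (1+t)²)` at `u = log x` (`taylor_zetaKernelNum`, `residueCoeff`). The
result is an error `O(x^{0.49})` (`abs_rieszSum_baseCoeff_sub_le`), below `x^{1/2}` by a power.

What has to be shown is that the integral over the new line converges absolutely. There `2z - 1` has
real part `-0.02`, and the functional equation with the Phragmén–Lindelöf principle gives
`ζ(2z-1) ≪ |t|^{0.53}`. The fourth power is treated in mean: the integral of `|ζ(0.49 + it)|⁴` over
`[2^k, 2^{k+1}]` is `≪ (k+1)⁷ 2^{1.36 k}` (`integral_norm_riemannZeta_pow_four_le`). Since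
`1.36 + 0.53 < 2`, the division by `|z|²` leaves a convergent sum over `k`, and the sharp fourth
moment theorem is not needed. The weaker moment bound comes from cutting the Dirichlet polynomial
approximating `ζ` into dyadic blocks: for short blocks the mean value theorem for Dirichlet
polynomials applies to the square of the block; for medium ones van der Corput's second derivative
test bounds one square and the mean value theorem the other; for long ones the first derivative test
is enough.

Finally each factor `1 / ζ(2z) = ∑ μ(m) m^{-2z}` is inserted elementarily, by summing the asymptotic
formula at `x / m²` over `m` with weight `μ(m)` (`abs_rieszSum_mul_moebius_sub_le`). In the main term
this multiplies the power series by `∑ μ(m) m^{-2-2t} = 1 / Z(t)` (`moebiusSeries_mul_seriesZ`,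
`seriesH_succ`). In the error, `∑_{m ≤ √x} (x / m²)^{0.49}` is `O(x^{1/2})`; the second insertion,
needed for cyclic subgroups, starts from the exponent `1/2`, where the sum over `m` costs a logarithm.
-/

namespace SubgroupCount

open Finset

/-! ### Counting subgroups of a product of two cyclic groups -/

section Group

/-- A subgroup of `A × B` is determined by its projection `H` to `A`, its intersection `K` with
`B`, and the homomorphism `H →+ B ⧸ K` of which it is the graph. -/
def subgroupOfGraph {A B : Type*} [AddCommGroup A] [AddCommGroup B]
    (p : Σ H : AddSubgroup A, Σ K : AddSubgroup B, (H →+ B ⧸ K)) : AddSubgroup (A × B) where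
  carrier := {x | ∃ h : x.1 ∈ p.1, p.2.2 ⟨x.1, h⟩ = (x.2 : B ⧸ p.2.1)}
  zero_mem' := ⟨p.1.zero_mem, p.2.2.map_zero⟩
  add_mem' := by
    rintro ⟨a, b⟩ ⟨a', b'⟩ ⟨h, e⟩ ⟨h', e'⟩
    refine ⟨p.1.add_mem h h', ?_⟩
    have := p.2.2.map_add ⟨a, h⟩ ⟨a', h'⟩
    simp only at e e'
    rw [e, e'] at this
    exact this
  neg_mem' := by
    rintro ⟨a, b⟩ ⟨h, e⟩
    refine ⟨p.1.neg_mem h, ?_⟩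
    have := p.2.2.map_neg ⟨a, h⟩
    simp only at e
    rw [e] at this
    exact this

variable {A B : Type*} [AddCommGroup A] [AddCommGroup B]

lemma mem_subgroupOfGraph (p : Σ H : AddSubgroup A, Σ K : AddSubgroup B, (H →+ B ⧸ K))
    (x : A × B) :
    x ∈ subgroupOfGraph p ↔ ∃ h : x.1 ∈ p.1, p.2.2 ⟨x.1, h⟩ = (x.2 : B ⧸ p.2.1) := Iff.rfl

lemma subgroupOfGraph_injective :
    Function.Injective (subgroupOfGraph (A := A) (B := B)) := by
  rintro ⟨H, K, f⟩ ⟨H', K', f'⟩ h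
  have key : ∀ x : A × B, (∃ h : x.1 ∈ H, f ⟨x.1, h⟩ = (x.2 : B ⧸ K)) ↔
      (∃ h : x.1 ∈ H', f' ⟨x.1, h⟩ = (x.2 : B ⧸ K')) := fun x => by
    have := congrArg (fun S => x ∈ S) h
    simpa only [mem_subgroupOfGraph, eq_iff_iff] using this
  have hH : H = H' := by
    ext a
    constructor
    · intro ha
      obtain ⟨b, hb⟩ := QuotientAddGroup.mk_surjective (f ⟨a, ha⟩)
      exact ((key (a, b)).1 ⟨ha, hb.symm⟩).1
    · intro ha
      obtain ⟨b, hb⟩ := QuotientAddGroup.mk_surjective (f' ⟨a, ha⟩)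
      exact ((key (a, b)).2 ⟨ha, hb.symm⟩).1
  have hK : K = K' := by
    ext b
    have := key (0, b)
    have e1 : ∀ h : (0 : A) ∈ H, f ⟨0, h⟩ = 0 := fun _ => f.map_zero
    have e2 : ∀ h : (0 : A) ∈ H', f' ⟨0, h⟩ = 0 := fun _ => f'.map_zero
    simp only [e1, e2, H.zero_mem, H'.zero_mem, exists_true_left] at this
    rw [eq_comm, QuotientAddGroup.eq_zero_iff, eq_comm, QuotientAddGroup.eq_zero_iff] at this
    exact this
  subst hH hK
  have hf : f = f' := by
    ext ⟨a, ha⟩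
    obtain ⟨b, hb⟩ := QuotientAddGroup.mk_surjective (f ⟨a, ha⟩)
    obtain ⟨_, e⟩ := (key (a, b)).1 ⟨ha, hb.symm⟩
    rw [← hb]
    exact e.symm
  rw [hf]

lemma subgroupOfGraph_surjective :
    Function.Surjective (subgroupOfGraph (A := A) (B := B)) := by
  intro S
  let H : AddSubgroup A := S.map (AddMonoidHom.fst A B)
  let K : AddSubgroup B := S.comap (AddMonoidHom.inr A B)
  have hex : ∀ a : H, ∃ b : B, ((a : A), b) ∈ S := by
    rintro ⟨a, ha⟩
    obtain ⟨⟨a', b⟩, hx, rfl⟩ := AddSubgroup.mem_map.1 ha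
    exact ⟨b, hx⟩
  choose g hg using hex
  have hgK : ∀ (a : H) (b : B), ((a : A), b) ∈ S ↔ (g a : B ⧸ K) = b := by
    intro a b
    rw [QuotientAddGroup.eq]
    change _ ↔ ((0 : A), -g a + b) ∈ S
    constructor
    · intro h
      have := S.add_mem (S.neg_mem (hg a)) h
      simpa using this
    · intro h
      have := S.add_mem (hg a) h
      simpa using this
  let f : H →+ B ⧸ K :=
    { toFun := fun a => (g a : B ⧸ K)
      map_zero' := (hgK 0 0).1 S.zero_mem
      map_add' := fun a a' => by
        have := S.add_mem (hg a) (hg a')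
        exact (hgK (a + a') (g a + g a')).1 this }
  refine ⟨⟨H, K, f⟩, ?_⟩
  ext ⟨a, b⟩
  rw [mem_subgroupOfGraph]
  constructor
  · rintro ⟨h, e⟩
    exact (hgK ⟨a, h⟩ b).2 e
  · intro h
    have ha : a ∈ H := AddSubgroup.mem_map.2 ⟨(a, b), h, rfl⟩
    exact ⟨ha, (hgK ⟨a, ha⟩ b).1 h⟩

lemma card_addMonoidHom_of_isAddCyclic (A Q : Type*) [AddCommGroup A] [AddCommGroup Q]
    [IsAddCyclic A] [IsAddCyclic Q] [Finite A] [Finite Q] :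
    Nat.card (A →+ Q) = Nat.gcd (Nat.card A) (Nat.card Q) := by
  rw [Nat.gcd_comm, ← IsAddCyclic.card_nsmulAddMonoidHom_ker Q (Nat.card A)]
  obtain ⟨e⟩ : Nonempty (ZMod (Nat.card A) ≃+ A) := ⟨zmodAddCyclicAddEquiv inferInstance⟩
  refine Nat.card_congr ?_
  refine (e.addMonoidHomCongrLeft.symm.toEquiv.trans (ZMod.lift (Nat.card A)).symm).trans ?_
  refine Equiv.subtypeEquiv (zmultiplesHom Q).symm ?_
  intro f
  rw [AddMonoidHom.mem_ker]
  simp only [nsmulAddMonoidHom_apply]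
  have : f (Nat.card A : ℤ) = Nat.card A • f 1 := by
    rw [← map_nsmul]; simp
  rw [this]
  rfl

/-- A subgroup of a finite cyclic group is determined by its order, which can be any divisor of
the order of the group. -/
lemma sum_addSubgroup_card (A : Type*) [AddCommGroup A] [IsAddCyclic A] [Finite A]
    [Fintype (AddSubgroup A)] (F : ℕ → ℕ) :
    ∑ H : AddSubgroup A, F (Nat.card H) = ∑ i ∈ (Nat.card A).divisors, F i := by
  have hker : ∀ i ∈ (Nat.card A).divisors,
      Nat.card (nsmulAddMonoidHom i : A →+ A).ker = i := fun i hi => by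
    rw [IsAddCyclic.card_nsmulAddMonoidHom_ker, Nat.gcd_eq_right (Nat.dvd_of_mem_divisors hi)]
  refine Finset.sum_bij' (fun H _ => Nat.card H) (fun i _ => (nsmulAddMonoidHom i : A →+ A).ker)
    ?_ ?_ ?_ ?_ ?_
  · intro H _
    exact Nat.mem_divisors.2 ⟨AddSubgroup.card_addSubgroup_dvd_card H, Nat.card_pos.ne'⟩
  · intros; simp
  · intro H _
    symm
    apply AddSubgroup.eq_of_le_of_card_ge
    · intro x hx
      rw [AddMonoidHom.mem_ker, nsmulAddMonoidHom_apply]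
      have := card_nsmul_eq_zero' (x := (⟨x, hx⟩ : H))
      rw [Subtype.ext_iff] at this
      exact this
    · rw [hker]
      exact Nat.mem_divisors.2 ⟨AddSubgroup.card_addSubgroup_dvd_card H, Nat.card_pos.ne'⟩
  · intro i hi
    exact hker i hi
  · intros; rfl

/-- `s(m,n) = ∑_{i ∣ m, j ∣ n} gcd(i,j)`. -/
theorem s_eq_sum_gcd {m n : ℕ} (hm : m ≠ 0) (hn : n ≠ 0) :
    s m n = ∑ i ∈ m.divisors, ∑ j ∈ n.divisors, Nat.gcd i j := by
  have : NeZero m := ⟨hm⟩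
  have : NeZero n := ⟨hn⟩
  classical
  have := Fintype.ofFinite (AddSubgroup (ZMod m))
  have := Fintype.ofFinite (AddSubgroup (ZMod n))
  have hfin : ∀ (H : AddSubgroup (ZMod m)) (K : AddSubgroup (ZMod n)),
      Finite (H →+ ZMod n ⧸ K) := fun H K => DFunLike.finite _
  unfold s
  rw [← Nat.card_congr (Equiv.ofBijective _ ⟨subgroupOfGraph_injective (A := ZMod m) (B := ZMod n),
    subgroupOfGraph_surjective⟩), Nat.card_sigma]
  have h1 := sum_addSubgroup_card (ZMod m) (fun i => ∑ j ∈ n.divisors, Nat.gcd i j)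
  rw [Nat.card_zmod] at h1
  rw [← h1]
  refine Finset.sum_congr rfl fun H _ => ?_
  rw [Nat.card_sigma]
  have h2 := sum_addSubgroup_card (ZMod n) (fun k => Nat.gcd (Nat.card H) (n / k))
  rw [Nat.card_zmod, Nat.sum_div_divisors n (fun k => Nat.gcd (Nat.card H) k)] at h2
  rw [← h2]
  refine Finset.sum_congr rfl fun K _ => ?_
  have : IsAddCyclic (ZMod n ⧸ K) :=
    isAddCyclic_of_surjective (QuotientAddGroup.mk' K) (QuotientAddGroup.mk'_surjective K)
  rw [card_addMonoidHom_of_isAddCyclic]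
  congr 1
  have := AddSubgroup.card_eq_card_quotient_mul_card_addSubgroup K
  rw [Nat.card_zmod] at this
  exact (Nat.div_eq_of_eq_mul_left Nat.card_pos this).symm

lemma card_generators (G : Type*) [AddCommGroup G] [Fintype G] (H : AddSubgroup G)
    [IsAddCyclic H] [DecidablePred fun x : G => AddSubgroup.zmultiples x = H] :
    #{x : G | AddSubgroup.zmultiples x = H} = Nat.totient (Nat.card H) := by
  classical
  have := Fintype.ofFinite H
  rw [← IsAddCyclic.card_addOrderOf_eq_totient (α := H) (d := Nat.card H)
    (by rw [Nat.card_eq_fintype_card])]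
  symm
  refine Finset.card_bij (fun x _ => (x : G)) ?_ ?_ ?_
  · intro x hx
    simp only [mem_filter, mem_univ, true_and] at hx ⊢
    apply AddSubgroup.eq_of_le_of_card_ge
    · simp
    · rw [Nat.card_zmultiples, AddSubgroup.addOrderOf_coe, hx]
  · intro x _ y _ h
    exact Subtype.ext h
  · intro x hx
    simp only [mem_filter, mem_univ, true_and] at hx
    have hxH : x ∈ H := hx ▸ AddSubgroup.mem_zmultiples x
    refine ⟨⟨x, hxH⟩, ?_, rfl⟩
    simp only [mem_filter, mem_univ, true_and]
    rw [← AddSubgroup.addOrderOf_coe, ← Nat.card_zmultiples, hx]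

lemma card_cyclic_eq_sum (G : Type*) [AddCommGroup G] [Fintype G] :
    (Nat.card {H : AddSubgroup G // IsAddCyclic H} : ℚ)
      = ∑ x : G, ((Nat.totient (addOrderOf x) : ℚ))⁻¹ := by
  classical
  have := Fintype.ofFinite {H : AddSubgroup G // IsAddCyclic H}
  let π : G → {H : AddSubgroup G // IsAddCyclic H} := fun x =>
    ⟨AddSubgroup.zmultiples x, inferInstance⟩
  rw [← Finset.sum_fiberwise_of_maps_to (s := univ) (t := univ) (g := π) (fun _ _ => mem_univ _),
    Nat.card_eq_fintype_card, ← Finset.card_univ, Finset.cast_card]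
  refine Finset.sum_congr rfl fun H _ => ?_
  have hH := H.2
  have h1 : ∀ x ∈ ({x : G | π x = H} : Finset G),
      ((Nat.totient (addOrderOf x) : ℚ))⁻¹ = ((Nat.totient (Nat.card H.1) : ℚ))⁻¹ := by
    intro x hx
    simp only [mem_filter, mem_univ, true_and] at hx
    rw [← Nat.card_zmultiples, ← hx]
  rw [Finset.sum_congr rfl h1, Finset.sum_const]
  have h2 : #{x : G | π x = H} = Nat.totient (Nat.card H.1) := by
    rw [← card_generators G H.1]
    congr 1
    ext x
    simp only [mem_filter, mem_univ, true_and, π, Subtype.ext_iff]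
  rw [h2, nsmul_eq_mul, mul_inv_cancel₀]
  have : 0 < Nat.totient (Nat.card H.1) := Nat.totient_pos.2 Nat.card_pos
  exact_mod_cast this.ne'

lemma sum_addOrderOf (A : Type*) [AddCommGroup A] [IsAddCyclic A] [Fintype A] (F : ℕ → ℚ) :
    ∑ x : A, F (addOrderOf x) = ∑ i ∈ (Nat.card A).divisors, (Nat.totient i : ℚ) * F i := by
  classical
  rw [← Finset.sum_fiberwise_of_maps_to (s := univ) (t := (Nat.card A).divisors)
    (g := fun x : A => addOrderOf x)
    (fun x _ => Nat.mem_divisors.2 ⟨addOrderOf_dvd_natCard x, Nat.card_pos.ne'⟩)]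
  refine Finset.sum_congr rfl fun i hi => ?_
  rw [← IsAddCyclic.card_addOrderOf_eq_totient (α := A) (d := i)
    (by rw [← Nat.card_eq_fintype_card]; exact Nat.dvd_of_mem_divisors hi), ← nsmul_eq_mul,
    ← Finset.sum_const]
  refine Finset.sum_congr rfl fun x hx => ?_
  rw [(Finset.mem_filter.1 hx).2]

lemma totient_gcd_mul_totient_lcm {a b : ℕ} (ha : a ≠ 0) :
    Nat.totient (Nat.gcd a b) * Nat.totient (Nat.lcm a b) = Nat.totient a * Nat.totient b := by
  have h1 := Nat.totient_gcd_mul_totient_mul a b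
  have h2 := Nat.totient_gcd_mul_totient_mul (a.gcd b) (a.lcm b)
  rw [Nat.gcd_mul_lcm, Nat.gcd_eq_left ((Nat.gcd_dvd_left a b).trans (Nat.dvd_lcm_left a b)),
    h1] at h2
  have : 0 < Nat.gcd a b := Nat.gcd_pos_of_pos_left _ (Nat.pos_of_ne_zero ha)
  exact (Nat.eq_of_mul_eq_mul_right this h2).symm

/-- `c(m,n) = ∑_{i ∣ m, j ∣ n} φ(gcd(i,j))`: a cyclic subgroup of order `k` has `φ(k)` generators,
and there are `φ(i) φ(j)` pairs of elements of orders `i` and `j`, which have order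
`lcm(i,j)`. -/
theorem c_eq_sum_totient_gcd {m n : ℕ} (hm : m ≠ 0) (hn : n ≠ 0) :
    c m n = ∑ i ∈ m.divisors, ∑ j ∈ n.divisors, Nat.totient (Nat.gcd i j) := by
  have : NeZero m := ⟨hm⟩
  have : NeZero n := ⟨hn⟩
  have h : (c m n : ℚ) = ((∑ i ∈ m.divisors, ∑ j ∈ n.divisors, Nat.totient (Nat.gcd i j) : ℕ) : ℚ) := by
    unfold c
    rw [card_cyclic_eq_sum, Fintype.sum_prod_type]
    simp only [Prod.addOrderOf_mk]
    have h1 : ∀ x : ZMod m, ∑ y : ZMod n, ((Nat.totient ((addOrderOf x).lcm (addOrderOf y)) : ℚ))⁻¹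
        = ∑ j ∈ n.divisors, (Nat.totient j : ℚ)
            * ((Nat.totient ((addOrderOf x).lcm j) : ℚ))⁻¹ := fun x => by
      rw [sum_addOrderOf (ZMod n) (fun j => ((Nat.totient ((addOrderOf x).lcm j) : ℚ))⁻¹),
        Nat.card_zmod]
    rw [Finset.sum_congr rfl fun x _ => h1 x, sum_addOrderOf (ZMod m)
      (fun i => ∑ j ∈ n.divisors, (Nat.totient j : ℚ) * ((Nat.totient (i.lcm j) : ℚ))⁻¹),
      Nat.card_zmod]
    push_cast
    refine Finset.sum_congr rfl fun i hi => ?_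
    rw [Finset.mul_sum]
    refine Finset.sum_congr rfl fun j hj => ?_
    have hi0 : i ≠ 0 := (Nat.pos_of_mem_divisors hi).ne'
    have hj0 : j ≠ 0 := (Nat.pos_of_mem_divisors hj).ne'
    have := totient_gcd_mul_totient_lcm (b := j) hi0
    have hpos : 0 < Nat.totient (Nat.lcm i j) :=
      Nat.totient_pos.2 (Nat.pos_of_ne_zero (Nat.lcm_ne_zero hi0 hj0))
    have hq : (Nat.totient (Nat.lcm i j) : ℚ) ≠ 0 := by exact_mod_cast hpos.ne'
    rw [← mul_assoc, ← div_eq_mul_inv, div_eq_iff hq]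
    exact_mod_cast this.symm
  exact_mod_cast h

end Group

end SubgroupCount

namespace SubgroupCount

open Finset ArithmeticFunction
open scoped ArithmeticFunction.zeta ArithmeticFunction.Moebius

/-! ### Reduction to a Riesz mean of a Dirichlet convolution -/

noncomputable section Convolution

/-- The arithmetic function `d² ↦ w(d)`, vanishing off the squares. Its Dirichlet series at `z` is
that of `w` at `2z`. -/
def squareSupport (w : ArithmeticFunction ℝ) : ArithmeticFunction ℝ where
  toFun n := if IsSquare n then w (Nat.sqrt n) else 0
  map_zero' := by simp

@[simp] lemma squareSupport_mul_self (w : ArithmeticFunction ℝ) (d : ℕ) :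
    squareSupport w (d * d) = w d := by
  change (if IsSquare (d * d) then w (Nat.sqrt (d * d)) else 0) = _
  rw [if_pos ⟨d, rfl⟩, Nat.sqrt_eq]

lemma squareSupport_of_not_isSquare (w : ArithmeticFunction ℝ) {n : ℕ} (h : ¬ IsSquare n) :
    squareSupport w n = 0 := if_neg h

/-- The logarithmic Riesz mean `∑_{n ≤ x} b(n) log(x / n)`. -/
def rieszSum (b : ArithmeticFunction ℝ) (x : ℝ) : ℝ :=
  ∑ n ∈ Ioc 0 ⌊x⌋₊, b n * Real.log (x / n)

lemma rieszSum_eq_zero (b : ArithmeticFunction ℝ) {x : ℝ} (hx : x < 1) : rieszSum b x = 0 := by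
  unfold rieszSum
  rw [Nat.floor_eq_zero.2 hx]
  simp

/-- The function `d ↦ 1`, `n ↦ 0` for `n ≠ d`, whose Dirichlet series is `d^{-z}`. -/
def pointMass (d : ℕ) : ArithmeticFunction ℝ where
  toFun n := if n = d ∧ n ≠ 0 then 1 else 0
  map_zero' := by simp

lemma pointMass_apply (d n : ℕ) : pointMass d n = if n = d ∧ n ≠ 0 then 1 else 0 := rfl

lemma pointMass_mul_pointMass (d e : ℕ) :
    pointMass d * pointMass e = pointMass (d * e) := by
  ext n
  rw [mul_apply]
  simp only [pointMass_apply, ← ite_and, mul_ite, mul_one, mul_zero]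
  by_cases h : n = d * e ∧ n ≠ 0
  · rw [if_pos h, Finset.sum_eq_single (d, e)]
    · obtain ⟨rfl, h0⟩ := h
      simpa using And.intro (right_ne_zero_of_mul h0) (left_ne_zero_of_mul h0)
    · rintro ⟨a, b⟩ _ hne
      rw [if_neg]
      rintro ⟨⟨hb, _⟩, ha, _⟩
      exact hne (by simp_all)
    · intro hmem
      exact absurd (Nat.mem_divisorsAntidiagonal.2 ⟨h.1.symm, h.2⟩) hmem
  · rw [if_neg h]
    refine Finset.sum_eq_zero ?_
    rintro ⟨a, b⟩ hab
    rw [Nat.mem_divisorsAntidiagonal] at hab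
    rw [if_neg]
    rintro ⟨⟨hb, _⟩, ha, _⟩
    simp only at hb ha hab
    exact h ⟨by rw [← hab.1, ha, hb], hab.2⟩

lemma zeta_mul_pointMass {d i : ℕ} (hi : i ≠ 0) :
    ((ζ : ArithmeticFunction ℝ) * pointMass d) i = if d ∣ i then 1 else 0 := by
  rw [coe_zeta_mul_apply]
  by_cases h : d ∣ i
  · rw [if_pos h, Finset.sum_eq_single d]
    · rw [pointMass_apply, if_pos ⟨rfl, fun h0 => hi (by simpa [h0] using h)⟩]
    · intro b _ hb
      rw [pointMass_apply, if_neg (fun h => hb h.1)]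
    · intro h'
      exact absurd (Nat.mem_divisors.2 ⟨h, hi⟩) h'
  · rw [if_neg h]
    refine Finset.sum_eq_zero fun b hb => ?_
    rw [pointMass_apply, if_neg]
    rintro ⟨rfl, _⟩
    exact h (Nat.dvd_of_mem_divisors hb)

lemma squareSupport_eq_sum_pointMass (w : ArithmeticFunction ℝ) {n N : ℕ} (hn : n ≤ N) :
    squareSupport w n = ∑ d ∈ Ioc 0 N, w d * pointMass (d * d) n := by
  rcases Nat.eq_zero_or_pos n with rfl | h0
  · simp
  by_cases h : IsSquare n
  · obtain ⟨d, rfl⟩ := h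
    have hd : 0 < d := by
      rcases Nat.eq_zero_or_pos d with rfl | h
      · simp at h0
      · exact h
    rw [squareSupport_mul_self, Finset.sum_eq_single d]
    · rw [pointMass_apply, if_pos ⟨rfl, h0.ne'⟩, mul_one]
    · intro b _ hb
      rw [pointMass_apply, if_neg, mul_zero]
      rintro ⟨h, _⟩
      exact hb (Nat.mul_self_inj.1 h).symm
    · intro h'
      exact absurd (Finset.mem_Ioc.2 ⟨hd, (Nat.le_mul_self d).trans hn⟩) h'
  · rw [squareSupport_of_not_isSquare w h]
    symm
    refine Finset.sum_eq_zero fun d _ => ?_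
    rw [pointMass_apply, if_neg, mul_zero]
    rintro ⟨h', _⟩
    exact h ⟨d, h'⟩

/-- Summing `∑_{i ∣ m, j ∣ n} ∑_{d ∣ gcd(i,j)} w(d)` over `mn = N` gives the coefficient at `N` of
`ζ(z)⁴ ∑ w(d) d^{-2z}`. -/
lemma sum_divisors_gcd_eq_convolution (w : ArithmeticFunction ℝ) {N : ℕ} (hN : N ≠ 0) :
    ∑ p ∈ N.divisorsAntidiagonal, ∑ i ∈ p.1.divisors, ∑ j ∈ p.2.divisors,
        ∑ d ∈ (Nat.gcd i j).divisors, w d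
      = (((ζ : ArithmeticFunction ℝ) ^ 4) * squareSupport w) N := by
  have h1 : ∀ p ∈ N.divisorsAntidiagonal, ∑ i ∈ p.1.divisors, ∑ j ∈ p.2.divisors,
      ∑ d ∈ (Nat.gcd i j).divisors, w d
      = ∑ d ∈ Ioc 0 N, w d * (((ζ : ArithmeticFunction ℝ) * (ζ * pointMass d)) p.1
          * ((ζ : ArithmeticFunction ℝ) * (ζ * pointMass d)) p.2) := by
    intro p hp
    rw [Nat.mem_divisorsAntidiagonal] at hp
    have h2 : ∀ i ∈ p.1.divisors, ∀ j ∈ p.2.divisors, ∑ d ∈ (Nat.gcd i j).divisors, w d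
        = ∑ d ∈ Ioc 0 N, w d * (((ζ : ArithmeticFunction ℝ) * pointMass d) i
          * ((ζ : ArithmeticFunction ℝ) * pointMass d) j) := by
      intro i hi j hj
      have hi0 := (Nat.pos_of_mem_divisors hi).ne'
      have hj0 := (Nat.pos_of_mem_divisors hj).ne'
      have hiN : i ≤ N := Nat.le_of_dvd (Nat.pos_of_ne_zero hN)
        ((Nat.dvd_of_mem_divisors hi).trans (hp.1 ▸ Nat.dvd_mul_right _ _))
      have hsub : (Nat.gcd i j).divisors = {d ∈ Ioc 0 N | d ∣ i ∧ d ∣ j} := by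
        ext d
        simp only [Nat.mem_divisors, mem_filter, mem_Ioc, Nat.dvd_gcd_iff]
        constructor
        · rintro ⟨h, _⟩
          exact ⟨⟨Nat.pos_of_dvd_of_pos h.1 (Nat.pos_of_ne_zero hi0),
            (Nat.le_of_dvd (Nat.pos_of_ne_zero hi0) h.1).trans hiN⟩, h⟩
        · rintro ⟨_, h⟩
          exact ⟨h, fun h' => hi0 (Nat.gcd_eq_zero_iff.1 h').1⟩
      rw [hsub, Finset.sum_filter]
      refine Finset.sum_congr rfl fun d _ => ?_
      rw [zeta_mul_pointMass hi0, zeta_mul_pointMass hj0]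
      by_cases h3 : d ∣ i <;> by_cases h4 : d ∣ j <;> simp [h3, h4]
    rw [Finset.sum_congr rfl fun i hi => Finset.sum_congr rfl fun j hj => h2 i hi j hj]
    rw [Finset.sum_congr rfl fun i _ => Finset.sum_comm, Finset.sum_comm]
    refine Finset.sum_congr rfl fun d _ => ?_
    rw [coe_zeta_mul_apply, coe_zeta_mul_apply, Finset.sum_mul_sum, Finset.mul_sum]
    refine Finset.sum_congr rfl fun i _ => ?_
    rw [Finset.mul_sum]
  rw [Finset.sum_congr rfl h1, Finset.sum_comm]
  have h5 : ∀ d ∈ Ioc 0 N, ∑ p ∈ N.divisorsAntidiagonal,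
      w d * (((ζ : ArithmeticFunction ℝ) * (ζ * pointMass d)) p.1
          * ((ζ : ArithmeticFunction ℝ) * (ζ * pointMass d)) p.2)
      = w d * (((ζ : ArithmeticFunction ℝ) ^ 4) * pointMass (d * d)) N := by
    intro d _
    rw [← Finset.mul_sum, ← mul_apply, ← pointMass_mul_pointMass]
    congr 2
    ring
  rw [Finset.sum_congr rfl h5]
  simp only [mul_apply (f := (ζ : ArithmeticFunction ℝ) ^ 4)]
  simp_rw [Finset.mul_sum]
  rw [Finset.sum_comm]
  refine Finset.sum_congr rfl fun p hp => ?_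
  rw [Nat.mem_divisorsAntidiagonal] at hp
  rw [squareSupport_eq_sum_pointMass w (N := N)
    (Nat.le_of_dvd (Nat.pos_of_ne_zero hN) (hp.1 ▸ Nat.dvd_mul_left _ _)), Finset.mul_sum]
  refine Finset.sum_congr rfl fun d _ => ?_
  ring

lemma sum_Ioc_sum_divisorsAntidiagonal (F : ℕ × ℕ → ℝ) (N : ℕ) :
    ∑ n ∈ Ioc 0 N, ∑ p ∈ n.divisorsAntidiagonal, F p
      = ∑ p ∈ (Ioc 0 N ×ˢ Ioc 0 N).filter (fun p => p.1 * p.2 ≤ N), F p := by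
  trans ∑ n ∈ Ioc 0 N, ∑ p ∈ (Ioc 0 N ×ˢ Ioc 0 N).filter (fun p => p.1 * p.2 = n), F p
  · refine sum_congr rfl fun n hn => ?_
    simp only [mem_Ioc] at hn
    rw [Nat.divisorsAntidiagonal_eq_prod_filter_of_le hn.1.ne' hn.2]
  · simp_rw [sum_filter]
    rw [sum_comm]
    exact sum_congr rfl fun _ _ => (by simp_all)

lemma logWeightedSum_eq_rieszSum (f : ℕ → ℕ → ℕ) (w : ArithmeticFunction ℝ)
    (hf : ∀ m n : ℕ, m ≠ 0 → n ≠ 0 →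
      (f m n : ℝ) = ∑ i ∈ m.divisors, ∑ j ∈ n.divisors, ∑ d ∈ (Nat.gcd i j).divisors, w d)
    {x : ℝ} (hx : 0 ≤ x) :
    logWeightedSum f x = rieszSum ((ζ : ArithmeticFunction ℝ) ^ 4 * squareSupport w) x := by
  unfold logWeightedSum rieszSum
  have h1 : ∀ n ∈ Ioc 0 ⌊x⌋₊, ((ζ : ArithmeticFunction ℝ) ^ 4 * squareSupport w) n
      * Real.log (x / n) = ∑ p ∈ n.divisorsAntidiagonal,
        (f p.1 p.2 : ℝ) * Real.log (x / ((p.1 : ℝ) * (p.2 : ℝ))) := by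
    intro n hn
    rw [← sum_divisors_gcd_eq_convolution w (mem_Ioc.1 hn).1.ne', Finset.sum_mul]
    refine Finset.sum_congr rfl fun p hp => ?_
    rw [Nat.mem_divisorsAntidiagonal] at hp
    have hp0 : p.1 * p.2 ≠ 0 := by rw [hp.1]; exact hp.2
    rw [hf _ _ (left_ne_zero_of_mul hp0) (right_ne_zero_of_mul hp0), ← hp.1, Nat.cast_mul]
  rw [Finset.sum_congr rfl h1, sum_Ioc_sum_divisorsAntidiagonal]
  refine Finset.sum_congr ?_ fun _ _ => rfl
  ext p
  have : ((p.1 : ℝ) * (p.2 : ℝ) ≤ x) ↔ p.1 * p.2 ≤ ⌊x⌋₊ := by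
    rw [Nat.le_floor_iff hx, Nat.cast_mul]
  simp only [mem_filter, mem_product, mem_Icc, mem_Ioc, this, Nat.one_le_iff_ne_zero,
    Nat.pos_iff_ne_zero]

/-- The Riesz mean of a convolution with a function supported on squares. -/
lemma rieszSum_mul_squareSupport (f v : ArithmeticFunction ℝ) {x : ℝ} (hx : 0 ≤ x) :
    rieszSum (f * squareSupport v) x
      = ∑ m ∈ Ioc 0 ⌊x⌋₊, v m * rieszSum f (x / (m : ℝ) ^ 2) := by
  unfold rieszSum
  set N := ⌊x⌋₊ with hN
  have h1 : ∀ n ∈ Ioc 0 N, (f * squareSupport v) n * Real.log (x / n)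
      = ∑ p ∈ n.divisorsAntidiagonal, f p.1 * squareSupport v p.2
        * Real.log (x / ((p.1 : ℝ) * (p.2 : ℝ))) := by
    intro n hn
    rw [mul_apply, Finset.sum_mul]
    refine Finset.sum_congr rfl fun p hp => ?_
    rw [Nat.mem_divisorsAntidiagonal] at hp
    rw [← hp.1, Nat.cast_mul]
  rw [Finset.sum_congr rfl h1, sum_Ioc_sum_divisorsAntidiagonal, sum_filter, sum_product_right]
  have h2 : ∀ b ∈ Ioc 0 N, ∑ a ∈ Ioc 0 N, (if (a, b).1 * (a, b).2 ≤ N then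
      f (a, b).1 * squareSupport v (a, b).2 * Real.log (x / (((a, b).1 : ℝ) * ((a, b).2 : ℝ)))
        else 0)
      = squareSupport v b * ∑ a ∈ Ioc 0 ⌊x / b⌋₊, f a * Real.log (x / b / a) := by
    intro b hb
    rw [← sum_filter, Finset.mul_sum]
    have hb0 := (mem_Ioc.1 hb).1
    refine Finset.sum_congr ?_ ?_
    · ext a
      simp only [mem_filter, mem_Ioc, Nat.floor_div_natCast, ← hN, Nat.le_div_iff_mul_le hb0]
      constructor
      · rintro ⟨⟨h, _⟩, h'⟩
        exact ⟨h, h'⟩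
      · rintro ⟨h, h'⟩
        exact ⟨⟨h, le_trans (Nat.le_mul_of_pos_right a hb0) h'⟩, h'⟩
    · intro a _
      rw [div_div, mul_comm (b : ℝ) (a : ℝ)]
      ring
  rw [Finset.sum_congr rfl h2]
  have h3 : ∀ b ∈ Ioc 0 N, squareSupport v b * ∑ a ∈ Ioc 0 ⌊x / b⌋₊, f a * Real.log (x / b / a)
      = ∑ m ∈ Ioc 0 N, v m * (pointMass (m * m) b
          * ∑ a ∈ Ioc 0 ⌊x / b⌋₊, f a * Real.log (x / b / a)) := by
    intro b hb
    rw [squareSupport_eq_sum_pointMass v (mem_Ioc.1 hb).2, Finset.sum_mul]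
    exact Finset.sum_congr rfl fun _ _ => by ring
  rw [Finset.sum_congr rfl h3, Finset.sum_comm]
  refine Finset.sum_congr rfl fun m hm => ?_
  rw [← Finset.mul_sum]
  congr 1
  have hm0 := (mem_Ioc.1 hm).1
  by_cases hmN : m * m ≤ N
  · rw [Finset.sum_eq_single (m * m)]
    · rw [pointMass_apply, if_pos ⟨rfl, (Nat.mul_pos hm0 hm0).ne'⟩, one_mul, Nat.cast_mul, pow_two]
    · intro b _ hb
      rw [pointMass_apply, if_neg (fun h => hb h.1), zero_mul]
    · intro h
      exact absurd (mem_Ioc.2 ⟨Nat.mul_pos hm0 hm0, hmN⟩) h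
  · rw [Finset.sum_eq_zero]
    · symm
      rw [Nat.floor_eq_zero.2, Ioc_self, Finset.sum_empty]
      rw [div_lt_one (by positivity)]
      rw [not_le, hN, Nat.floor_lt hx] at hmN
      rw [pow_two]
      exact_mod_cast hmN
    · intro b hb
      rw [pointMass_apply, if_neg, zero_mul]
      rintro ⟨rfl, _⟩
      exact hmN (mem_Ioc.1 hb).2

lemma squareSupport_mul (v w : ArithmeticFunction ℝ) :
    squareSupport (v * w) = squareSupport v * squareSupport w := by
  ext n
  by_cases h : IsSquare n
  · obtain ⟨D, rfl⟩ := h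
    rw [squareSupport_mul_self, mul_apply, mul_apply]
    refine Finset.sum_bij_ne_zero (fun p _ _ => (p.1 * p.1, p.2 * p.2)) ?_ ?_ ?_ ?_
    · intro p hp _
      rw [Nat.mem_divisorsAntidiagonal] at hp ⊢
      exact ⟨by rw [← hp.1]; ring, mul_ne_zero hp.2 hp.2⟩
    · intro p _ _ q _ _ h
      simp only [Prod.mk.injEq, Nat.mul_self_inj] at h
      exact Prod.ext h.1 h.2
    · rintro ⟨a, b⟩ hab hne
      have ha : IsSquare a := by
        by_contra hh
        exact hne (by rw [squareSupport_of_not_isSquare v hh, zero_mul])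
      have hb : IsSquare b := by
        by_contra hh
        exact hne (by rw [squareSupport_of_not_isSquare w hh, mul_zero])
      obtain ⟨d, rfl⟩ := ha
      obtain ⟨e, rfl⟩ := hb
      rw [Nat.mem_divisorsAntidiagonal] at hab
      refine ⟨(d, e), ?_, ?_, rfl⟩
      · rw [Nat.mem_divisorsAntidiagonal]
        refine ⟨Nat.mul_self_inj.1 (by rw [← hab.1]; ring), fun h0 => hab.2 (by rw [h0])⟩
      · simpa using hne
    · intro p _ _
      simp
  · rw [squareSupport_of_not_isSquare _ h, mul_apply]
    symm
    refine Finset.sum_eq_zero fun p hp => ?_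
    rw [Nat.mem_divisorsAntidiagonal] at hp
    by_cases h1 : IsSquare p.1
    · have h2 : ¬ IsSquare p.2 := fun h2 => h (hp.1 ▸ h1.mul h2)
      rw [squareSupport_of_not_isSquare w h2, mul_zero]
    · rw [squareSupport_of_not_isSquare v h1, zero_mul]

/-- The identity function, with Dirichlet series `ζ(z - 1)`. -/
def idFun : ArithmeticFunction ℝ := ⟨fun n => (n : ℝ), by simp⟩

lemma idFun_apply (n : ℕ) : idFun n = n := rfl

/-- The Möbius function as a real arithmetic function. -/
abbrev moebiusR : ArithmeticFunction ℝ := ((μ : ArithmeticFunction ℤ) : ArithmeticFunction ℝ)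

lemma sum_divisors_mul_moebiusR (f : ArithmeticFunction ℝ) (k : ℕ) :
    ∑ d ∈ k.divisors, (f * moebiusR) d = f k := by
  rw [← coe_mul_zeta_apply, mul_assoc, coe_moebius_mul_coe_zeta, mul_one]

lemma idFun_mul_moebiusR (k : ℕ) : (idFun * moebiusR) k = (Nat.totient k : ℝ) := by
  let φ : ArithmeticFunction ℝ := ⟨fun n => (Nat.totient n : ℝ), by simp⟩
  have h : idFun = φ * (ζ : ArithmeticFunction ℝ) := by
    ext n
    rw [coe_mul_zeta_apply, idFun_apply]
    change (n : ℝ) = ∑ i ∈ n.divisors, (Nat.totient i : ℝ)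
    exact_mod_cast (Nat.sum_totient n).symm
  rw [h, mul_assoc, coe_zeta_mul_coe_moebius, mul_one]
  rfl

/-- The Dirichlet coefficients of `ζ(z)⁴ ζ(2z-1)`. -/
def baseCoeff : ArithmeticFunction ℝ := (ζ : ArithmeticFunction ℝ) ^ 4 * squareSupport idFun

/-- The Dirichlet series of `∑_{mn=N} s(m,n)` is `ζ(z)⁴ ζ(2z-1) / ζ(2z)`. -/
theorem logWeightedSum_s {x : ℝ} (hx : 0 ≤ x) :
    logWeightedSum s x = rieszSum (baseCoeff * squareSupport moebiusR) x := by
  rw [logWeightedSum_eq_rieszSum s (idFun * moebiusR) _ hx, squareSupport_mul, baseCoeff, mul_assoc]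
  intro m n hm hn
  rw [s_eq_sum_gcd hm hn]
  push_cast
  refine Finset.sum_congr rfl fun i _ => Finset.sum_congr rfl fun j _ => ?_
  rw [sum_divisors_mul_moebiusR, idFun_apply]

/-- The Dirichlet series of `∑_{mn=N} c(m,n)` is `ζ(z)⁴ ζ(2z-1) / ζ(2z)²`. -/
theorem logWeightedSum_c {x : ℝ} (hx : 0 ≤ x) :
    logWeightedSum c x
      = rieszSum (baseCoeff * squareSupport moebiusR * squareSupport moebiusR) x := by
  rw [logWeightedSum_eq_rieszSum c (idFun * moebiusR * moebiusR) _ hx, squareSupport_mul,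
    squareSupport_mul, baseCoeff, mul_assoc, mul_assoc, mul_assoc]
  intro m n hm hn
  rw [c_eq_sum_totient_gcd hm hn]
  push_cast
  refine Finset.sum_congr rfl fun i _ => Finset.sum_congr rfl fun j _ => ?_
  rw [sum_divisors_mul_moebiusR, idFun_mul_moebiusR]

end Convolution

end SubgroupCount

namespace SubgroupCount

open Finset

/-! ### Exponential sums: the first and second derivative tests -/

section ExponentialSums

/-- `1 / (1 - e^{ig}) = 1/2 + (i/2) cot(g/2)`. -/
lemma half_add_cot_mul_one_sub_exp {g : ℝ} (hg : Real.sin (g / 2) ≠ 0) :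
    (1 / 2 + (Real.cos (g / 2) / (2 * Real.sin (g / 2)) : ℝ) * Complex.I)
      * (1 - Complex.exp (g * Complex.I)) = 1 := by
  have h1 : Complex.exp (g * Complex.I)
      = ((1 - 2 * Real.sin (g / 2) ^ 2 : ℝ) : ℂ)
        + ((2 * Real.sin (g / 2) * Real.cos (g / 2) : ℝ) : ℂ) * Complex.I := by
    rw [Complex.exp_mul_I, ← Complex.ofReal_cos, ← Complex.ofReal_sin]
    have e : g = 2 * (g / 2) := by ring
    congr 2
    · conv_lhs => rw [e, Real.cos_two_mul]
      have := Real.sin_sq_add_cos_sq (g / 2)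
      linarith
    · conv_lhs => rw [e, Real.sin_two_mul]
  rw [h1]
  have hs := Real.sin_sq_add_cos_sq (g / 2)
  set S := Real.sin (g / 2)
  set C := Real.cos (g / 2)
  have hq : (2 * S : ℂ) * ((C / (2 * S) : ℝ) : ℂ) = C := by
    push_cast
    have : (S : ℂ) ≠ 0 := by exact_mod_cast hg
    field_simp
  have hs' : (S : ℂ) ^ 2 + (C : ℂ) ^ 2 = 1 := by exact_mod_cast hs
  generalize ((C / (2 * S) : ℝ) : ℂ) = q at hq ⊢
  push_cast
  linear_combination (S * Complex.I - C * Complex.I ^ 2) * hq + hs'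
    - (C : ℂ) ^ 2 * Complex.I_sq

lemma div_pi_le_sin_half {g δ : ℝ} (hδ : 0 < δ) (h1 : δ ≤ g) (h2 : g ≤ 2 * Real.pi - δ) :
    δ / Real.pi ≤ Real.sin (g / 2) := by
  have hpi := Real.pi_pos
  rcases le_total (g / 2) (Real.pi / 2) with h | h
  · have := Real.mul_le_sin (x := g / 2) (by linarith) h
    refine le_trans ?_ this
    rw [div_le_iff₀ hpi]
    field_simp
    linarith
  · have := Real.mul_le_sin (x := Real.pi - g / 2) (by linarith) (by linarith)
    rw [Real.sin_pi_sub] at this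
    refine le_trans ?_ this
    rw [div_le_iff₀ hpi]
    field_simp
    linarith

lemma cot_half_le {g g' δ : ℝ} (hδ : 0 < δ) (h1 : δ ≤ g') (h : g' ≤ g)
    (h2 : g ≤ 2 * Real.pi - δ) :
    Real.cos (g / 2) / (2 * Real.sin (g / 2)) ≤ Real.cos (g' / 2) / (2 * Real.sin (g' / 2)) := by
  have hpi := Real.pi_pos
  have p1 : 0 < Real.sin (g / 2) :=
    lt_of_lt_of_le (by positivity) (div_pi_le_sin_half hδ (h1.trans h) h2)
  have p2 : 0 < Real.sin (g' / 2) :=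
    lt_of_lt_of_le (by positivity) (div_pi_le_sin_half hδ h1 (h.trans h2))
  rw [div_le_div_iff₀ (by positivity) (by positivity)]
  have : 0 ≤ Real.sin (g / 2 - g' / 2) :=
    Real.sin_nonneg_of_nonneg_of_le_pi (by linarith) (by linarith)
  rw [Real.sin_sub] at this
  nlinarith

/-- **Kusmin–Landau inequality**: if the increments `g(n) = α(n+1) - α(n)` are decreasing and stay
at distance `δ` from the multiples of `2π`, then `∑ e^{iα(n)}` is at most `2π / δ`. -/
lemma norm_sum_exp_le_of_increments {α : ℕ → ℝ} {a b : ℕ} {δ : ℝ} (hδ : 0 < δ)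
    (h1 : ∀ n, a ≤ n → n < b → δ ≤ α (n + 1) - α n)
    (h2 : ∀ n, a ≤ n → n < b → α (n + 1) - α n ≤ 2 * Real.pi - δ)
    (h3 : ∀ n, a ≤ n → n + 1 < b → α (n + 2) - α (n + 1) ≤ α (n + 1) - α n) :
    ‖∑ n ∈ Ico a b, Complex.exp (α n * Complex.I)‖ ≤ 2 * Real.pi / δ := by
  have hpi := Real.pi_pos
  rcases le_or_gt b a with hab | hab
  · rw [Ico_eq_empty (by omega)]
    simp only [sum_empty, norm_zero]
    positivity
  set u : ℕ → ℂ := fun n => Complex.exp (α n * Complex.I) with hu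
  set g : ℕ → ℝ := fun n => α (n + 1) - α n with hg
  set k : ℕ → ℝ := fun n => Real.cos (g n / 2) / (2 * Real.sin (g n / 2)) with hk
  set C : ℕ → ℂ := fun n => 1 / 2 + (k n : ℂ) * Complex.I with hC
  have hun : ∀ n, ‖u n‖ = 1 := fun n => Complex.norm_exp_ofReal_mul_I _
  have hsin : ∀ n, a ≤ n → n < b → δ / Real.pi ≤ Real.sin (g n / 2) := fun n hn hn' =>
    div_pi_le_sin_half hδ (h1 n hn hn') (h2 n hn hn')
  have hstep : ∀ n, a ≤ n → n < b → u n = C n * (u n - u (n + 1)) := by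
    intro n hn hn'
    have hs : Real.sin (g n / 2) ≠ 0 := by
      have := hsin n hn hn'
      have : 0 < δ / Real.pi := by positivity
      linarith
    have h := half_add_cot_mul_one_sub_exp hs
    have hmul : u (n + 1) = u n * Complex.exp (g n * Complex.I) := by
      simp only [hu, hg]
      rw [← Complex.exp_add]
      congr 1
      push_cast
      ring
    rw [hmul]
    have h' : C n * (1 - Complex.exp (g n * Complex.I)) = 1 := h
    linear_combination -(u n) * h'
  have hkbound : ∀ n, a ≤ n → n < b → |k n| ≤ Real.pi / (2 * δ) := by
    intro n hn hn'
    have hs := hsin n hn hn'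
    have hp : 0 < δ / Real.pi := by positivity
    simp only [hk]
    rw [abs_div, abs_of_pos (a := 2 * Real.sin (g n / 2)) (by linarith)]
    calc |Real.cos (g n / 2)| / (2 * Real.sin (g n / 2)) ≤ 1 / (2 * (δ / Real.pi)) := by
          apply div_le_div₀ (by norm_num) (Real.abs_cos_le_one _) (by positivity) (by linarith)
      _ = Real.pi / (2 * δ) := by field_simp
  have hCbound : ∀ n, a ≤ n → n < b → ‖C n‖ ≤ Real.pi / (2 * δ) := by
    intro n hn hn'
    have hs := hsin n hn hn'
    have hp : 0 < δ / Real.pi := by positivity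
    have hs0 : 0 < Real.sin (g n / 2) := by linarith
    have hsq : ‖C n‖ ^ 2 = (1 / (2 * Real.sin (g n / 2))) ^ 2 := by
      have e : C n = ((1 / 2 : ℝ) : ℂ) + (k n : ℂ) * Complex.I := by simp [hC]
      rw [e, ← Complex.normSq_eq_norm_sq, Complex.normSq_add_mul_I]
      simp only [hk]
      field_simp
      have := Real.sin_sq_add_cos_sq (g n / 2)
      linarith
    have : ‖C n‖ = 1 / (2 * Real.sin (g n / 2)) := by
      rwa [sq_eq_sq₀ (norm_nonneg _) (by positivity)] at hsq
    rw [this]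
    calc 1 / (2 * Real.sin (g n / 2)) ≤ 1 / (2 * (δ / Real.pi)) := by
          apply div_le_div_of_nonneg_left (by norm_num) (by positivity) (by linarith)
      _ = Real.pi / (2 * δ) := by field_simp
  have key : ∀ m, a + m < b →
      ‖∑ n ∈ Ico a (a + m + 1), u n + C (a + m) * u (a + m + 1)‖ ≤ ‖C a‖ + (k (a + m) - k a) := by
    intro m
    induction m with
    | zero =>
      intro hm
      simp only [Nat.add_zero, Nat.Ico_succ_singleton, sum_singleton]
      have e : u a + C a * u (a + 1) = C a * u a := by
        conv_lhs => rw [hstep a le_rfl hab]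
        ring
      rw [e, norm_mul, hun, mul_one]
      simp
    | succ m ih =>
      intro hm
      have ih' := ih (by omega)
      have hs := hstep (a + m + 1) (by omega) (by omega)
      rw [show a + (m + 1) = a + m + 1 by ring, sum_Ico_succ_top (by omega)]
      have e : ∑ n ∈ Ico a (a + m + 1), u n + u (a + m + 1) + C (a + m + 1) * u (a + m + 1 + 1)
          = (∑ n ∈ Ico a (a + m + 1), u n + C (a + m) * u (a + m + 1))
            + (C (a + m + 1) - C (a + m)) * u (a + m + 1) := by
        linear_combination hs
      rw [e]
      refine (norm_add_le _ _).trans ?_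
      have hd : ‖(C (a + m + 1) - C (a + m)) * u (a + m + 1)‖ = k (a + m + 1) - k (a + m) := by
        rw [norm_mul, hun, mul_one]
        have : C (a + m + 1) - C (a + m) = ((k (a + m + 1) - k (a + m) : ℝ) : ℂ) * Complex.I := by
          simp only [hC]; push_cast; ring
        rw [this, norm_mul, Complex.norm_I, mul_one, Complex.norm_real, Real.norm_of_nonneg]
        have := cot_half_le hδ (h1 (a + m + 1) (by omega) (by omega)) (h3 (a + m) (by omega) (by omega))
          (h2 (a + m) (by omega) (by omega))
        simp only [hk, hg]
        linarith
      rw [hd]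
      linarith
  obtain ⟨m, rfl⟩ : ∃ m, b = a + m + 1 := ⟨b - a - 1, by omega⟩
  have hm := key m (by omega)
  have b1 := hCbound a le_rfl hab
  have b2 := hCbound (a + m) (by omega) (by omega)
  have b3 := abs_le.1 (hkbound a le_rfl hab)
  have b4 := abs_le.1 (hkbound (a + m) (by omega) (by omega))
  have e : ∑ n ∈ Ico a (a + m + 1), u n
      = (∑ n ∈ Ico a (a + m + 1), u n + C (a + m) * u (a + m + 1)) - C (a + m) * u (a + m + 1) := by
    ring
  rw [e]
  refine (norm_sub_le _ _).trans ?_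
  rw [norm_mul (C (a + m)), hun, mul_one]
  have : 2 * Real.pi / δ = 4 * (Real.pi / (2 * δ)) := by field_simp; ring
  rw [this]
  linarith

lemma norm_sum_exp_le_of_increments_shift {α : ℕ → ℝ} {a b : ℕ} {δ : ℝ} (ν : ℕ) (hδ : 0 < δ)
    (h1 : ∀ n, a ≤ n → n < b → 2 * Real.pi * ν + δ ≤ α (n + 1) - α n)
    (h2 : ∀ n, a ≤ n → n < b → α (n + 1) - α n ≤ 2 * Real.pi * (ν + 1) - δ)
    (h3 : ∀ n, a ≤ n → n + 1 < b → α (n + 2) - α (n + 1) ≤ α (n + 1) - α n) :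
    ‖∑ n ∈ Ico a b, Complex.exp (α n * Complex.I)‖ ≤ 2 * Real.pi / δ := by
  have e : ∀ n : ℕ, Complex.exp (α n * Complex.I)
      = Complex.exp (((α n - 2 * Real.pi * ν * n : ℝ) : ℂ) * Complex.I) := by
    intro n
    rw [Complex.exp_eq_exp_iff_exists_int]
    refine ⟨(ν * n : ℕ), ?_⟩
    push_cast
    ring
  rw [Finset.sum_congr rfl fun n _ => e n]
  refine norm_sum_exp_le_of_increments (α := fun n => α n - 2 * Real.pi * ν * n) hδ ?_ ?_ ?_
  · intro n hn hn'
    have := h1 n hn hn'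
    push_cast
    linarith
  · intro n hn hn'
    have := h2 n hn hn'
    push_cast
    linarith
  · intro n hn hn'
    have := h3 n hn hn'
    push_cast
    linarith

lemma norm_sum_exp_le_card (α : ℕ → ℝ) {a b : ℕ} (hab : a ≤ b) :
    ‖∑ n ∈ Ico a b, Complex.exp (α n * Complex.I)‖ ≤ (b : ℝ) - a := by
  refine (norm_sum_le _ _).trans ?_
  simp only [Complex.norm_exp_ofReal_mul_I, sum_const, Nat.card_Ico, nsmul_eq_mul, mul_one]
  rw [Nat.cast_sub hab]

/-- An antitone sequence on `[a, b)` exceeds `v` on an initial interval only. -/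
lemma exists_threshold {g : ℕ → ℝ} {a b : ℕ} (hab : a ≤ b)
    (hg : ∀ n m, a ≤ n → n ≤ m → m < b → g m ≤ g n) (v : ℝ) :
    ∃ c, a ≤ c ∧ c ≤ b ∧ (∀ n, a ≤ n → n < c → v < g n) ∧ (∀ n, c ≤ n → n < b → g n ≤ v) := by
  classical
  have hex : ∃ n, a ≤ n ∧ (b ≤ n ∨ g n ≤ v) := ⟨b, hab, Or.inl le_rfl⟩
  refine ⟨Nat.find hex, (Nat.find_spec hex).1, Nat.find_min' hex ⟨hab, Or.inl le_rfl⟩, ?_, ?_⟩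
  · intro n hn hn'
    have := Nat.find_min hex hn'
    push Not at this
    exact (this hn).2
  · intro n hn hn'
    rcases (Nat.find_spec hex).2 with h | h
    · omega
    · exact (hg _ n (Nat.find_spec hex).1 hn hn').trans h

lemma norm_sum_exp_le_of_short_range {α : ℕ → ℝ} {a b : ℕ} {lam δ v : ℝ} (hlam : 0 < lam)
    (hδ : 0 ≤ δ) (hab : a ≤ b)
    (h : ∀ n m, a ≤ n → n ≤ m → m < b →
      lam * ((m : ℝ) - n) ≤ (α (n + 1) - α n) - (α (m + 1) - α m))
    (h1 : ∀ n, a ≤ n → n < b → v ≤ α (n + 1) - α n)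
    (h2 : ∀ n, a ≤ n → n < b → α (n + 1) - α n ≤ v + δ) :
    ‖∑ n ∈ Ico a b, Complex.exp (α n * Complex.I)‖ ≤ δ / lam + 1 := by
  refine (norm_sum_exp_le_card α hab).trans ?_
  rcases hab.eq_or_lt with rfl | hab'
  · rw [sub_self]
    positivity
  have e1 := h a (b - 1) le_rfl (by omega) (by omega)
  have e2 := h1 (b - 1) (by omega) (by omega)
  have e3 := h2 a le_rfl hab'
  rw [Nat.cast_sub (by omega), Nat.cast_one] at e1
  rw [← sub_le_iff_le_add, le_div_iff₀ hlam]
  linarith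

/-- Increments within one period: the parts near the two ends of the period are short, the middle
part is bounded by the Kusmin–Landau inequality. -/
lemma norm_sum_exp_le_one_period {α : ℕ → ℝ} {a b : ℕ} {lam : ℝ} (ν : ℕ) (hlam : 0 < lam)
    (hlam1 : lam ≤ 1) (hab : a ≤ b)
    (h : ∀ n m, a ≤ n → n ≤ m → m < b →
      lam * ((m : ℝ) - n) ≤ (α (n + 1) - α n) - (α (m + 1) - α m))
    (h1 : ∀ n, a ≤ n → n < b → 2 * Real.pi * ν ≤ α (n + 1) - α n)
    (h2 : ∀ n, a ≤ n → n < b → α (n + 1) - α n ≤ 2 * Real.pi * (ν + 1)) :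
    ‖∑ n ∈ Ico a b, Complex.exp (α n * Complex.I)‖ ≤ 11 / Real.sqrt lam := by
  have hs : 0 < Real.sqrt lam := Real.sqrt_pos.2 hlam
  have hs1 : Real.sqrt lam ≤ 1 := Real.sqrt_le_one.2 hlam1
  have hss : Real.sqrt lam * Real.sqrt lam = lam := Real.mul_self_sqrt hlam.le
  set δ := Real.sqrt lam with hδ
  have hanti : ∀ n m, a ≤ n → n ≤ m → m < b → α (m + 1) - α m ≤ α (n + 1) - α n := by
    intro n m hn hnm hm
    have := h n m hn hnm hm
    have h0 : (0 : ℝ) ≤ (m : ℝ) - n := sub_nonneg.2 (by exact_mod_cast hnm)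
    have := mul_nonneg hlam.le h0
    linarith
  obtain ⟨c, hac, hcb, hc1, hc2⟩ := exists_threshold hab hanti (2 * Real.pi * (ν + 1) - δ)
  obtain ⟨d, hcd, hdb, hd1, hd2⟩ := exists_threshold (g := fun n => α (n + 1) - α n) hcb
    (fun n m hn hnm hm => hanti n m (hac.trans hn) hnm hm) (2 * Real.pi * ν + δ)
  have hsum : ∑ n ∈ Ico a b, Complex.exp (α n * Complex.I)
      = ∑ n ∈ Ico a c, Complex.exp (α n * Complex.I) + ∑ n ∈ Ico c d, Complex.exp (α n * Complex.I)
        + ∑ n ∈ Ico d b, Complex.exp (α n * Complex.I) := by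
    rw [sum_Ico_consecutive _ hac hcd, sum_Ico_consecutive _ (hac.trans hcd) hdb]
  rw [hsum]
  have b1 : ‖∑ n ∈ Ico a c, Complex.exp (α n * Complex.I)‖ ≤ δ / lam + 1 :=
    norm_sum_exp_le_of_short_range (v := 2 * Real.pi * (ν + 1) - δ) hlam hs.le hac
      (fun n m hn hnm hm => h n m hn hnm (lt_of_lt_of_le hm hcb))
      (fun n hn hn' => (hc1 n hn hn').le)
      (fun n hn hn' => by have := h2 n hn (lt_of_lt_of_le hn' hcb); linarith)
  have b2 : ‖∑ n ∈ Ico c d, Complex.exp (α n * Complex.I)‖ ≤ 2 * Real.pi / δ :=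
    norm_sum_exp_le_of_increments_shift ν hs (fun n hn hn' => (hd1 n hn hn').le)
      (fun n hn hn' => hc2 n hn (lt_of_lt_of_le hn' hdb))
      (fun n hn hn' => hanti n (n + 1) (by omega) (by omega) (by omega))
  have b3 : ‖∑ n ∈ Ico d b, Complex.exp (α n * Complex.I)‖ ≤ δ / lam + 1 :=
    norm_sum_exp_le_of_short_range (v := 2 * Real.pi * ν) hlam hs.le hdb
      (fun n m hn hnm hm => h n m (by omega) hnm hm)
      (fun n hn hn' => h1 n (by omega) hn')
      (fun n hn hn' => hd2 n hn hn')
  have e1 : δ / lam = 1 / δ := by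
    rw [← hss]; field_simp
  have e2 : (1 : ℝ) ≤ 1 / δ := by rw [le_div_iff₀ hs]; linarith
  have e3 : 2 * Real.pi / δ ≤ 7 / δ := by
    apply div_le_div_of_nonneg_right _ hs.le
    have := Real.pi_lt_d2
    linarith
  have e4 : (11 : ℝ) / δ = 4 * (1 / δ) + 7 / δ := by ring
  rw [e1] at b1 b3
  rw [e4]
  refine (norm_add₃_le).trans ?_
  linarith

/-- The second derivative test: the range is cut into `k + 1` intervals on each of which the
increments `α (n + 1) - α n` stay within one period `2π`. -/
lemma norm_sum_exp_le_periods {α : ℕ → ℝ} {a : ℕ} {lam : ℝ} (hlam : 0 < lam)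
    (hlam1 : lam ≤ 1) (k : ℕ) : ∀ b : ℕ, a ≤ b →
    (∀ n m, a ≤ n → n ≤ m → m < b →
      lam * ((m : ℝ) - n) ≤ (α (n + 1) - α n) - (α (m + 1) - α m)) →
    ∀ c, a ≤ c → c ≤ b → (∀ n, c ≤ n → n < b → 0 ≤ α (n + 1) - α n) →
    (∀ n, c ≤ n → n < b → α (n + 1) - α n ≤ 2 * Real.pi * (k + 1)) →
    ‖∑ n ∈ Ico c b, Complex.exp (α n * Complex.I)‖ ≤ (k + 1) * (11 / Real.sqrt lam) := by
  induction k with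
  | zero =>
    intro b _ h c hac hcb h0 h1
    have := norm_sum_exp_le_one_period (α := α) (a := c) (b := b) 0 hlam hlam1 hcb
      (fun n m hn hnm hm => h n m (by omega) hnm hm)
      (fun n hn hn' => by simpa using h0 n hn hn')
      (fun n hn hn' => by simpa using h1 n hn hn')
    simpa using this
  | succ k ih =>
    intro b hab h c hac hcb h0 h1
    have hanti : ∀ n m, c ≤ n → n ≤ m → m < b → α (m + 1) - α m ≤ α (n + 1) - α n := by
      intro n m hn hnm hm
      have := h n m (by omega) hnm hm
      have h0 : (0 : ℝ) ≤ (m : ℝ) - n := sub_nonneg.2 (by exact_mod_cast hnm)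
      have := mul_nonneg hlam.le h0
      linarith
    obtain ⟨d, hcd, hdb, hd1, hd2⟩ := exists_threshold hcb hanti (2 * Real.pi * (k + 1))
    rw [← sum_Ico_consecutive _ hcd hdb]
    have b1 := norm_sum_exp_le_one_period (α := α) (a := c) (b := d) (k + 1) hlam hlam1 hcd
      (fun n m hn hnm hm => h n m (by omega) hnm (by omega))
      (fun n hn hn' => by have := hd1 n hn hn'; push_cast; linarith)
      (fun n hn hn' => by have := h1 n hn (by omega); push_cast at this ⊢; linarith)
    have b2 := ih b hab h d (by omega) hdb (fun n hn hn' => h0 n (by omega) hn') hd2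
    refine (norm_add_le _ _).trans ?_
    push_cast
    linarith

lemma log_succ_increment_sub {n : ℕ} (hn : 1 ≤ n) :
    1 / ((n : ℝ) + 1) ^ 2 ≤ (Real.log ((n + 1 : ℕ) : ℝ) - Real.log n)
      - (Real.log ((n + 2 : ℕ) : ℝ) - Real.log ((n + 1 : ℕ) : ℝ)) := by
  have h0 : (0 : ℝ) < n := by exact_mod_cast hn
  push_cast
  have e : Real.log ((n : ℝ) + 1) - Real.log n - (Real.log ((n : ℝ) + 2) - Real.log ((n : ℝ) + 1))
      = Real.log (((n : ℝ) + 1) ^ 2 / (n * (n + 2))) := by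
    rw [Real.log_div (by positivity) (by positivity), Real.log_pow,
      Real.log_mul (by positivity) (by positivity)]
    push_cast
    ring
  rw [e]
  have := Real.one_sub_inv_le_log_of_pos (x := ((n : ℝ) + 1) ^ 2 / (n * (n + 2))) (by positivity)
  refine le_trans (le_of_eq ?_) this
  field_simp
  ring

lemma log_increments_sub_le {b : ℕ} {t : ℝ} (ht : 0 ≤ t) {n m : ℕ} (hn : 1 ≤ n) (hnm : n ≤ m)
    (hm : m < b) :
    t / (b : ℝ) ^ 2 * ((m : ℝ) - n)
      ≤ (t * Real.log ((n + 1 : ℕ) : ℝ) - t * Real.log n)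
        - (t * Real.log ((m + 1 : ℕ) : ℝ) - t * Real.log m) := by
  induction m, hnm using Nat.le_induction with
  | base => simp
  | succ m hnm ih =>
    have h1 := ih (by omega)
    have h2 := mul_le_mul_of_nonneg_left (log_succ_increment_sub (n := m) (by omega)) ht
    have h3 : t / (b : ℝ) ^ 2 ≤ t * (1 / ((m : ℝ) + 1) ^ 2) := by
      rw [mul_one_div]
      apply div_le_div_of_nonneg_left ht (by positivity)
      have : (m : ℝ) + 1 ≤ b := by exact_mod_cast hm.le
      exact pow_le_pow_left₀ (by positivity) this 2
    have e : t / (b : ℝ) ^ 2 * (((m + 1 : ℕ) : ℝ) - n)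
        = t / (b : ℝ) ^ 2 * ((m : ℝ) - n) + t / (b : ℝ) ^ 2 := by
      push_cast; ring
    rw [e]
    have e2 : m + 1 + 1 = m + 2 := rfl
    rw [e2]
    linarith

lemma log_increment_le {n : ℕ} (hn : 1 ≤ n) :
    Real.log ((n + 1 : ℕ) : ℝ) - Real.log n ≤ 1 / n := by
  have h0 : (0 : ℝ) < n := by exact_mod_cast hn
  rw [← Real.log_div (by positivity) (by positivity)]
  have := Real.log_le_sub_one_of_pos (x := ((n + 1 : ℕ) : ℝ) / n) (by positivity)
  refine this.trans (le_of_eq ?_)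
  push_cast
  field_simp
  ring

lemma le_log_increment {n : ℕ} (hn : 1 ≤ n) :
    1 / ((n : ℝ) + 1) ≤ Real.log ((n + 1 : ℕ) : ℝ) - Real.log n := by
  have h0 : (0 : ℝ) < n := by exact_mod_cast hn
  rw [← Real.log_div (by positivity) (by positivity)]
  have := Real.one_sub_inv_le_log_of_pos (x := ((n + 1 : ℕ) : ℝ) / n) (by positivity)
  refine le_trans (le_of_eq ?_) this
  push_cast
  field_simp
  ring

/-- The second derivative test for `∑ n^{it}` over a subinterval of `[M, 2M)`. -/
lemma norm_sum_exp_log_le_of_second_derivative {M a b : ℕ} {t : ℝ} (hM : 1 ≤ M) (hMa : M ≤ a)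
    (hab : a ≤ b) (hb : b ≤ 2 * M) (ht : 0 < t) (htM : t ≤ (2 * M : ℝ) ^ 2) :
    ‖∑ n ∈ Ico a b, Complex.exp ((t * Real.log n : ℝ) * Complex.I)‖
      ≤ 22 * (Real.sqrt t + M / Real.sqrt t) := by
  have hM0 : (0 : ℝ) < M := by exact_mod_cast hM
  set lam : ℝ := t / (2 * M : ℝ) ^ 2 with hlam
  have hlam0 : 0 < lam := by positivity
  have hlam1 : lam ≤ 1 := by rw [hlam, div_le_one (by positivity)]; exact htM
  set k : ℕ := ⌊t / (2 * Real.pi * M)⌋₊ with hk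
  have hpi := Real.pi_pos
  have hk1 : t / (2 * Real.pi * M) < k + 1 := Nat.lt_floor_add_one _
  have hk2 : (k : ℝ) ≤ t / (2 * Real.pi * M) := Nat.floor_le (by positivity)
  have hinc : ∀ n m, a ≤ n → n ≤ m → m < b → lam * ((m : ℝ) - n)
      ≤ (t * Real.log ((n + 1 : ℕ) : ℝ) - t * Real.log n)
        - (t * Real.log ((m + 1 : ℕ) : ℝ) - t * Real.log m) := by
    intro n m hn hnm hm
    have := log_increments_sub_le ht.le (b := 2 * M) (n := n) (m := m) (by omega) hnm (by omega)
    push_cast at this ⊢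
    exact this
  have hpos : ∀ n, a ≤ n → n < b → 0 ≤ t * Real.log ((n + 1 : ℕ) : ℝ) - t * Real.log n := by
    intro n hn _
    have h1 := le_log_increment (n := n) (by omega)
    have h2 : (0 : ℝ) ≤ 1 / ((n : ℝ) + 1) := by positivity
    rw [← mul_sub]
    exact mul_nonneg ht.le (h2.trans h1)
  have hle : ∀ n, a ≤ n → n < b →
      t * Real.log ((n + 1 : ℕ) : ℝ) - t * Real.log n ≤ 2 * Real.pi * (k + 1) := by
    intro n hn _
    have h1 := mul_le_mul_of_nonneg_left (log_increment_le (n := n) (by omega)) ht.le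
    have hMn : (M : ℝ) ≤ n := by exact_mod_cast hMa.trans hn
    have h2 : t * (1 / (n : ℝ)) ≤ t * (1 / M) := by
      apply mul_le_mul_of_nonneg_left _ ht.le
      exact one_div_le_one_div_of_le hM0 hMn
    have h3 : t * (1 / M) = 2 * Real.pi * (t / (2 * Real.pi * M)) := by field_simp
    rw [← mul_sub]
    have h4 := mul_le_mul_of_nonneg_left hk1.le (by positivity : 0 ≤ 2 * Real.pi)
    linarith
  have h := norm_sum_exp_le_periods (α := fun n => t * Real.log n) hlam0 hlam1 k b hab hinc a le_rfl
    hab hpos hle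
  refine h.trans ?_
  have hst : 0 < Real.sqrt t := Real.sqrt_pos.2 ht
  have hsl : Real.sqrt lam = Real.sqrt t / (2 * M) := by
    rw [hlam, Real.sqrt_div ht.le, Real.sqrt_sq (by positivity)]
  rw [hsl]
  have e1 : (k + 1 : ℝ) * (11 / (Real.sqrt t / (2 * M)))
      ≤ (t / (2 * M) + 1) * (11 / (Real.sqrt t / (2 * M))) := by
    apply mul_le_mul_of_nonneg_right _ (by positivity)
    have : t / (2 * Real.pi * M) ≤ t / (2 * M) := by
      apply div_le_div_of_nonneg_left ht.le (by positivity)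
      have := Real.pi_gt_three
      nlinarith
    linarith
  refine e1.trans ?_
  have e2 : (t / (2 * M) + 1) * (11 / (Real.sqrt t / (2 * M)))
      = 11 * (t / Real.sqrt t) + 22 * (M / Real.sqrt t) := by
    field_simp
    ring
  rw [e2, Real.div_sqrt]
  linarith

/-- The first derivative test for `∑ n^{it}` over a subinterval of `[M, 2M)`, where `t ≤ 4M`. -/
lemma norm_sum_exp_log_le_of_first_derivative {M a b : ℕ} {t : ℝ} (hM : 1 ≤ M) (hMa : M ≤ a)
    (hb : b ≤ 2 * M) (ht : 0 < t) (htM : t ≤ 4 * M) :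
    ‖∑ n ∈ Ico a b, Complex.exp ((t * Real.log n : ℝ) * Complex.I)‖ ≤ 13 * M / t := by
  have hM0 : (0 : ℝ) < M := by exact_mod_cast hM
  have hpi := Real.pi_gt_three
  have hδ : 0 < t / (2 * M) := by positivity
  have h := norm_sum_exp_le_of_increments (α := fun n => t * Real.log n) (a := a) (b := b) hδ ?_ ?_ ?_
  · refine h.trans ?_
    have e : 2 * Real.pi / (t / (2 * M)) = 4 * Real.pi * M / t := by
      field_simp
      ring
    rw [e]
    apply div_le_div_of_nonneg_right _ ht.le
    have := Real.pi_lt_d2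
    nlinarith
  · intro n hn hn'
    have h1 := mul_le_mul_of_nonneg_left (le_log_increment (n := n) (by omega)) ht.le
    rw [← mul_sub]
    refine le_trans ?_ h1
    rw [mul_one_div]
    apply div_le_div_of_nonneg_left ht.le (by positivity)
    exact_mod_cast (by omega : n + 1 ≤ 2 * M)
  · intro n hn hn'
    have h1 := mul_le_mul_of_nonneg_left (log_increment_le (n := n) (by omega)) ht.le
    rw [← mul_sub]
    have hMn : (M : ℝ) ≤ n := by exact_mod_cast hMa.trans hn
    have h2 : t * (1 / (n : ℝ)) ≤ t * (1 / M) := by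
      apply mul_le_mul_of_nonneg_left _ ht.le
      exact one_div_le_one_div_of_le hM0 hMn
    have h3 : t * (1 / (M : ℝ)) ≤ 4 := by
      rw [mul_one_div, div_le_iff₀ hM0]; exact htM
    have h4 : t / (2 * M) ≤ 2 := by
      rw [div_le_iff₀ (by positivity)]; linarith
    linarith
  · intro n hn hn'
    have h1 := log_succ_increment_sub (n := n) (by omega)
    have h2 : (0 : ℝ) ≤ 1 / ((n : ℝ) + 1) ^ 2 := by positivity
    have h3 := mul_nonneg ht.le (h2.trans h1)
    linarith

/-- **Abel's inequality** for nonnegative decreasing weights. -/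
lemma norm_sum_mul_le_of_antitone {w : ℕ → ℝ} {u : ℕ → ℂ} {a b : ℕ} {B : ℝ}
    (hw0 : ∀ n, a ≤ n → n < b → 0 ≤ w n)
    (hw : ∀ n, a ≤ n → n + 1 < b → w (n + 1) ≤ w n)
    (hu : ∀ c, a ≤ c → c ≤ b → ‖∑ n ∈ Ico a c, u n‖ ≤ B) (hab : a < b) :
    ‖∑ n ∈ Ico a b, (w n : ℂ) * u n‖ ≤ w a * B := by
  have hB : 0 ≤ B := le_trans (norm_nonneg _) (hu a le_rfl hab.le)
  have key : ∀ m, a + m < b →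
      ‖∑ n ∈ Ico a (a + m + 1), (w n : ℂ) * u n
        - (w (a + m) : ℂ) * ∑ n ∈ Ico a (a + m + 1), u n‖ ≤ (w a - w (a + m)) * B := by
    intro m
    induction m with
    | zero => intro _; simp
    | succ m ih =>
      intro hm
      have ih' := ih (by omega)
      rw [show a + (m + 1) = a + m + 1 by ring]
      have e : ∑ n ∈ Ico a (a + m + 1 + 1), (w n : ℂ) * u n
            - (w (a + m + 1) : ℂ) * ∑ n ∈ Ico a (a + m + 1 + 1), u n
          = (∑ n ∈ Ico a (a + m + 1), (w n : ℂ) * u n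
              - (w (a + m) : ℂ) * ∑ n ∈ Ico a (a + m + 1), u n)
            + ((w (a + m) - w (a + m + 1) : ℝ) : ℂ) * ∑ n ∈ Ico a (a + m + 1), u n := by
        rw [sum_Ico_succ_top (by omega : a ≤ a + m + 1),
          sum_Ico_succ_top (f := u) (by omega : a ≤ a + m + 1)]
        push_cast
        ring
      rw [e]
      refine (norm_add_le _ _).trans ?_
      have hd : 0 ≤ w (a + m) - w (a + m + 1) := sub_nonneg.2 (hw (a + m) (by omega) hm)
      have : ‖((w (a + m) - w (a + m + 1) : ℝ) : ℂ) * ∑ n ∈ Ico a (a + m + 1), u n‖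
          ≤ (w (a + m) - w (a + m + 1)) * B := by
        rw [norm_mul, Complex.norm_real, Real.norm_of_nonneg hd]
        exact mul_le_mul_of_nonneg_left (hu _ (by omega) (by omega)) hd
      linarith
  obtain ⟨m, rfl⟩ : ∃ m, b = a + m + 1 := ⟨b - a - 1, by omega⟩
  have h1 := key m (by omega)
  have h2 : ‖(w (a + m) : ℂ) * ∑ n ∈ Ico a (a + m + 1), u n‖ ≤ w (a + m) * B := by
    rw [norm_mul, Complex.norm_real, Real.norm_of_nonneg (hw0 _ (by omega) (by omega))]
    exact mul_le_mul_of_nonneg_left (hu _ (by omega) le_rfl) (hw0 _ (by omega) (by omega))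
  have e : ∑ n ∈ Ico a (a + m + 1), (w n : ℂ) * u n
      = (∑ n ∈ Ico a (a + m + 1), (w n : ℂ) * u n
        - (w (a + m) : ℂ) * ∑ n ∈ Ico a (a + m + 1), u n)
        + (w (a + m) : ℂ) * ∑ n ∈ Ico a (a + m + 1), u n := by ring
  rw [e]
  refine (norm_add_le _ _).trans ?_
  linarith

end ExponentialSums

end SubgroupCount

namespace SubgroupCount

open Finset Filter Topology Complex

/-! ### Euler–Maclaurin approximation of the zeta function -/

noncomputable section EulerMaclaurin

/-- `(s-1) ∫_n^{n+1} (u^{-s} - (n+1)^{-s}) du`, written without an integral. -/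
def zetaErrorTerm (n : ℕ) (s : ℂ) : ℂ :=
  (n : ℂ) ^ (1 - s) - ((n + 1 : ℕ) : ℂ) ^ (1 - s) - (s - 1) * ((n + 1 : ℕ) : ℂ) ^ (-s)

lemma hasDerivAt_ofReal_cpow_mul {n : ℕ} {s : ℂ} {u : ℝ} (hu : 0 < u) :
    HasDerivAt (fun v : ℝ => (n : ℂ) ^ (1 - s) - (v : ℂ) ^ (1 - s)
        - (s - 1) * (((v - n : ℝ) : ℂ) * (v : ℂ) ^ (-s)))
      (s * (s - 1) * (((u - n : ℝ) : ℂ) * (u : ℂ) ^ (-s - 1))) u := by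
  have hu' : (u : ℂ) ∈ slitPlane := by simpa using hu
  have h1 : HasDerivAt (fun v : ℝ => (v : ℂ) ^ (1 - s)) ((1 - s) * (u : ℂ) ^ (-s)) u := by
    have := ((hasDerivAt_id (u : ℂ)).cpow_const (c := 1 - s) hu').comp_ofReal
    simpa using this
  have h2 : HasDerivAt (fun v : ℝ => (v : ℂ) ^ (-s)) (-s * (u : ℂ) ^ (-s - 1)) u := by
    have := ((hasDerivAt_id (u : ℂ)).cpow_const (c := -s) hu').comp_ofReal
    simpa using this
  have h3 : HasDerivAt (fun v : ℝ => ((v - n : ℝ) : ℂ)) 1 u := by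
    have := ((hasDerivAt_id u).sub_const (n : ℝ)).ofReal_comp
    simpa using this
  have h4 := ((h1.const_sub ((n : ℂ) ^ (1 - s))).sub ((h3.mul h2).const_mul (s - 1)))
  refine h4.congr_deriv ?_
  ring

lemma norm_zetaErrorTerm_deriv_le {n : ℕ} {s : ℂ} {u : ℝ} (hu : 0 < u) (h1 : (n : ℝ) ≤ u)
    (h2 : u ≤ n + 1) :
    ‖s * (s - 1) * (((u - n : ℝ) : ℂ) * (u : ℂ) ^ (-s - 1))‖
      ≤ ‖s - 1‖ * ‖s‖ * u ^ (-s.re - 1) := by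
  rw [norm_mul, norm_mul, norm_mul, Complex.norm_real, Complex.norm_cpow_eq_rpow_re_of_pos hu,
    Real.norm_of_nonneg (by linarith)]
  have e : (-s - 1).re = -s.re - 1 := by simp
  rw [e]
  have hp : 0 ≤ u ^ (-s.re - 1) := by positivity
  calc ‖s‖ * ‖s - 1‖ * ((u - n) * u ^ (-s.re - 1))
      ≤ ‖s‖ * ‖s - 1‖ * (1 * u ^ (-s.re - 1)) := by
        apply mul_le_mul_of_nonneg_left _ (by positivity)
        exact mul_le_mul_of_nonneg_right (by linarith) hp
    _ = _ := by ring

lemma zetaErrorTerm_eq (n : ℕ) (s : ℂ) :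
    zetaErrorTerm n s = (n : ℂ) ^ (1 - s) - (((n : ℝ) + 1 : ℝ) : ℂ) ^ (1 - s)
        - (s - 1) * ((((n : ℝ) + 1 - n : ℝ) : ℂ) * (((n : ℝ) + 1 : ℝ) : ℂ) ^ (-s)) := by
  unfold zetaErrorTerm
  push_cast
  ring

lemma norm_zetaErrorTerm_le_sub {n : ℕ} (hn : 1 ≤ n) {s : ℂ} (hs : 0 < s.re) :
    ‖zetaErrorTerm n s‖
      ≤ ‖s - 1‖ * ‖s‖ / s.re * ((n : ℝ) ^ (-s.re) - ((n : ℝ) + 1) ^ (-s.re)) := by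
  have hn0 : (0 : ℝ) < n := by exact_mod_cast hn
  rw [zetaErrorTerm_eq]
  refine image_norm_le_of_norm_deriv_right_le_deriv_boundary' (a := (n : ℝ)) (b := (n : ℝ) + 1)
    (f := fun v : ℝ => (n : ℂ) ^ (1 - s) - (v : ℂ) ^ (1 - s)
        - (s - 1) * (((v - n : ℝ) : ℂ) * (v : ℂ) ^ (-s)))
    (f' := fun u => s * (s - 1) * (((u - n : ℝ) : ℂ) * (u : ℂ) ^ (-s - 1)))
    (B := fun u => ‖s - 1‖ * ‖s‖ / s.re * ((n : ℝ) ^ (-s.re) - u ^ (-s.re)))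
    (B' := fun u => ‖s - 1‖ * ‖s‖ * u ^ (-s.re - 1)) ?_ ?_ ?_ ?_ ?_ ?_
    (Set.right_mem_Icc.2 (by linarith))
  · intro u hu
    exact (hasDerivAt_ofReal_cpow_mul (hn0.trans_le hu.1)).continuousAt.continuousWithinAt
  · intro u hu
    exact (hasDerivAt_ofReal_cpow_mul (hn0.trans_le hu.1)).hasDerivWithinAt
  · simp
  · intro u hu
    have hu0 : u ≠ 0 := (hn0.trans_le hu.1).ne'
    exact (continuousAt_const.mul (continuousAt_const.sub
      (Real.continuousAt_rpow_const _ _ (Or.inl hu0)))).continuousWithinAt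
  · intro u hu
    have hu0 : u ≠ 0 := (hn0.trans_le hu.1).ne'
    have h := (((Real.hasDerivAt_rpow_const (p := -s.re) (Or.inl hu0)).const_sub
      ((n : ℝ) ^ (-s.re))).const_mul (‖s - 1‖ * ‖s‖ / s.re))
    refine (h.congr_deriv ?_).hasDerivWithinAt
    field_simp
  · intro u hu
    exact norm_zetaErrorTerm_deriv_le (hn0.trans_le hu.1) hu.1 hu.2.le

lemma norm_zetaErrorTerm_le {n : ℕ} (hn : 1 ≤ n) {s : ℂ} (hs : 0 < s.re) :
    ‖zetaErrorTerm n s‖ ≤ ‖s - 1‖ * ‖s‖ * (n : ℝ) ^ (-s.re - 1) := by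
  have hn0 : (0 : ℝ) < n := by exact_mod_cast hn
  rw [zetaErrorTerm_eq]
  have h := norm_image_sub_le_of_norm_deriv_right_le_segment (a := (n : ℝ)) (b := (n : ℝ) + 1)
    (f := fun v : ℝ => (n : ℂ) ^ (1 - s) - (v : ℂ) ^ (1 - s)
        - (s - 1) * (((v - n : ℝ) : ℂ) * (v : ℂ) ^ (-s)))
    (f' := fun u => s * (s - 1) * (((u - n : ℝ) : ℂ) * (u : ℂ) ^ (-s - 1)))
    (C := ‖s - 1‖ * ‖s‖ * (n : ℝ) ^ (-s.re - 1)) ?_ ?_ ?_ ((n : ℝ) + 1)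
    (Set.right_mem_Icc.2 (by linarith))
  · simpa using h
  · intro u hu
    exact (hasDerivAt_ofReal_cpow_mul (hn0.trans_le hu.1)).continuousAt.continuousWithinAt
  · intro u hu
    exact (hasDerivAt_ofReal_cpow_mul (hn0.trans_le hu.1)).hasDerivWithinAt
  · intro u hu
    refine (norm_zetaErrorTerm_deriv_le (hn0.trans_le hu.1) hu.1 hu.2.le).trans ?_
    apply mul_le_mul_of_nonneg_left _ (by positivity)
    exact Real.rpow_le_rpow_of_nonpos hn0 hu.1 (by linarith)

lemma sum_zetaErrorTerm (N M : ℕ) (s : ℂ) :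
    ∑ i ∈ range M, zetaErrorTerm (N + i) s
      = (N : ℂ) ^ (1 - s) - ((N + M : ℕ) : ℂ) ^ (1 - s)
        - (s - 1) * (∑ n ∈ range (N + M), ((n + 1 : ℕ) : ℂ) ^ (-s)
          - ∑ n ∈ range N, ((n + 1 : ℕ) : ℂ) ^ (-s)) := by
  induction M with
  | zero => simp
  | succ M ih =>
    rw [sum_range_succ, ih, zetaErrorTerm, ← add_assoc, sum_range_succ _ (N + M)]
    ring

lemma hasSum_zetaErrorTerm {N : ℕ} {s : ℂ} (hs : 1 < s.re)
    (hsum : Summable fun i => zetaErrorTerm (N + i) s) :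
    HasSum (fun i => zetaErrorTerm (N + i) s) ((N : ℂ) ^ (1 - s)
      + (s - 1) * ∑ n ∈ range N, ((n + 1 : ℕ) : ℂ) ^ (-s) - (s - 1) * riemannZeta s) := by
  have hz : Tendsto (fun M : ℕ => ∑ n ∈ range M, ((n + 1 : ℕ) : ℂ) ^ (-s)) atTop
      (𝓝 (riemannZeta s)) := by
    have h1 : Summable fun n : ℕ => 1 / ((n + 1 : ℕ) : ℂ) ^ s :=
      (summable_nat_add_iff 1).2 (Complex.summable_one_div_nat_cpow.2 hs)
    have h2 := h1.hasSum.tendsto_sum_nat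
    have e : ∑' n : ℕ, 1 / ((n + 1 : ℕ) : ℂ) ^ s = riemannZeta s := by
      rw [zeta_eq_tsum_one_div_nat_add_one_cpow hs]
      push_cast
      rfl
    rw [e] at h2
    refine h2.congr fun M => Finset.sum_congr rfl fun n _ => ?_
    rw [Complex.cpow_neg, one_div]
  have hp : Tendsto (fun M : ℕ => ((M : ℕ) : ℂ) ^ (1 - s)) atTop (𝓝 0) := by
    rw [tendsto_zero_iff_norm_tendsto_zero]
    have h1 : Tendsto (fun M : ℕ => (M : ℝ) ^ (-(s.re - 1))) atTop (𝓝 0) :=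
      (tendsto_rpow_neg_atTop (by linarith)).comp tendsto_natCast_atTop_atTop
    refine h1.congr' ?_
    filter_upwards [eventually_gt_atTop 0] with M hM
    rw [Complex.norm_natCast_cpow_of_pos hM]
    congr 1
    simp
  have h := hsum.hasSum
  have hlim : Tendsto (fun M => ∑ i ∈ range M, zetaErrorTerm (N + i) s) atTop
      (𝓝 ((N : ℂ) ^ (1 - s) - 0
        - (s - 1) * (riemannZeta s - ∑ n ∈ range N, ((n + 1 : ℕ) : ℂ) ^ (-s)))) := by
    have hadd : Tendsto (fun M : ℕ => N + M) atTop atTop := tendsto_add_atTop_nat N |>.congr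
      fun M => add_comm M N
    have := ((tendsto_const_nhds (x := (N : ℂ) ^ (1 - s))).sub (hp.comp hadd)).sub
      (((hz.comp hadd).sub_const (∑ n ∈ range N, ((n + 1 : ℕ) : ℂ) ^ (-s))).const_mul (s - 1))
    refine this.congr fun M => ?_
    rw [sum_zetaErrorTerm]
    rfl
  have e := tendsto_nhds_unique h.tendsto_sum_nat hlim
  rw [e] at h
  convert h using 1
  ring

lemma summable_zetaErrorTerm_bound (N : ℕ) {ε : ℝ} (hε : 0 < ε) (R : ℝ) :
    Summable fun i : ℕ => R * ((N + i : ℕ) : ℝ) ^ (-ε - 1) := by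
  apply Summable.mul_left
  have h : Summable fun n : ℕ => (n : ℝ) ^ (-ε - 1) := Real.summable_nat_rpow.2 (by linarith)
  have := (summable_nat_add_iff N).2 h
  refine this.congr fun i => ?_
  rw [add_comm]

lemma tsum_zetaErrorTerm {N : ℕ} (hN : 1 ≤ N) {s : ℂ} (hs : 0 < s.re) :
    (Summable fun i => zetaErrorTerm (N + i) s) ∧
    riemannZeta₁ s = (N : ℂ) ^ (1 - s)
      + (s - 1) * ∑ n ∈ range N, ((n + 1 : ℕ) : ℂ) ^ (-s) - ∑' i, zetaErrorTerm (N + i) s := by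
  set ε : ℝ := min (s.re / 2) 1 with hε
  have hε0 : 0 < ε := lt_min (by linarith) one_pos
  set R : ℝ := ‖s‖ + 3 with hR
  set U : Set ℂ := {z | ε < z.re} ∩ Metric.ball 0 R with hU
  have hUo : IsOpen U := (isOpen_lt continuous_const continuous_re).inter Metric.isOpen_ball
  have hUc : IsPreconnected U :=
    ((convex_halfSpace_re_gt ε).inter (convex_ball 0 R)).isPreconnected
  have hsU : s ∈ U := by
    refine ⟨?_, ?_⟩
    · change ε < s.re
      exact lt_of_le_of_lt (min_le_left _ _) (by linarith)
    · rw [mem_ball_zero_iff]; linarith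
  have hbound : ∀ (i : ℕ) (w : ℂ), w ∈ U →
      ‖zetaErrorTerm (N + i) w‖ ≤ ((R + 1) * R) * ((N + i : ℕ) : ℝ) ^ (-ε - 1) := by
    intro i w hw
    have hw1 : ε < w.re := hw.1
    have hw2 : ‖w‖ < R := by simpa using hw.2
    refine (norm_zetaErrorTerm_le (n := N + i) (by omega) (hε0.trans hw1)).trans ?_
    apply mul_le_mul
    · apply mul_le_mul _ hw2.le (norm_nonneg _) (by positivity)
      refine (norm_sub_le _ _).trans ?_
      simp only [norm_one]
      linarith
    · apply Real.rpow_le_rpow_of_exponent_le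
      · exact_mod_cast (by omega : 1 ≤ N + i)
      · linarith
    · positivity
    · positivity
  have hu := summable_zetaErrorTerm_bound N hε0 ((R + 1) * R)
  have hsumm : ∀ w ∈ U, Summable fun i => zetaErrorTerm (N + i) w := fun w hw =>
    Summable.of_norm_bounded hu fun i => hbound i w hw
  refine ⟨hsumm s hsU, ?_⟩
  have hcpow : ∀ (n : ℕ) (f : ℂ → ℂ), 1 ≤ n → Differentiable ℂ f →
      Differentiable ℂ (fun z => (n : ℂ) ^ f z) := fun n f hn hf =>
    hf.const_cpow (Or.inl (by exact_mod_cast (by omega : n ≠ 0)))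
  have hd1 : DifferentiableOn ℂ (fun z => ∑' i, zetaErrorTerm (N + i) z) U := by
    refine differentiableOn_tsum_of_summable_norm hu (fun i => ?_) hUo hbound
    apply Differentiable.differentiableOn
    unfold zetaErrorTerm
    exact ((hcpow _ _ (by omega) (by fun_prop)).sub (hcpow _ _ (by omega) (by fun_prop))).sub
      ((differentiable_id.sub_const 1).mul (hcpow _ _ (by omega) (by fun_prop)))
  have hd2 : DifferentiableOn ℂ (fun z => (N : ℂ) ^ (1 - z)
      + (z - 1) * ∑ n ∈ range N, ((n + 1 : ℕ) : ℂ) ^ (-z) - ∑' i, zetaErrorTerm (N + i) z) U := by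
    refine DifferentiableOn.sub ?_ hd1
    apply Differentiable.differentiableOn
    refine (hcpow _ _ hN (by fun_prop)).add ((differentiable_id.sub_const 1).mul ?_)
    exact Differentiable.fun_sum fun n _ => hcpow _ _ (by omega) (by fun_prop)
  have h2U : (2 : ℂ) ∈ U := by
    refine ⟨?_, ?_⟩
    · change ε < (2 : ℂ).re
      simp only [re_ofNat]
      exact lt_of_le_of_lt (min_le_right _ _) (by norm_num)
    · rw [mem_ball_zero_iff]
      simp only [Complex.norm_ofNat, hR]
      linarith [norm_nonneg s]
  refine (differentiable_riemannZeta₁.differentiableOn.analyticOnNhd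
    hUo).eqOn_of_preconnected_of_eventuallyEq (hd2.analyticOnNhd hUo) hUc h2U ?_ hsU
  have hV : {z : ℂ | 1 < z.re} ∩ U ∈ 𝓝 (2 : ℂ) := by
    refine IsOpen.mem_nhds ((isOpen_lt continuous_const continuous_re).inter hUo) ⟨?_, h2U⟩
    change 1 < (2 : ℂ).re
    simp
  filter_upwards [hV] with w hw
  rw [(hasSum_zetaErrorTerm hw.1 (hsumm w hw.2)).tsum_eq]
  have hw1 : w ≠ 1 := by
    rintro rfl
    have := hw.1
    simp at this
  have : w - 1 ≠ 0 := sub_ne_zero.2 hw1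
  rw [riemannZeta_eq_inv_sub_mul hw1]
  field_simp
  ring

/-- `(s-1) ζ(s) = (s-1) ∑_{n ≤ N} n^{-s} + N^{1-s} + O(|s| |s-1| N^{-σ} / σ)` for `σ > 0`. -/
lemma norm_riemannZeta₁_sub_le {N : ℕ} (hN : 1 ≤ N) {s : ℂ} (hs : 0 < s.re) :
    ‖riemannZeta₁ s - (s - 1) * ∑ n ∈ range N, ((n + 1 : ℕ) : ℂ) ^ (-s) - (N : ℂ) ^ (1 - s)‖
      ≤ ‖s - 1‖ * ‖s‖ / s.re * (N : ℝ) ^ (-s.re) := by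
  obtain ⟨hsum, h⟩ := tsum_zetaErrorTerm hN hs
  have e : riemannZeta₁ s - (s - 1) * ∑ n ∈ range N, ((n + 1 : ℕ) : ℂ) ^ (-s) - (N : ℂ) ^ (1 - s)
      = -∑' i, zetaErrorTerm (N + i) s := by
    rw [h]; ring
  rw [e, norm_neg]
  refine le_of_tendsto' hsum.hasSum.tendsto_sum_nat.norm fun M => ?_
  have key : ∀ M : ℕ, ∑ i ∈ range M, ‖zetaErrorTerm (N + i) s‖
      ≤ ‖s - 1‖ * ‖s‖ / s.re * ((N : ℝ) ^ (-s.re) - ((N + M : ℕ) : ℝ) ^ (-s.re)) := by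
    intro M
    induction M with
    | zero => simp
    | succ M ih =>
      rw [sum_range_succ]
      have h1 := norm_zetaErrorTerm_le_sub (n := N + M) (by omega) hs
      have e2 : (((N + (M + 1) : ℕ)) : ℝ) = ((N + M : ℕ) : ℝ) + 1 := by push_cast; ring
      rw [e2]
      linarith
  refine (norm_sum_le _ _).trans ((key M).trans ?_)
  apply mul_le_mul_of_nonneg_left _ (by positivity)
  have : (0 : ℝ) ≤ ((N + M : ℕ) : ℝ) ^ (-s.re) := by positivity
  linarith

end EulerMaclaurin

end SubgroupCount

namespace SubgroupCount

open Finset Filter Topology Complex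

/-! ### Growth of the zeta function in vertical strips -/

section Growth

lemma norm_Gamma_sq_of_half_add (y : ℝ) :
    ‖Gamma (1 / 2 + y * I)‖ ^ 2 = Real.pi / Real.cosh (Real.pi * y) := by
  have h := Complex.Gamma_mul_Gamma_one_sub (1 / 2 + y * I)
  have e : (1 : ℂ) - (1 / 2 + y * I) = (starRingEnd ℂ) (1 / 2 + y * I) := by
    apply Complex.ext <;> simp
    norm_num
  rw [e, Complex.Gamma_conj] at h
  have hn := congrArg norm h
  rw [norm_mul, Complex.norm_conj, ← pow_two, norm_div, Complex.norm_real,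
    Real.norm_of_nonneg Real.pi_pos.le] at hn
  rw [hn]
  congr 1
  have : (Real.pi : ℂ) * (1 / 2 + y * I) = ((Real.pi * y : ℝ) : ℂ) * I + Real.pi / 2 := by
    push_cast; ring
  rw [this, Complex.sin_add_pi_div_two, Complex.cos_mul_I, ← Complex.ofReal_cosh,
    Complex.norm_real, Real.norm_of_nonneg (Real.cosh_pos _).le]

lemma norm_cos_three_quarters_pi_add_sq (v : ℝ) :
    ‖cos ((3 * Real.pi / 4 : ℝ) + v * I)‖ ^ 2 = Real.cosh (2 * v) / 2 := by
  rw [Complex.sq_norm, Complex.cos_add_mul_I, ← Complex.ofReal_cos, ← Complex.ofReal_sin,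
    ← Complex.ofReal_cosh, ← Complex.ofReal_sinh, ← Complex.ofReal_mul, ← Complex.ofReal_mul,
    sub_eq_add_neg, ← neg_mul, ← Complex.ofReal_neg, Complex.normSq_add_mul_I]
  have e : (3 * Real.pi / 4 : ℝ) = Real.pi - Real.pi / 4 := by ring
  rw [e, Real.cos_pi_sub, Real.sin_pi_sub, Real.cos_pi_div_four, Real.sin_pi_div_four,
    Real.cosh_two_mul]
  have : Real.sqrt 2 ^ 2 = 2 := Real.sq_sqrt (by norm_num)
  ring_nf
  rw [this]
  ring

lemma norm_Gamma_mul_cos_three_halves (y : ℝ) :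
    ‖Gamma (3 / 2 + y * I) * cos (Real.pi * (3 / 2 + y * I) / 2)‖ ≤ 2 * (1 + |y|) := by
  have h1 : Gamma (3 / 2 + y * I) = (1 / 2 + y * I) * Gamma (1 / 2 + y * I) := by
    rw [← Complex.Gamma_add_one]
    · congr 1; ring
    · intro h
      have := congrArg Complex.re h
      simp at this
  have h2 : (Real.pi : ℂ) * (3 / 2 + y * I) / 2
      = ((3 * Real.pi / 4 : ℝ) : ℂ) + ((Real.pi * y / 2 : ℝ) : ℂ) * I := by
    push_cast; ring
  have hc := Real.cosh_pos (Real.pi * y)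
  have hsq : ‖Gamma (3 / 2 + y * I) * cos (Real.pi * (3 / 2 + y * I) / 2)‖ ^ 2
      = (1 / 4 + y ^ 2) * (Real.pi / 2) := by
    rw [h1, h2, norm_mul, norm_mul, mul_pow, mul_pow, norm_Gamma_sq_of_half_add,
      norm_cos_three_quarters_pi_add_sq]
    have e : (1 / 2 : ℂ) + y * I = ((1 / 2 : ℝ) : ℂ) + (y : ℂ) * I := by simp
    rw [e, Complex.sq_norm, Complex.normSq_add_mul_I]
    have e2 : 2 * (Real.pi * y / 2) = Real.pi * y := by ring
    rw [e2]
    field_simp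
    ring
  refine le_of_sq_le_sq ?_ (by positivity)
  rw [hsq, mul_pow, ← sq_abs y]
  have := Real.pi_lt_four
  have := abs_nonneg y
  nlinarith [sq_nonneg |y|]

lemma norm_Gamma_mul_cos_one_sq {y : ℝ} (hy : y ≠ 0) :
    ‖Gamma (1 + y * I) * cos (Real.pi * (1 + y * I) / 2)‖ ^ 2 ≤ 2 * |y| := by
  have hyI : (y : ℂ) * I ≠ 0 := mul_ne_zero (by exact_mod_cast hy) I_ne_zero
  have h1 : Gamma (1 + y * I) = (y * I) * Gamma (y * I) := by
    rw [add_comm, Complex.Gamma_add_one _ hyI]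
  have h := Complex.Gamma_mul_Gamma_one_sub (y * I)
  have e : (1 : ℂ) - y * I = (starRingEnd ℂ) (1 + y * I) := by
    apply Complex.ext <;> simp
  rw [e, Complex.Gamma_conj] at h
  have hG : ‖Gamma (1 + y * I)‖ ^ 2 = |y| * (Real.pi / |Real.sinh (Real.pi * y)|) := by
    have hn := congrArg norm h
    rw [norm_mul, Complex.norm_conj, norm_div, Complex.norm_real,
      Real.norm_of_nonneg Real.pi_pos.le] at hn
    have e2 : (Real.pi : ℂ) * (y * I) = ((Real.pi * y : ℝ) : ℂ) * I := by push_cast; ring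
    rw [e2, Complex.sin_mul_I, ← Complex.ofReal_sinh, norm_mul, Complex.norm_I, mul_one,
      Complex.norm_real, Real.norm_eq_abs] at hn
    have hn1 : ‖Gamma (1 + y * I)‖ = |y| * ‖Gamma (y * I)‖ := by
      rw [h1, norm_mul, norm_mul, Complex.norm_I, mul_one, Complex.norm_real, Real.norm_eq_abs]
    rw [← hn, hn1]
    ring
  have hC : ‖cos (Real.pi * (1 + y * I) / 2)‖ = |Real.sinh (Real.pi * y / 2)| := by
    have e2 : (Real.pi : ℂ) * (1 + y * I) / 2 = ((Real.pi * y / 2 : ℝ) : ℂ) * I + Real.pi / 2 := by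
      push_cast; ring
    rw [e2, Complex.cos_add_pi_div_two, norm_neg, Complex.sin_mul_I, ← Complex.ofReal_sinh, norm_mul,
      Complex.norm_I, mul_one, Complex.norm_real, Real.norm_eq_abs]
  rw [norm_mul, mul_pow, hG, hC]
  set v := Real.pi * y / 2 with hv
  have e3 : Real.pi * y = 2 * v := by rw [hv]; ring
  have hv0 : v ≠ 0 := by
    have := Real.pi_pos.ne'
    simp [hv, hy, this]
  have hs0 : 0 < |Real.sinh v| := abs_pos.2 (Real.sinh_ne_zero.2 hv0)
  have hc0 := Real.cosh_pos v
  rw [e3, Real.sinh_two_mul, abs_mul, abs_mul, abs_of_pos hc0, abs_two]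
  have hsc : |Real.sinh v| ≤ Real.cosh v := by
    rw [abs_le]
    constructor
    · have := Real.exp_pos v
      have h' := Real.cosh_add_sinh v
      linarith
    · exact (Real.sinh_lt_cosh v).le
  have e4 : |y| * (Real.pi / (2 * |Real.sinh v| * Real.cosh v)) * |Real.sinh v| ^ 2
      = |y| * (Real.pi / 2) * (|Real.sinh v| / Real.cosh v) := by
    field_simp
  rw [e4]
  have h5 : |Real.sinh v| / Real.cosh v ≤ 1 := by rwa [div_le_one hc0]
  have h6 : |y| * (Real.pi / 2) ≤ 2 * |y| := by
    have := Real.pi_lt_four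
    have := abs_nonneg y
    nlinarith
  have h7 : 0 ≤ |y| * (Real.pi / 2) := by have := Real.pi_pos; positivity
  nlinarith

lemma norm_Gamma_le_Gamma_re {s : ℂ} (hs : 0 < s.re) : ‖Gamma s‖ ≤ Real.Gamma s.re := by
  rw [Complex.Gamma_eq_integral hs, Real.Gamma_eq_integral hs, Complex.GammaIntegral]
  refine (MeasureTheory.norm_integral_le_integral_norm _).trans (le_of_eq ?_)
  refine MeasureTheory.setIntegral_congr_fun measurableSet_Ioi fun x hx => ?_
  rw [norm_mul, Complex.norm_real, Real.norm_of_nonneg (Real.exp_pos _).le,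
    Complex.norm_cpow_eq_rpow_re_of_pos hx]
  simp

lemma norm_cos_le_exp (z : ℂ) : ‖cos z‖ ≤ Real.exp |z.im| := by
  unfold Complex.cos
  rw [norm_div, Complex.norm_ofNat, div_le_iff₀ two_pos]
  refine (norm_add_le _ _).trans ?_
  rw [Complex.norm_exp, Complex.norm_exp]
  have h1 : (z * I).re = -z.im := by simp
  have h2 : (-z * I).re = z.im := by simp
  rw [h1, h2]
  have h3 : Real.exp (-z.im) ≤ Real.exp |z.im| := Real.exp_le_exp.2 (neg_le_abs _)
  have h4 : Real.exp z.im ≤ Real.exp |z.im| := Real.exp_le_exp.2 (le_abs_self _)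
  linarith

lemma norm_riemannZeta_le_of_one_lt {σ : ℝ} (hσ : 1 < σ) :
    ∃ C : ℝ, 0 ≤ C ∧ ∀ s : ℂ, s.re = σ → ‖riemannZeta s‖ ≤ C := by
  refine ⟨∑' n : ℕ, 1 / (n : ℝ) ^ σ, tsum_nonneg fun n => by positivity, fun s hs => ?_⟩
  rw [zeta_eq_tsum_one_div_nat_cpow (by rw [hs]; exact hσ)]
  have hsum := Real.summable_one_div_nat_rpow.2 hσ
  refine tsum_of_norm_bounded hsum.hasSum fun n => ?_
  rcases Nat.eq_zero_or_pos n with rfl | hn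
  · have : s ≠ 0 := by
      rintro rfl
      simp at hs
      linarith
    rw [Nat.cast_zero, Complex.zero_cpow this]
    simp
    positivity
  · rw [norm_div, norm_one, Complex.norm_natCast_cpow_of_pos hn, hs]

lemma norm_riemannZeta₁_le_mul {s : ℂ} {N : ℕ} (hN : 1 ≤ N) (hs : 0 < s.re) :
    ‖riemannZeta₁ s‖ ≤ ‖s - 1‖ * ∑ n ∈ range N, ((n : ℝ) + 1) ^ (-s.re) + (N : ℝ) ^ (1 - s.re)
      + ‖s - 1‖ * ‖s‖ / s.re * (N : ℝ) ^ (-s.re) := by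
  have h := norm_riemannZeta₁_sub_le hN hs
  have e : riemannZeta₁ s = (riemannZeta₁ s
      - (s - 1) * ∑ n ∈ range N, ((n + 1 : ℕ) : ℂ) ^ (-s) - (N : ℂ) ^ (1 - s))
      + (s - 1) * ∑ n ∈ range N, ((n + 1 : ℕ) : ℂ) ^ (-s) + (N : ℂ) ^ (1 - s) := by ring
  rw [e]
  refine norm_add₃_le.trans ?_
  have h1 : ‖(N : ℂ) ^ (1 - s)‖ = (N : ℝ) ^ (1 - s.re) := by
    rw [Complex.norm_natCast_cpow_of_pos (by omega)]
    simp
  have h2 : ‖(s - 1) * ∑ n ∈ range N, ((n + 1 : ℕ) : ℂ) ^ (-s)‖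
      ≤ ‖s - 1‖ * ∑ n ∈ range N, ((n : ℝ) + 1) ^ (-s.re) := by
    rw [norm_mul]
    apply mul_le_mul_of_nonneg_left _ (norm_nonneg _)
    refine (norm_sum_le _ _).trans (le_of_eq ?_)
    refine Finset.sum_congr rfl fun n _ => ?_
    rw [Complex.norm_natCast_cpow_of_pos (by omega)]
    simp
  rw [h1]
  linarith

lemma norm_le_two_add_abs_im {s : ℂ} (h1 : -2 ≤ s.re) (h2 : s.re ≤ 2) :
    ‖s‖ ≤ 2 * (1 + |s.im|) := by
  refine (Complex.norm_le_abs_re_add_abs_im s).trans ?_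
  have : |s.re| ≤ 2 := abs_le.2 ⟨h1, h2⟩
  have := abs_nonneg s.im
  linarith

lemma norm_sub_one_le {s : ℂ} (h1 : -1 ≤ s.re) (h2 : s.re ≤ 3) :
    ‖s - 1‖ ≤ 2 * (1 + |s.im|) := by
  have := norm_le_two_add_abs_im (s := s - 1) (by simp; linarith) (by simp; linarith)
  simpa using this

lemma norm_riemannZeta₁_le_quadratic {s : ℂ} (h1 : 1 / 2 ≤ s.re) (h2 : s.re ≤ 2) :
    ‖riemannZeta₁ s‖ ≤ 11 * (1 + |s.im|) ^ 2 := by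
  have h := norm_riemannZeta₁_le_mul (s := s) (N := 1) le_rfl (by linarith)
  simp only [range_one, sum_singleton, Nat.cast_zero, zero_add, Real.one_rpow, Nat.cast_one,
    mul_one] at h
  have a := norm_sub_one_le (s := s) (by linarith) (by linarith)
  have b := norm_le_two_add_abs_im (s := s) (by linarith) (by linarith)
  have c := abs_nonneg s.im
  have d : ‖s - 1‖ * ‖s‖ / s.re ≤ 8 * (1 + |s.im|) ^ 2 := by
    rw [div_le_iff₀ (by linarith)]
    have : ‖s - 1‖ * ‖s‖ ≤ 2 * (1 + |s.im|) * (2 * (1 + |s.im|)) :=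
      mul_le_mul a b (norm_nonneg _) (by positivity)
    nlinarith [sq_nonneg (1 + |s.im|)]
  nlinarith

/-- Crude exponential growth, sufficient for the Phragmén–Lindelöf principle. -/
lemma norm_riemannZeta₁_le_exp :
    ∃ A : ℝ, 0 ≤ A ∧ ∀ s : ℂ, -1 / 2 ≤ s.re → s.re ≤ 2 → 1 ≤ |s.im| →
      ‖riemannZeta₁ s‖ ≤ A * Real.exp (6 * |s.im|) := by
  have hcont : ContinuousOn Real.Gamma (Set.Icc (1 / 2) (3 / 2)) := fun x hx =>
    (Real.differentiableAt_Gamma fun m h => by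
      have := hx.1
      have : (0 : ℝ) ≤ m := m.cast_nonneg
      linarith).continuousAt.continuousWithinAt
  obtain ⟨G, hG⟩ := isCompact_Icc.exists_bound_of_continuousOn hcont
  have hG0 : 0 ≤ G := (norm_nonneg _).trans (hG 1 (by norm_num))
  refine ⟨11 + 44 * G, by positivity, fun s h1 h2 h3 => ?_⟩
  have hv : 1 + |s.im| ≤ Real.exp |s.im| := by
    have := Real.add_one_le_exp |s.im|; linarith
  have hv0 := abs_nonneg s.im
  have hpow : ∀ k : ℕ, (1 + |s.im|) ^ k ≤ Real.exp (k * |s.im|) := fun k => by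
    rw [Real.exp_nat_mul]
    exact pow_le_pow_left₀ (by positivity) hv k
  have hexp : ∀ k : ℝ, k ≤ 6 → Real.exp (k * |s.im|) ≤ Real.exp (6 * |s.im|) := fun k hk =>
    Real.exp_le_exp.2 (mul_le_mul_of_nonneg_right hk hv0)
  rcases le_total (1 / 2) s.re with h | h
  · refine (norm_riemannZeta₁_le_quadratic h h2).trans ?_
    have e1 := (hpow 2).trans (hexp 2 (by norm_num))
    have e2 := Real.exp_pos (6 * |s.im|)
    nlinarith
  · set w := 1 - s with hw
    have hwre : w.re = 1 - s.re := by simp [hw]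
    have hwim : |w.im| = |s.im| := by simp [hw]
    have hw1 : 1 ≤ ‖w - 1‖ := by
      refine h3.trans ?_
      rw [← hwim]
      have := Complex.abs_im_le_norm (w - 1)
      simpa using this
    have hwne : w ≠ 1 := by
      intro h
      rw [h] at hw1
      norm_num at hw1
    have hs1 : s ≠ 1 := by
      rintro rfl
      norm_num at h3
    have hfe := riemannZeta_one_sub (s := w) (fun n h => by
      have := congrArg Complex.re h
      simp only [Complex.neg_re, Complex.natCast_re] at this
      have : (0 : ℝ) ≤ n := n.cast_nonneg
      linarith) hwne
    have e : (1 : ℂ) - w = s := by rw [hw]; ring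
    rw [e] at hfe
    have hz : riemannZeta₁ s = (s - 1) * riemannZeta s := by
      rw [riemannZeta_eq_inv_sub_mul hs1, mul_inv_cancel_left₀ (sub_ne_zero.2 hs1)]
    have hzw : ‖riemannZeta w‖ ≤ 11 * (1 + |s.im|) ^ 2 := by
      rw [riemannZeta_eq_inv_sub_mul hwne, norm_mul, norm_inv]
      have := norm_riemannZeta₁_le_quadratic (s := w) (by rw [hwre]; linarith)
        (by rw [hwre]; linarith)
      rw [hwim] at this
      calc ‖w - 1‖⁻¹ * ‖riemannZeta₁ w‖ ≤ 1 * ‖riemannZeta₁ w‖ := by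
            apply mul_le_mul_of_nonneg_right _ (norm_nonneg _)
            exact inv_le_one_of_one_le₀ hw1
        _ ≤ _ := by rw [one_mul]; exact this
    have hgam : ‖Gamma w‖ ≤ G := by
      refine (norm_Gamma_le_Gamma_re (by rw [hwre]; linarith)).trans ?_
      refine (le_abs_self _).trans (hG _ ⟨?_, ?_⟩) <;> rw [hwre] <;> linarith
    have hcos : ‖cos (Real.pi * w / 2)‖ ≤ Real.exp (2 * |s.im|) := by
      refine (norm_cos_le_exp _).trans (Real.exp_le_exp.2 ?_)
      have e : (Real.pi * w / 2 : ℂ).im = Real.pi / 2 * w.im := by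
        have : (Real.pi * w / 2 : ℂ) = ((Real.pi / 2 : ℝ) : ℂ) * w := by push_cast; ring
        rw [this, Complex.re_ofReal_mul |> fun _ => Complex.im_ofReal_mul _ _]
      rw [e, abs_mul, hwim, abs_of_pos (by have := Real.pi_pos; positivity)]
      have := Real.pi_lt_four
      nlinarith
    have hpi : ‖(2 * Real.pi : ℂ) ^ (-w)‖ ≤ 1 := by
      have : (2 * Real.pi : ℂ) = ((2 * Real.pi : ℝ) : ℂ) := by push_cast; ring
      rw [this, Complex.norm_cpow_eq_rpow_re_of_pos (by have := Real.pi_pos; positivity)]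
      apply Real.rpow_le_one_of_one_le_of_nonpos
      · have := Real.pi_gt_three; linarith
      · rw [Complex.neg_re, hwre]; linarith
    rw [hz, hfe, norm_mul, norm_mul, norm_mul, norm_mul, norm_mul, Complex.norm_ofNat]
    have hsn := norm_sub_one_le (s := s) (by linarith) (by linarith)
    have hE := Real.exp_pos (2 * |s.im|)
    calc ‖s - 1‖ * (2 * ‖(2 * Real.pi : ℂ) ^ (-w)‖ * ‖Gamma w‖ * ‖cos (Real.pi * w / 2)‖
          * ‖riemannZeta w‖)
        ≤ (2 * (1 + |s.im|)) * (2 * 1 * G * Real.exp (2 * |s.im|) * (11 * (1 + |s.im|) ^ 2)) := by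
          gcongr
      _ = 44 * G * ((1 + |s.im|) ^ 3 * Real.exp (2 * |s.im|)) := by ring
      _ ≤ 44 * G * (Real.exp ((3 : ℕ) * |s.im|) * Real.exp (2 * |s.im|)) := by
          gcongr
          exact hpow 3
      _ = 44 * G * Real.exp (5 * |s.im|) := by
          rw [← Real.exp_add]
          congr 2
          push_cast
          ring
      _ ≤ (11 + 44 * G) * Real.exp (6 * |s.im|) := by
          have e1 := hexp 5 (by norm_num)
          have e2 := Real.exp_pos (6 * |s.im|)
          have e3 : 44 * G * Real.exp (5 * |s.im|) ≤ 44 * G * Real.exp (6 * |s.im|) :=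
            mul_le_mul_of_nonneg_left e1 (by positivity)
          linarith

/-- **Phragmén–Lindelöf convexity**: polynomial bounds on two vertical lines interpolate. The
factor `exp((w - i t₀)²)` localizes near the height `t₀`. -/
lemma norm_le_rpow_of_vertical_lines {f : ℂ → ℂ} (hf : Differentiable ℂ f) {a b α β C A : ℝ}
    (hab : a < b) (hab3 : b - a ≤ 3) (hα : 0 ≤ α) (hβ : 0 ≤ β) (hC : 0 ≤ C) (hA : 0 ≤ A)
    (hgrow : ∀ s : ℂ, a ≤ s.re → s.re ≤ b → 1 ≤ |s.im| → ‖f s‖ ≤ A * Real.exp (6 * |s.im|))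
    (hfa : ∀ s : ℂ, s.re = a → ‖f s‖ ≤ C * (1 + |s.im|) ^ α)
    (hfb : ∀ s : ℂ, s.re = b → ‖f s‖ ≤ C * (1 + |s.im|) ^ β) :
    ∃ C' : ℝ, 0 ≤ C' ∧ ∀ s : ℂ, a ≤ s.re → s.re ≤ b →
      ‖f s‖ ≤ C' * (1 + |s.im|) ^ ((α * (b - s.re) + β * (s.re - a)) / (b - a)) := by
  set C' : ℝ := C * Real.exp (a ^ 2 + b ^ 2 + α ^ 2 + β ^ 2) with hC'
  have hba : 0 < b - a := sub_pos.2 hab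
  refine ⟨C', by positivity, fun s hs1 hs2 => ?_⟩
  set t₀ := s.im with ht₀
  set L := Real.log (1 + |t₀|) with hL
  have hT : 1 ≤ 1 + |t₀| := by linarith [abs_nonneg t₀]
  have hL0 : 0 ≤ L := Real.log_nonneg hT
  set g : ℂ → ℂ := fun w => f w * cexp ((w - t₀ * I) ^ 2)
    * cexp (-L * ((α * (b - w) + β * (w - a)) / (b - a))) with hg
  have hgn : ∀ w : ℂ, ‖g w‖ = ‖f w‖ * Real.exp (w.re ^ 2 - (w.im - t₀) ^ 2)
      * Real.exp (-L * ((α * (b - w.re) + β * (w.re - a)) / (b - a))) := by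
    intro w
    simp only [hg]
    rw [norm_mul, norm_mul, Complex.norm_exp, Complex.norm_exp]
    congr 3
    · simp [pow_two]
    · have e : (-(L : ℂ) * ((α * (b - w) + β * (w - a)) / (b - a)))
          = ((-L / (b - a) : ℝ) : ℂ) * ((α : ℂ) * ((b : ℂ) - w) + (β : ℂ) * (w - (a : ℂ))) := by
        push_cast
        have : (b : ℂ) - a ≠ 0 := by exact_mod_cast hba.ne'
        field_simp
      rw [e, Complex.re_ofReal_mul]
      simp
      ring
  have hsq : ∀ x : ℝ, a ≤ x → x ≤ b → x ^ 2 ≤ a ^ 2 + b ^ 2 := by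
    intro x h1 h2
    rcases le_total 0 x with h | h <;> nlinarith [sq_nonneg a, sq_nonneg b]
  have hexpo : ∀ x : ℝ, a ≤ x → x ≤ b → 0 ≤ (α * (b - x) + β * (x - a)) / (b - a) := by
    intro x h1 h2
    have := mul_nonneg hα (sub_nonneg.2 h2)
    have := mul_nonneg hβ (sub_nonneg.2 h1)
    positivity
  -- a line bound for `f` becomes a bound for `g` that does not depend on the height `t₀`
  have hline : ∀ (x γ : ℝ), a ≤ x → x ≤ b → 0 ≤ γ → γ ^ 2 ≤ α ^ 2 + β ^ 2 →
      (α * (b - x) + β * (x - a)) / (b - a) = γ → ∀ w : ℂ, w.re = x →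
      ‖f w‖ ≤ C * (1 + |w.im|) ^ γ → ‖g w‖ ≤ C' := by
    intro x γ hx1 hx2 hγ hγ2 hγe w hw hfw
    rw [hgn, hw, hγe]
    have h1 : (1 + |w.im|) ≤ (1 + |t₀|) * Real.exp |w.im - t₀| := by
      have e1 : |w.im| ≤ |t₀| + |w.im - t₀| := by
        have := abs_add_le t₀ (w.im - t₀)
        simpa using this
      have e2 := Real.add_one_le_exp |w.im - t₀|
      have e3 := abs_nonneg (w.im - t₀)
      nlinarith [abs_nonneg t₀]
    have h2 : (1 + |w.im|) ^ γ ≤ Real.exp (L * γ) * Real.exp (|w.im - t₀| * γ) := by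
      refine (Real.rpow_le_rpow (by positivity) h1 hγ).trans (le_of_eq ?_)
      rw [Real.mul_rpow (by positivity) (Real.exp_pos _).le, ← Real.exp_mul,
        Real.rpow_def_of_pos (by positivity)]
    calc ‖f w‖ * Real.exp (x ^ 2 - (w.im - t₀) ^ 2) * Real.exp (-L * γ)
        ≤ (C * (Real.exp (L * γ) * Real.exp (|w.im - t₀| * γ)))
          * Real.exp (x ^ 2 - (w.im - t₀) ^ 2) * Real.exp (-L * γ) := by
          gcongr
          exact hfw.trans (mul_le_mul_of_nonneg_left h2 hC)
      _ = C * Real.exp (L * γ + |w.im - t₀| * γ + (x ^ 2 - (w.im - t₀) ^ 2) + -L * γ) := by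
          rw [Real.exp_add, Real.exp_add, Real.exp_add]
          ring
      _ ≤ C' := by
          rw [hC']
          apply mul_le_mul_of_nonneg_left _ hC
          apply Real.exp_le_exp.2
          have := hsq x hx1 hx2
          rw [← sq_abs (w.im - t₀)]
          nlinarith [sq_nonneg (|w.im - t₀| - γ), sq_nonneg |w.im - t₀|]
  have hgd : Differentiable ℂ g := by
    simp only [hg]
    fun_prop
  have hB : ∃ c < Real.pi / (b - a), ∃ B,
      g =O[comap (_root_.abs ∘ im) atTop ⊓ 𝓟 (re ⁻¹' Set.Ioo a b)]
        fun z => Real.exp (B * Real.exp (c * |z.im|)) := by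
    refine ⟨1, ?_, 6, ?_⟩
    · rw [lt_div_iff₀ hba]
      have := Real.pi_gt_three
      linarith
    · apply Asymptotics.IsBigO.of_bound (A * Real.exp (a ^ 2 + b ^ 2))
      have h1 : ∀ᶠ z : ℂ in comap (_root_.abs ∘ im) atTop, 1 ≤ |z.im| :=
        tendsto_comap.eventually (eventually_ge_atTop (1 : ℝ))
      rw [eventually_inf_principal]
      filter_upwards [h1] with w hw1 hw2
      have hwa : a ≤ w.re := (show a < w.re from hw2.1).le
      have hwb : w.re ≤ b := (show w.re < b from hw2.2).le
      rw [hgn, Real.norm_of_nonneg (Real.exp_pos _).le]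
      have e1 := hgrow w hwa hwb hw1
      have e2 : Real.exp (w.re ^ 2 - (w.im - t₀) ^ 2) ≤ Real.exp (a ^ 2 + b ^ 2) :=
        Real.exp_le_exp.2 (by nlinarith [hsq w.re hwa hwb, sq_nonneg (w.im - t₀)])
      have e3 : Real.exp (-L * ((α * (b - w.re) + β * (w.re - a)) / (b - a))) ≤ 1 := by
        apply Real.exp_le_one_iff.2
        have := mul_nonneg hL0 (hexpo w.re hwa hwb)
        linarith
      have e4 : Real.exp (6 * |w.im|) ≤ Real.exp (6 * Real.exp (1 * |w.im|)) := by
        apply Real.exp_le_exp.2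
        have := Real.add_one_le_exp (1 * |w.im|)
        linarith
      calc ‖f w‖ * Real.exp (w.re ^ 2 - (w.im - t₀) ^ 2)
            * Real.exp (-L * ((α * (b - w.re) + β * (w.re - a)) / (b - a)))
          ≤ (A * Real.exp (6 * Real.exp (1 * |w.im|))) * Real.exp (a ^ 2 + b ^ 2) * 1 := by
            gcongr
            exact e1.trans (mul_le_mul_of_nonneg_left e4 hA)
        _ = _ := by ring
  have hmain : ‖g s‖ ≤ C' := by
    refine PhragmenLindelof.vertical_strip (hgd.diffContOnCl) hB ?_ ?_ hs1 hs2
    · intro w hw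
      refine hline a α le_rfl hab.le hα (by nlinarith [sq_nonneg β]) ?_ w hw (hfa w hw)
      rw [sub_self, mul_zero, add_zero, mul_div_cancel_right₀ _ hba.ne']
    · intro w hw
      refine hline b β hab.le le_rfl hβ (by nlinarith [sq_nonneg α]) ?_ w hw (hfb w hw)
      rw [sub_self, mul_zero, zero_add, mul_div_cancel_right₀ _ hba.ne']
  rw [hgn, ← ht₀, sub_self] at hmain
  set γ := (α * (b - s.re) + β * (s.re - a)) / (b - a) with hγ
  have e1 : (1 + |t₀|) ^ γ = Real.exp (L * γ) := by
    rw [Real.rpow_def_of_pos (by positivity)]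
  rw [e1]
  have e2 : 1 ≤ Real.exp (s.re ^ 2 - 0 ^ 2) := Real.one_le_exp (by nlinarith [sq_nonneg s.re])
  have e3 : Real.exp (-L * γ) * Real.exp (L * γ) = 1 := by
    rw [← Real.exp_add]; simp
  calc ‖f s‖ = ‖f s‖ * 1 * (Real.exp (-L * γ) * Real.exp (L * γ)) := by rw [e3]; ring
    _ ≤ ‖f s‖ * Real.exp (s.re ^ 2 - 0 ^ 2) * (Real.exp (-L * γ) * Real.exp (L * γ)) := by
        gcongr
    _ = (‖f s‖ * Real.exp (s.re ^ 2 - 0 ^ 2) * Real.exp (-L * γ)) * Real.exp (L * γ) := by ring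
    _ ≤ C' * Real.exp (L * γ) := mul_le_mul_of_nonneg_right hmain (Real.exp_pos _).le

end Growth

end SubgroupCount

namespace SubgroupCount

open Finset Filter Topology Complex

/-! ### Bounds for the zeta function on vertical lines and in strips -/

section LineBounds

lemma riemannZeta₁_eq_mul {s : ℂ} (hs : s ≠ 1) : riemannZeta₁ s = (s - 1) * riemannZeta s := by
  rw [riemannZeta_eq_inv_sub_mul hs, mul_inv_cancel_left₀ (sub_ne_zero.2 hs)]

lemma norm_two_pi_cpow_le_one {s : ℂ} (hs : 0 ≤ s.re) : ‖(2 * Real.pi : ℂ) ^ (-s)‖ ≤ 1 := by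
  have e : (2 * Real.pi : ℂ) = ((2 * Real.pi : ℝ) : ℂ) := by push_cast; rfl
  rw [e, Complex.norm_cpow_eq_rpow_re_of_pos (by positivity)]
  apply Real.rpow_le_one_of_one_le_of_nonpos
  · nlinarith [Real.pi_gt_three]
  · simpa using hs

lemma norm_riemannZeta₁_le_of_re_neg_half :
    ∃ C : ℝ, 0 ≤ C ∧ ∀ s : ℂ, s.re = -1 / 2 → ‖riemannZeta₁ s‖ ≤ C * (1 + |s.im|) ^ (2 : ℝ) := by
  obtain ⟨C, hC, h⟩ := norm_riemannZeta_le_of_one_lt (σ := 3 / 2) (by norm_num)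
  refine ⟨8 * C, by positivity, fun s hs => ?_⟩
  have hs1 : s ≠ 1 := by
    rintro rfl
    norm_num at hs
  set s' : ℂ := 1 - s with hs'
  have hre : s'.re = 3 / 2 := by simp [hs', hs]; norm_num
  have him : s'.im = -s.im := by simp [hs']
  have e : s' = 3 / 2 + (s'.im : ℂ) * I := by
    apply Complex.ext <;> simp [hre]
  have hf := riemannZeta_one_sub (s := s')
    (fun n hn => by
      have := congrArg Complex.re hn
      simp [hre] at this
      have : (0 : ℝ) ≤ n := n.cast_nonneg
      linarith)
    (by intro hh; rw [hh] at hre; norm_num at hre)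
  have hs1' : 1 - s' = s := by simp [hs']
  rw [hs1'] at hf
  have hG := norm_Gamma_mul_cos_three_halves s'.im
  rw [← e, him, abs_neg] at hG
  have hz := h s' hre
  have hp := norm_two_pi_cpow_le_one (s := s') (by rw [hre]; norm_num)
  have h0 := abs_nonneg s.im
  have hζ : ‖riemannZeta s‖ ≤ 2 * 1 * (2 * (1 + |s.im|)) * C := by
    rw [hf, mul_assoc (2 * (2 * (Real.pi : ℂ)) ^ (-s')), norm_mul, norm_mul, norm_mul,
      Complex.norm_ofNat]
    gcongr
  rw [riemannZeta₁_eq_mul hs1, norm_mul]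
  have h2 := norm_sub_one_le (s := s) (by rw [hs]; norm_num) (by rw [hs]; norm_num)
  calc ‖s - 1‖ * ‖riemannZeta s‖ ≤ (2 * (1 + |s.im|)) * (2 * 1 * (2 * (1 + |s.im|)) * C) := by
        gcongr
    _ = _ := by rw [Real.rpow_two]; ring

lemma norm_riemannZeta₁_le_of_re_one :
    ∃ C : ℝ, 0 ≤ C ∧ ∀ s : ℂ, s.re = 1 → ‖riemannZeta₁ s‖ ≤ C * (1 + |s.im|) ^ (1.01 : ℝ) := by
  refine ⟨309, by positivity, fun s hs => ?_⟩
  set t := |s.im| with ht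
  have ht0 : 0 ≤ t := abs_nonneg _
  set N : ℕ := ⌈t⌉₊ + 1 with hN
  have hN1 : 1 ≤ N := by omega
  have hNt : t ≤ N := (Nat.le_ceil t).trans (by rw [hN]; push_cast; linarith)
  have hNt1 : 1 + t ≤ N := by
    have := Nat.le_ceil t
    rw [hN]; push_cast; linarith
  have hNt2 : (N : ℝ) ≤ 2 * (1 + t) := by
    have := Nat.ceil_lt_add_one ht0
    rw [hN]; push_cast; linarith
  have hNpos : (0 : ℝ) < N := by positivity
  have h := norm_riemannZeta₁_le_mul (s := s) hN1 (by rw [hs]; norm_num)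
  have h2 := norm_sub_one_le (s := s) (by rw [hs]; norm_num) (by rw [hs]; norm_num)
  have h3 := norm_le_two_add_abs_im (s := s) (by rw [hs]; norm_num) (by rw [hs]; norm_num)
  rw [hs] at h
  have hsum : ∑ n ∈ range N, ((n : ℝ) + 1) ^ (-(1 : ℝ)) ≤ 150 * (1 + t) ^ (0.01 : ℝ) := by
    have e : ∑ n ∈ range N, ((n : ℝ) + 1) ^ (-(1 : ℝ)) = (harmonic N : ℝ) := by
      rw [harmonic]
      push_cast
      exact sum_congr rfl fun n _ => Real.rpow_neg_one _
    rw [e]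
    refine (harmonic_le_one_add_log N).trans ?_
    have hl : Real.log N ≤ Real.log 2 + Real.log (1 + t) := by
      rw [← Real.log_mul (by norm_num) (by positivity)]
      exact Real.log_le_log hNpos hNt2
    have hl2 := Real.log_le_rpow_div (x := 1 + t) (ε := 0.01) (by positivity) (by norm_num)
    have hl3 : (1 : ℝ) ≤ (1 + t) ^ (0.01 : ℝ) := Real.one_le_rpow (by linarith) (by norm_num)
    have := Real.log_two_lt_d9
    have e2 : (1 + t) ^ (0.01 : ℝ) / 0.01 = 100 * (1 + t) ^ (0.01 : ℝ) := by ring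
    rw [e2] at hl2
    linarith
  have hlast : ‖s - 1‖ * ‖s‖ / 1 * (N : ℝ) ^ (-(1 : ℝ)) ≤ 4 * (1 + t) := by
    rw [Real.rpow_neg_one, div_one, ← div_eq_mul_inv, div_le_iff₀ hNpos]
    calc ‖s - 1‖ * ‖s‖ ≤ (2 * (1 + t)) * (2 * (1 + t)) := by gcongr
      _ = 4 * (1 + t) * (1 + t) := by ring
      _ ≤ _ := by gcongr
  have e3 : (1 + t) ^ (1.01 : ℝ) = (1 + t) * (1 + t) ^ (0.01 : ℝ) := by
    rw [← Real.rpow_one_add' (by positivity) (by norm_num)]; norm_num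
  have hl3 : (1 : ℝ) ≤ (1 + t) ^ (0.01 : ℝ) := Real.one_le_rpow (by linarith) (by norm_num)
  have hfirst : ‖s - 1‖ * ∑ n ∈ range N, ((n : ℝ) + 1) ^ (-(1 : ℝ))
      ≤ (2 * (1 + t)) * (150 * (1 + t) ^ (0.01 : ℝ)) := by
    have : 0 ≤ ∑ n ∈ range N, ((n : ℝ) + 1) ^ (-(1 : ℝ)) := sum_nonneg fun n _ => by positivity
    gcongr
  have hmid : (N : ℝ) ^ (1 - 1 : ℝ) = 1 := by norm_num
  rw [hmid] at h
  rw [e3]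
  have : (1 + t) * 1 ≤ (1 + t) * (1 + t) ^ (0.01 : ℝ) := by gcongr
  nlinarith

lemma norm_riemannZeta₁_le_of_re_zero :
    ∃ C : ℝ, 0 ≤ C ∧ ∀ s : ℂ, s.re = 0 → ‖riemannZeta₁ s‖ ≤ C * (1 + |s.im|) ^ (1.51 : ℝ) := by
  obtain ⟨C, hC, h⟩ := norm_riemannZeta₁_le_of_re_one
  obtain ⟨B, hB⟩ := (isCompact_closedBall (0 : ℂ) 1).exists_bound_of_continuousOn
    differentiable_riemannZeta₁.continuous.continuousOn
  have hB0 : 0 ≤ B := (norm_nonneg _).trans (hB 0 (by simp))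
  refine ⟨16 * C + B, by positivity, fun s hs => ?_⟩
  have ht0 : 0 ≤ |s.im| := abs_nonneg _
  rcases le_total |s.im| 1 with hle | hge
  · have h1 : (1 : ℝ) ≤ (1 + |s.im|) ^ (1.51 : ℝ) := Real.one_le_rpow (by linarith) (by norm_num)
    have h2 := hB s (by
      rw [mem_closedBall_zero_iff]
      refine (Complex.norm_le_abs_re_add_abs_im s).trans ?_
      rw [hs]; simpa using hle)
    calc _ ≤ B := h2
      _ ≤ (16 * C + B) * 1 := by linarith
      _ ≤ _ := by gcongr
  · have hs1 : s ≠ 1 := by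
      rintro rfl
      norm_num at hs
    set s' : ℂ := 1 - s with hs'
    have hre : s'.re = 1 := by simp [hs', hs]
    have him : s'.im = -s.im := by simp [hs']
    have hsim : s'.im ≠ 0 := by
      intro hh
      rw [him, neg_eq_zero] at hh
      rw [hh] at hge
      norm_num at hge
    have e : s' = 1 + (s'.im : ℂ) * I := by
      apply Complex.ext <;> simp [hre]
    have hs'1 : s' ≠ 1 := by intro hh; rw [hh] at hsim; simp at hsim
    have hf := riemannZeta_one_sub (s := s')
      (fun n hn => by
        have := congrArg Complex.re hn
        simp [hre] at this
        have : (0 : ℝ) ≤ n := n.cast_nonneg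
        linarith) hs'1
    have hs1' : 1 - s' = s := by simp [hs']
    rw [hs1'] at hf
    have hG2 := norm_Gamma_mul_cos_one_sq hsim
    rw [← e, him, abs_neg] at hG2
    have hG : ‖Gamma s' * cos (Real.pi * s' / 2)‖ ≤ 2 * (1 + |s.im|) ^ (0.5 : ℝ) := by
      refine (pow_le_pow_iff_left₀ (norm_nonneg _) (by positivity) two_ne_zero).1 ?_
      rw [mul_pow, ← Real.rpow_natCast (_ ^ (0.5 : ℝ)), ← Real.rpow_mul (by positivity)]
      have e2 : (1 + |s.im|) ^ ((0.5 : ℝ) * (2 : ℕ)) = 1 + |s.im| := by norm_num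
      rw [e2]
      linarith
    have hp := norm_two_pi_cpow_le_one (s := s') (by rw [hre]; norm_num)
    have hz1 := h s' hre
    rw [him, abs_neg] at hz1
    have hz : ‖riemannZeta s'‖ ≤ 2 * C * (1 + |s.im|) ^ (0.01 : ℝ) := by
      have h3 : |s.im| ≤ ‖s' - 1‖ := by
        have := Complex.abs_im_le_norm (s' - 1)
        simpa [him] using this
      rw [riemannZeta₁_eq_mul hs'1, norm_mul] at hz1
      have e3 : (1 + |s.im|) ^ (1.01 : ℝ) = (1 + |s.im|) * (1 + |s.im|) ^ (0.01 : ℝ) := by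
        rw [← Real.rpow_one_add' (by positivity) (by norm_num)]; norm_num
      rw [e3] at hz1
      have h4 : |s.im| * ‖riemannZeta s'‖ ≤ |s.im| * (2 * C * (1 + |s.im|) ^ (0.01 : ℝ)) := by
        calc _ ≤ ‖s' - 1‖ * ‖riemannZeta s'‖ := by gcongr
          _ ≤ _ := hz1
          _ ≤ C * ((2 * |s.im|) * (1 + |s.im|) ^ (0.01 : ℝ)) := by gcongr; linarith
          _ = _ := by ring
      exact le_of_mul_le_mul_left h4 (by linarith)
    have hζ : ‖riemannZeta s‖
        ≤ 2 * 1 * (2 * (1 + |s.im|) ^ (0.5 : ℝ)) * (2 * C * (1 + |s.im|) ^ (0.01 : ℝ)) := by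
      rw [hf, mul_assoc (2 * (2 * (Real.pi : ℂ)) ^ (-s')), norm_mul, norm_mul, norm_mul,
        Complex.norm_ofNat]
      gcongr
    rw [riemannZeta₁_eq_mul hs1, norm_mul]
    have h2 := norm_sub_one_le (s := s) (by rw [hs]; norm_num) (by rw [hs]; norm_num)
    have e5 : (1 + |s.im|) ^ (1.51 : ℝ)
        = (1 + |s.im|) * ((1 + |s.im|) ^ (0.5 : ℝ) * (1 + |s.im|) ^ (0.01 : ℝ)) := by
      rw [← Real.rpow_add (by positivity), ← Real.rpow_one_add' (by positivity) (by norm_num)]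
      norm_num
    calc ‖s - 1‖ * ‖riemannZeta s‖
        ≤ (2 * (1 + |s.im|)) *
          (2 * 1 * (2 * (1 + |s.im|) ^ (0.5 : ℝ)) * (2 * C * (1 + |s.im|) ^ (0.01 : ℝ))) := by
          gcongr
      _ = (16 * C + 0) * (1 + |s.im|) ^ (1.51 : ℝ) := by rw [e5]; ring
      _ ≤ _ := by gcongr

lemma norm_riemannZeta₁_le_of_re_two :
    ∃ C : ℝ, 0 ≤ C ∧ ∀ s : ℂ, s.re = 2 → ‖riemannZeta₁ s‖ ≤ C * (1 + |s.im|) ^ (1 : ℝ) := by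
  obtain ⟨C, hC, h⟩ := norm_riemannZeta_le_of_one_lt (σ := 2) (by norm_num)
  refine ⟨2 * C, by positivity, fun s hs => ?_⟩
  have hs1 : s ≠ 1 := by
    rintro rfl
    norm_num at hs
  have h2 := norm_sub_one_le (s := s) (by rw [hs]; norm_num) (by rw [hs]; norm_num)
  have h3 := h s hs
  rw [riemannZeta₁_eq_mul hs1, norm_mul, Real.rpow_one]
  calc ‖s - 1‖ * ‖riemannZeta s‖ ≤ (2 * (1 + |s.im|)) * C := by gcongr
    _ = _ := by ring

/-- Convexity between two vertical lines of the strip `-1/2 ≤ Re s ≤ 2`, in the form of a uniform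
exponent on a third line and to its right. -/
lemma norm_riemannZeta₁_le_of_lines {a b α β : ℝ} (ha : -1 / 2 ≤ a) (hab : a < b) (hb : b ≤ 2)
    (hα : 0 ≤ α) (hβ : 0 ≤ β)
    (h1 : ∃ C : ℝ, 0 ≤ C ∧ ∀ s : ℂ, s.re = a → ‖riemannZeta₁ s‖ ≤ C * (1 + |s.im|) ^ α)
    (h2 : ∃ C : ℝ, 0 ≤ C ∧ ∀ s : ℂ, s.re = b → ‖riemannZeta₁ s‖ ≤ C * (1 + |s.im|) ^ β)
    {c γ : ℝ} (hβα : β ≤ α) (hac : a ≤ c) (hγ : (α * (b - c) + β * (c - a)) / (b - a) ≤ γ) :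
    ∃ C : ℝ, 0 ≤ C ∧ ∀ s : ℂ, c ≤ s.re → s.re ≤ b → ‖riemannZeta₁ s‖ ≤ C * (1 + |s.im|) ^ γ := by
  obtain ⟨C₁, hC₁, h1⟩ := h1
  obtain ⟨C₂, hC₂, h2⟩ := h2
  obtain ⟨A, hA, hexp⟩ := norm_riemannZeta₁_le_exp
  obtain ⟨C, hC, h⟩ := norm_le_rpow_of_vertical_lines differentiable_riemannZeta₁ (C := C₁ + C₂)
    hab (by linarith) hα hβ (by positivity) hA
    (fun s ha' hb' hi => hexp s (by linarith) (by linarith) hi)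
    (fun s hs => (h1 s hs).trans (by gcongr; linarith))
    (fun s hs => (h2 s hs).trans (by gcongr; linarith))
  refine ⟨C, hC, fun s hcs hsb => (h s (by linarith) hsb).trans ?_⟩
  gcongr
  · linarith [abs_nonneg s.im]
  · refine le_trans ?_ hγ
    have : 0 < b - a := by linarith
    gcongr ?_ / _
    nlinarith

lemma norm_riemannZeta₁_le_of_neg_two_hundredths_le :
    ∃ C : ℝ, 0 ≤ C ∧ ∀ s : ℂ, -0.02 ≤ s.re → s.re ≤ 2 →
      ‖riemannZeta₁ s‖ ≤ C * (1 + |s.im|) ^ (1.53 : ℝ) := by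
  obtain ⟨C, hC, h⟩ := norm_riemannZeta₁_le_of_lines (by norm_num) (by norm_num) (by norm_num)
    (by norm_num) (by norm_num) norm_riemannZeta₁_le_of_re_neg_half
    norm_riemannZeta₁_le_of_re_zero (c := -0.02) (γ := 1.53) (by norm_num) (by norm_num)
    (by norm_num)
  exact norm_riemannZeta₁_le_of_lines (a := -0.02) (b := 2) (α := 1.53) (by norm_num)
    (by norm_num) (by norm_num) (by norm_num) (by norm_num)
    ⟨C, hC, fun s hs => h s hs.ge (by rw [hs]; norm_num)⟩
    norm_riemannZeta₁_le_of_re_two (by norm_num) le_rfl (by norm_num)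

lemma norm_riemannZeta₁_le_of_forty_nine_hundredths_le :
    ∃ C : ℝ, 0 ≤ C ∧ ∀ s : ℂ, 0.49 ≤ s.re → s.re ≤ 2 →
      ‖riemannZeta₁ s‖ ≤ C * (1 + |s.im|) ^ (1.265 : ℝ) := by
  obtain ⟨C, hC, h⟩ := norm_riemannZeta₁_le_of_lines (by norm_num) (by norm_num) (by norm_num)
    (by norm_num) (by norm_num) norm_riemannZeta₁_le_of_re_zero
    norm_riemannZeta₁_le_of_re_one (c := 0.49) (γ := 1.265) (by norm_num) (by norm_num)
    (by norm_num)
  exact norm_riemannZeta₁_le_of_lines (a := 0.49) (b := 2) (α := 1.265) (by norm_num)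
    (by norm_num) (by norm_num) (by norm_num) (by norm_num)
    ⟨C, hC, fun s hs => h s hs.ge (by rw [hs]; norm_num)⟩
    norm_riemannZeta₁_le_of_re_two (by norm_num) le_rfl (by norm_num)

end LineBounds

end SubgroupCount

namespace SubgroupCount

open Finset

/-! ### Mean values of Dirichlet polynomials -/

section MeanValue

lemma norm_sum_mul_exp_sq (s : Finset ℕ) (b θ : ℕ → ℝ) :
    ‖∑ n ∈ s, (b n : ℂ) * Complex.exp ((θ n : ℝ) * Complex.I)‖ ^ 2
      = ∑ m ∈ s, ∑ n ∈ s, b m * b n * Real.cos (θ m - θ n) := by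
  have hre : (∑ n ∈ s, (b n : ℂ) * Complex.exp ((θ n : ℝ) * Complex.I)).re
      = ∑ n ∈ s, b n * Real.cos (θ n) := by
    rw [Complex.re_sum]
    exact sum_congr rfl fun n _ => by rw [Complex.re_ofReal_mul, Complex.exp_ofReal_mul_I_re]
  have him : (∑ n ∈ s, (b n : ℂ) * Complex.exp ((θ n : ℝ) * Complex.I)).im
      = ∑ n ∈ s, b n * Real.sin (θ n) := by
    rw [Complex.im_sum]
    exact sum_congr rfl fun n _ => by rw [Complex.im_ofReal_mul, Complex.exp_ofReal_mul_I_im]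
  rw [Complex.sq_norm, Complex.normSq_apply, hre, him, sum_mul_sum, sum_mul_sum,
    ← sum_add_distrib]
  refine sum_congr rfl fun m _ => ?_
  rw [← sum_add_distrib]
  refine sum_congr rfl fun n _ => ?_
  rw [Real.cos_sub]
  ring

lemma abs_integral_cos_mul_le {l : ℝ} (hl : l ≠ 0) (a b : ℝ) :
    |∫ t in a..b, Real.cos (t * l)| ≤ 2 / |l| := by
  rw [intervalIntegral.integral_comp_mul_right _ hl, integral_cos, smul_eq_mul, abs_mul, abs_inv,
    inv_mul_eq_div]
  gcongr
  have h1 := Real.abs_sin_le_one (b * l)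
  have h2 := Real.abs_sin_le_one (a * l)
  calc _ ≤ |Real.sin (b * l)| + |Real.sin (a * l)| := abs_sub _ _
    _ ≤ _ := by linarith

lemma abs_sub_div_le_abs_log_sub_log {m n N : ℕ} (hm : 1 ≤ m) (hn : 1 ≤ n) (hmN : m ≤ N)
    (hnN : n ≤ N) : |(m : ℝ) - n| / N ≤ |Real.log m - Real.log n| := by
  wlog h : m ≤ n generalizing m n
  · rw [abs_sub_comm, abs_sub_comm (Real.log m)]
    exact this hn hm hnN hmN (by omega)
  have hm0 : (0 : ℝ) < m := by exact_mod_cast hm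
  have hn0 : (0 : ℝ) < n := by exact_mod_cast hn
  have hN0 : (0 : ℝ) < N := by exact_mod_cast (hn.trans hnN)
  have hmn : (m : ℝ) ≤ n := by exact_mod_cast h
  have hl : Real.log m ≤ Real.log n := Real.log_le_log hm0 hmn
  rw [abs_sub_comm, abs_sub_comm (Real.log m), abs_of_nonneg (by linarith),
    abs_of_nonneg (by linarith), ← Real.log_div hn0.ne' hm0.ne']
  have h1 := Real.one_sub_inv_le_log_of_pos (x := (n : ℝ) / m) (by positivity)
  refine le_trans ?_ h1
  have e : 1 - ((n : ℝ) / m)⁻¹ = (n - m) / n := by field_simp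
  rw [e]
  have : 0 ≤ (n : ℝ) - m := by linarith
  have : (n : ℝ) ≤ N := by exact_mod_cast hnN
  gcongr

lemma sum_range_inv_le {N : ℕ} : ∑ i ∈ range N, ((i : ℝ) + 1)⁻¹ ≤ 1 + Real.log N := by
  have h := harmonic_le_one_add_log N
  rw [harmonic] at h
  push_cast at h
  exact h

lemma sum_inv_abs_sub_le {m N : ℕ} (hm : m < N) :
    ∑ n ∈ range N, |(m : ℝ) - n|⁻¹ ≤ 2 * (1 + Real.log N) := by
  have hN : (0 : ℝ) < N := by exact_mod_cast (by omega : 0 < N)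
  rw [← sum_range_add_sum_Ico _ hm.le, sum_eq_sum_Ico_succ_bot hm]
  have h1 : ∑ n ∈ range m, |(m : ℝ) - n|⁻¹ ≤ 1 + Real.log N := by
    rw [← sum_range_reflect]
    calc ∑ j ∈ range m, |(m : ℝ) - ((m - 1 - j : ℕ) : ℝ)|⁻¹
        = ∑ i ∈ range m, ((i : ℝ) + 1)⁻¹ := sum_congr rfl fun j hj => by
          have hj := mem_range.1 hj
          have e : ((m - 1 - j : ℕ) : ℝ) = m - 1 - j := by
            rw [Nat.sub_sub, Nat.cast_sub (by omega)]; push_cast; ring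
          rw [e, abs_of_nonneg] <;> ring_nf
          positivity
      _ ≤ ∑ i ∈ range N, ((i : ℝ) + 1)⁻¹ :=
          sum_le_sum_of_subset_of_nonneg (range_mono hm.le) fun _ _ _ => by positivity
      _ ≤ _ := sum_range_inv_le
  have h2 : ∑ n ∈ Ico (m + 1) N, |(m : ℝ) - n|⁻¹ ≤ 1 + Real.log N := by
    rw [sum_Ico_eq_sum_range]
    calc ∑ j ∈ range (N - (m + 1)), |(m : ℝ) - ((m + 1 + j : ℕ) : ℝ)|⁻¹
        = ∑ i ∈ range (N - (m + 1)), ((i : ℝ) + 1)⁻¹ := sum_congr rfl fun j hj => by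
          rw [abs_sub_comm, abs_of_nonneg] <;> push_cast <;> ring_nf
          positivity
      _ ≤ ∑ i ∈ range N, ((i : ℝ) + 1)⁻¹ :=
          sum_le_sum_of_subset_of_nonneg (range_mono (by omega)) fun _ _ _ => by positivity
      _ ≤ _ := sum_range_inv_le
  simp only [sub_self, abs_zero, inv_zero, zero_add]
  linarith

/-- The mean value theorem for Dirichlet polynomials, with an error term that is larger by a
logarithm than the one given by Hilbert's inequality. -/
lemma integral_norm_dirichletPolynomial_sq_le (b : ℕ → ℝ) {N : ℕ} {T T' : ℝ} (hT : T ≤ T') :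
    ∫ t in T..T', ‖∑ n ∈ Ico 1 N, (b n : ℂ) * Complex.exp ((t * Real.log n : ℝ) * Complex.I)‖ ^ 2
      ≤ ((T' - T) + 4 * N * (1 + Real.log N)) * ∑ n ∈ Ico 1 N, b n ^ 2 := by
  set K : ℕ → ℕ → ℝ := fun m n => (if m = n then T' - T else 0) + 2 * N * |(m : ℝ) - n|⁻¹ with hK
  have hKsymm : ∀ m n, K m n = K n m := fun m n => by
    simp only [hK, abs_sub_comm (m : ℝ), eq_comm]
  have hK0 : ∀ m n, 0 ≤ K m n := fun m n => by
    have : 0 ≤ T' - T := sub_nonneg.2 hT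
    simp only [hK]
    split_ifs <;> positivity
  have hI : ∀ m ∈ Ico 1 N, ∀ n ∈ Ico 1 N,
      |∫ t in T..T', Real.cos (t * Real.log m - t * Real.log n)| ≤ K m n := by
    intro m hm n hn
    rw [mem_Ico] at hm hn
    by_cases h : m = n
    · subst h
      simp only [sub_self, Real.cos_zero, intervalIntegral.integral_const, smul_eq_mul, mul_one, hK,
        if_true, abs_zero, inv_zero, mul_zero, add_zero]
      rw [abs_of_nonneg (sub_nonneg.2 hT)]
    · have h0 : (0 : ℝ) < |(m : ℝ) - n| := abs_pos.2 (sub_ne_zero.2 (by exact_mod_cast h))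
      have hN : (0 : ℝ) < N := by exact_mod_cast (by omega : 0 < N)
      have h1 := abs_sub_div_le_abs_log_sub_log hm.1 hn.1 hm.2.le hn.2.le
      have h2 : 0 < |Real.log m - Real.log n| := lt_of_lt_of_le (by positivity) h1
      simp only [← mul_sub]
      refine (abs_integral_cos_mul_le (abs_pos.1 h2) _ _).trans ?_
      simp only [hK, if_neg h, zero_add]
      calc 2 / |Real.log m - Real.log n| ≤ 2 / (|(m : ℝ) - n| / N) := by gcongr
        _ = _ := by field_simp
  have hsum : ∀ m ∈ Ico 1 N, ∑ n ∈ Ico 1 N, K m n ≤ (T' - T) + 4 * N * (1 + Real.log N) := by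
    intro m hm
    simp only [hK]
    rw [sum_add_distrib, sum_ite_eq, if_pos hm, ← mul_sum]
    have h1 : ∑ n ∈ Ico 1 N, |(m : ℝ) - n|⁻¹ ≤ ∑ n ∈ range N, |(m : ℝ) - n|⁻¹ :=
      sum_le_sum_of_subset_of_nonneg (fun x hx => mem_range.2 (mem_Ico.1 hx).2)
        fun _ _ _ => by positivity
    have h2 := h1.trans (sum_inv_abs_sub_le (mem_Ico.1 hm).2)
    have h3 : 2 * (N : ℝ) * ∑ n ∈ Ico 1 N, |(m : ℝ) - n|⁻¹
        ≤ 2 * N * (2 * (1 + Real.log N)) := by gcongr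
    linarith
  simp only [norm_sum_mul_exp_sq]
  rw [intervalIntegral.integral_finsetSum fun m _ => by
    apply Continuous.intervalIntegrable; fun_prop]
  have hstep : ∀ m ∈ Ico 1 N,
      ∫ t in T..T', ∑ n ∈ Ico 1 N, b m * b n * Real.cos (t * Real.log m - t * Real.log n)
        ≤ ∑ n ∈ Ico 1 N, (b m ^ 2 / 2 * K m n + b n ^ 2 / 2 * K n m) := by
    intro m hm
    rw [intervalIntegral.integral_finsetSum fun n _ => by
      apply Continuous.intervalIntegrable; fun_prop]
    refine sum_le_sum fun n hn => ?_
    rw [intervalIntegral.integral_const_mul]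
    have h1 := hI m hm n hn
    have h2 : |b m * b n| ≤ b m ^ 2 / 2 + b n ^ 2 / 2 := by
      rw [abs_le]
      constructor <;> nlinarith [sq_nonneg (b m + b n), sq_nonneg (b m - b n)]
    calc _ ≤ |b m * b n * ∫ t in T..T', Real.cos (t * Real.log m - t * Real.log n)| := le_abs_self _
      _ ≤ (b m ^ 2 / 2 + b n ^ 2 / 2) * K m n := by
          rw [abs_mul]
          gcongr
      _ = _ := by rw [hKsymm n m]; ring
  refine (sum_le_sum hstep).trans ?_
  simp only [sum_add_distrib]
  rw [sum_comm (f := fun m n => b n ^ 2 / 2 * K n m), ← two_mul, mul_sum, mul_sum]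
  refine sum_le_sum fun m hm => ?_
  rw [← mul_sum]
  have := mul_le_mul_of_nonneg_left (hsum m hm) (sq_nonneg (b m))
  linarith

lemma card_divisors_mul_le (m n : ℕ) :
    #(m * n).divisors ≤ #m.divisors * #n.divisors := by
  rw [Nat.divisors_mul]
  exact card_mul_le

lemma sum_card_divisors_le (N : ℕ) :
    ∑ n ∈ Ioc 0 N, (#n.divisors : ℝ) ≤ N * (1 + Real.log N) := by
  have h := ArithmeticFunction.sum_Ioc_sigma0_eq_sum_div N
  simp only [ArithmeticFunction.sigma_zero_apply] at h
  have h2 : ∑ n ∈ Ioc 0 N, (#n.divisors : ℝ) = ∑ n ∈ Ioc 0 N, ((N / n : ℕ) : ℝ) := by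
    exact_mod_cast h
  rw [h2]
  calc ∑ n ∈ Ioc 0 N, ((N / n : ℕ) : ℝ) ≤ ∑ n ∈ Ioc 0 N, (N : ℝ) * (n : ℝ)⁻¹ :=
        sum_le_sum fun n _ => by rw [← div_eq_mul_inv]; exact Nat.cast_div_le
    _ = N * ∑ i ∈ range N, ((i : ℝ) + 1)⁻¹ := by
        rw [← mul_sum]
        congr 1
        have e : Ioc 0 N = Ico (0 + 1) (N + 1) := by ext; simp; omega
        rw [e, range_eq_Ico, ← sum_Ico_add' (fun x : ℕ => (x : ℝ)⁻¹) 0 N 1]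
        simp
    _ ≤ _ := by gcongr; exact sum_range_inv_le

/-- The coefficients of the square of a Dirichlet polynomial over `[M, 2M)` in mean square: the
number of solutions of `k l = k' l'` is at most `∑ d(k l) ≤ (∑ d(k))²`. -/
lemma sum_sq_convolution_le {M N : ℕ} {w : ℕ → ℝ} {W : ℝ} (hM : 1 ≤ M)
    (hw0 : ∀ n ∈ Ico M (2 * M), 0 ≤ w n) (hw : ∀ n ∈ Ico M (2 * M), w n ≤ W) :
    ∑ n ∈ Ico 1 N, (∑ p ∈ Ico M (2 * M) ×ˢ Ico M (2 * M) with p.1 * p.2 = n, w p.1 * w p.2) ^ 2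
      ≤ W ^ 4 * (2 * M * (1 + Real.log (2 * M))) ^ 2 := by
  set I := Ico M (2 * M) with hI
  have hW : 0 ≤ W := (hw0 M (by simp [hI]; omega)).trans (hw M (by simp [hI]; omega))
  have hb : ∀ n ∈ Ico 1 N, (∑ p ∈ I ×ˢ I with p.1 * p.2 = n, w p.1 * w p.2) ^ 2
      ≤ W ^ 4 * ∑ p ∈ I ×ˢ I with p.1 * p.2 = n, (#(p.1 * p.2).divisors : ℝ) := by
    intro n hn
    have h0 : 0 ≤ ∑ p ∈ I ×ˢ I with p.1 * p.2 = n, w p.1 * w p.2 := by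
      refine sum_nonneg fun p hp => ?_
      rw [mem_filter, mem_product] at hp
      exact mul_nonneg (hw0 _ hp.1.1) (hw0 _ hp.1.2)
    have h1 : ∑ p ∈ I ×ˢ I with p.1 * p.2 = n, w p.1 * w p.2
        ≤ #{p ∈ I ×ˢ I | p.1 * p.2 = n} * W ^ 2 := by
      rw [← nsmul_eq_mul]
      refine sum_le_card_nsmul _ _ _ fun p hp => ?_
      rw [mem_filter, mem_product] at hp
      rw [pow_two]
      exact mul_le_mul (hw _ hp.1.1) (hw _ hp.1.2) (hw0 _ hp.1.2) hW
    have h2 : #{p ∈ I ×ˢ I | p.1 * p.2 = n} ≤ #n.divisors := by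
      refine card_le_card_of_injOn Prod.fst (fun p hp => ?_) fun p hp q hq h => ?_
      · have hp := (mem_filter.1 (mem_coe.1 hp)).2
        exact mem_coe.2 (Nat.mem_divisors.2
          ⟨hp ▸ dvd_mul_right _ _, by have := (mem_Ico.1 hn).1; omega⟩)
      · have hp := (mem_filter.1 (mem_coe.1 hp)).2
        have hq := (mem_filter.1 (mem_coe.1 hq)).2
        have hp0 : 0 < p.1 := by
          rcases Nat.eq_zero_or_pos p.1 with h | h
          · rw [h, zero_mul] at hp
            have := (mem_Ico.1 hn).1
            omega
          · exact h
        refine Prod.ext h (Nat.eq_of_mul_eq_mul_left hp0 ?_)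
        rw [hp, h, hq]
    have h3 : ∑ p ∈ I ×ˢ I with p.1 * p.2 = n, (#(p.1 * p.2).divisors : ℝ)
        = #{p ∈ I ×ˢ I | p.1 * p.2 = n} * (#n.divisors : ℝ) := by
      rw [sum_congr rfl fun p hp => by rw [(mem_filter.1 hp).2], sum_const, nsmul_eq_mul]
    rw [h3]
    have h2' : (#{p ∈ I ×ˢ I | p.1 * p.2 = n} : ℝ) ≤ #n.divisors := by exact_mod_cast h2
    calc _ ≤ (#{p ∈ I ×ˢ I | p.1 * p.2 = n} * W ^ 2) ^ 2 := by gcongr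
      _ = W ^ 4 * (#{p ∈ I ×ˢ I | p.1 * p.2 = n} * (#{p ∈ I ×ˢ I | p.1 * p.2 = n} : ℝ)) := by ring
      _ ≤ _ := by gcongr
  refine (sum_le_sum hb).trans ?_
  rw [← mul_sum, sum_fiberwise_eq_sum_filter]
  gcongr
  calc ∑ p ∈ I ×ˢ I with p.1 * p.2 ∈ Ico 1 N, (#(p.1 * p.2).divisors : ℝ)
      ≤ ∑ p ∈ I ×ˢ I, (#(p.1 * p.2).divisors : ℝ) :=
        sum_le_sum_of_subset_of_nonneg (filter_subset _ _) fun _ _ _ => by positivity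
    _ ≤ ∑ p ∈ I ×ˢ I, (#p.1.divisors : ℝ) * #p.2.divisors :=
        sum_le_sum fun p _ => by exact_mod_cast card_divisors_mul_le _ _
    _ = (∑ n ∈ I, (#n.divisors : ℝ)) ^ 2 := by rw [pow_two, sum_mul_sum, sum_product]
    _ ≤ _ := by
        refine pow_le_pow_left₀ (sum_nonneg fun _ _ => by positivity) ?_ 2
        calc ∑ n ∈ I, (#n.divisors : ℝ) ≤ ∑ n ∈ Ioc 0 (2 * M), (#n.divisors : ℝ) :=
              sum_le_sum_of_subset_of_nonneg (fun x hx => by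
                rw [hI, mem_Ico] at hx
                exact mem_Ioc.2 ⟨by omega, hx.2.le⟩) fun _ _ _ => by positivity
          _ ≤ _ := by
            have := sum_card_divisors_le (2 * M)
            push_cast at this
            exact this

end MeanValue

end SubgroupCount

namespace SubgroupCount

open Finset

/-! ### The fourth moment of the zeta function near the critical line -/

noncomputable section FourthMoment

/-- The block `∑_{M ≤ n < 2M} n^{-s}` of the Dirichlet series of `ζ` at `s = 0.49 - it`. The sign of
`t` is chosen so that the summands are `n^{-0.49} e^{it log n}`. -/
def dyadicBlock (M : ℕ) (t : ℝ) : ℂ :=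
  ∑ n ∈ Ico M (2 * M), (((n : ℝ) ^ (-0.49 : ℝ) : ℝ) : ℂ)
    * Complex.exp ((t * Real.log n : ℝ) * Complex.I)

@[fun_prop]
lemma continuous_dyadicBlock (M : ℕ) : Continuous (dyadicBlock M) := by
  unfold dyadicBlock
  fun_prop

lemma weight_le {M n : ℕ} (hM : 1 ≤ M) (hn : M ≤ n) :
    (n : ℝ) ^ (-0.49 : ℝ) ≤ (M : ℝ) ^ (-0.49 : ℝ) :=
  Real.rpow_le_rpow_of_nonpos (by exact_mod_cast hM) (by exact_mod_cast hn) (by norm_num)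

lemma dyadicBlock_sq {M : ℕ} (hM : 1 ≤ M) (t : ℝ) :
    dyadicBlock M t ^ 2 = ∑ n ∈ Ico 1 (4 * M ^ 2),
      ((∑ p ∈ Ico M (2 * M) ×ˢ Ico M (2 * M) with p.1 * p.2 = n,
        (p.1 : ℝ) ^ (-0.49 : ℝ) * (p.2 : ℝ) ^ (-0.49 : ℝ) : ℝ) : ℂ)
        * Complex.exp ((t * Real.log n : ℝ) * Complex.I) := by
  rw [pow_two, dyadicBlock, sum_mul_sum, ← sum_product',
    ← sum_fiberwise_of_maps_to (t := Ico 1 (4 * M ^ 2)) (g := fun p : ℕ × ℕ => p.1 * p.2)]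
  · refine sum_congr rfl fun n hn => ?_
    rw [Complex.ofReal_sum, sum_mul]
    refine sum_congr rfl fun p hp => ?_
    rw [mem_filter, mem_product, mem_Ico, mem_Ico] at hp
    have h1 : (p.1 : ℝ) ≠ 0 := by exact_mod_cast (by omega : p.1 ≠ 0)
    have h2 : (p.2 : ℝ) ≠ 0 := by exact_mod_cast (by omega : p.2 ≠ 0)
    have e : ((t * Real.log n : ℝ) : ℂ) * Complex.I = ((t * Real.log p.1 : ℝ) : ℂ) * Complex.I
        + ((t * Real.log p.2 : ℝ) : ℂ) * Complex.I := by
      rw [← hp.2, Nat.cast_mul, Real.log_mul h1 h2]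
      push_cast
      ring
    rw [e, Complex.exp_add]
    push_cast
    ring
  · intro p hp
    rw [mem_product, mem_Ico, mem_Ico] at hp
    obtain ⟨⟨h1, h2⟩, h3, h4⟩ := hp
    rw [mem_Ico]
    constructor
    · have := Nat.mul_le_mul (hM.trans h1) (hM.trans h3)
      simpa using this
    · calc p.1 * p.2 < (2 * M) * (2 * M) := Nat.mul_lt_mul'' h2 h4
        _ = _ := by ring

lemma log_two_pow_le (m : ℕ) : Real.log ((2 : ℝ) ^ m) ≤ m := by
  rw [Real.log_pow]
  have := Real.log_two_lt_d9
  have hm : (0 : ℝ) ≤ m := m.cast_nonneg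
  nlinarith

lemma two_rpow_le {x y : ℝ} (h : x ≤ y) : (2 : ℝ) ^ x ≤ (2 : ℝ) ^ y :=
  Real.rpow_le_rpow_of_exponent_le (by norm_num) h

lemma two_pow_rpow (j : ℕ) (x : ℝ) : ((2 : ℝ) ^ j) ^ x = (2 : ℝ) ^ (j * x) := by
  rw [← Real.rpow_natCast, ← Real.rpow_mul (by norm_num)]

lemma integral_dyadicBlock_pow_four_le_of_one_le {M : ℕ} (hM : 1 ≤ M) {T T' : ℝ} (hT : T ≤ T') :
    ∫ t in T..T', ‖dyadicBlock M t‖ ^ 4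
      ≤ ((T' - T) + 4 * ((4 * M ^ 2 : ℕ) : ℝ) * (1 + Real.log ((4 * M ^ 2 : ℕ) : ℝ)))
        * (((M : ℝ) ^ (-0.49 : ℝ)) ^ 4 * (2 * (M : ℝ) * (1 + Real.log (2 * (M : ℝ)))) ^ 2) := by
  have e4 : ∀ z : ℂ, ‖z‖ ^ 4 = ‖z ^ 2‖ ^ 2 := fun z => by rw [norm_pow]; ring
  simp only [e4, dyadicBlock_sq hM]
  refine (integral_norm_dirichletPolynomial_sq_le
    (fun n : ℕ => ∑ p ∈ Ico M (2 * M) ×ˢ Ico M (2 * M) with p.1 * p.2 = n,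
        (p.1 : ℝ) ^ (-0.49 : ℝ) * (p.2 : ℝ) ^ (-0.49 : ℝ)) hT).trans ?_
  have h0 : 0 ≤ T' - T := sub_nonneg.2 hT
  have h1 : 0 ≤ Real.log ((4 * M ^ 2 : ℕ) : ℝ) := Real.log_natCast_nonneg _
  gcongr
  exact sum_sq_convolution_le hM
    (w := fun n => (n : ℝ) ^ (-0.49 : ℝ)) (fun n _ => by positivity)
    (fun n hn => weight_le hM (mem_Ico.1 hn).1)

/-- Short blocks: the mean value theorem is applied to the square of the block. -/
lemma integral_dyadicBlock_pow_four_le_of_short {j k : ℕ} (hjk : 3 * j ≤ 2 * k) :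
    ∫ t in (2 : ℝ) ^ k..(2 : ℝ) ^ (k + 1), ‖dyadicBlock (2 ^ j) t‖ ^ 4
      ≤ 784 * ((k : ℝ) + 1) ^ 3 * (2 : ℝ) ^ (1.36 * (k : ℝ)) := by
  have hM : 1 ≤ 2 ^ j := Nat.one_le_two_pow
  refine (integral_dyadicBlock_pow_four_le_of_one_le hM
    (pow_le_pow_right₀ (by norm_num) (Nat.le_succ k))).trans ?_
  have hk0 : (0 : ℝ) ≤ k := k.cast_nonneg
  have hj0 : (0 : ℝ) ≤ j := j.cast_nonneg
  have hjk' : 3 * (j : ℝ) ≤ 2 * k := by exact_mod_cast hjk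
  have hlog1 : Real.log ((4 * (2 ^ j) ^ 2 : ℕ) : ℝ) ≤ 2 * j + 2 := by
    have e : ((4 * (2 ^ j) ^ 2 : ℕ) : ℝ) = (2 : ℝ) ^ (2 * j + 2) := by push_cast; ring
    rw [e]
    exact_mod_cast log_two_pow_le (2 * j + 2)
  have hlog2 : Real.log (2 * ((2 ^ j : ℕ) : ℝ)) ≤ j + 1 := by
    have e : 2 * ((2 ^ j : ℕ) : ℝ) = (2 : ℝ) ^ (j + 1) := by push_cast; ring
    rw [e]
    exact_mod_cast log_two_pow_le (j + 1)
  have hlog0 : 0 ≤ Real.log (2 * ((2 ^ j : ℕ) : ℝ)) := Real.log_nonneg (by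
    have : (1 : ℝ) ≤ ((2 ^ j : ℕ) : ℝ) := by exact_mod_cast hM
    linarith)
  have hsq : ((2 : ℝ) ^ j) ^ 2 ≤ (2 : ℝ) ^ (4 / 3 * (k : ℝ)) := by
    rw [← Real.rpow_two, two_pow_rpow]
    exact two_rpow_le (by linarith)
  have hT : (2 : ℝ) ^ k ≤ (2 : ℝ) ^ (4 / 3 * (k : ℝ)) := by
    rw [← Real.rpow_natCast]
    exact two_rpow_le (by linarith)
  have hA : (2 : ℝ) ^ (k + 1) - 2 ^ k + 4 * ((4 * (2 ^ j) ^ 2 : ℕ) : ℝ)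
        * (1 + Real.log ((4 * (2 ^ j) ^ 2 : ℕ) : ℝ))
      ≤ 49 * (k + 1) * (2 : ℝ) ^ (4 / 3 * (k : ℝ)) := by
    have h1 : 1 + Real.log ((4 * (2 ^ j) ^ 2 : ℕ) : ℝ) ≤ 3 * (k + 1) := by linarith
    have h2 : 4 * ((4 * (2 ^ j) ^ 2 : ℕ) : ℝ) ≤ 16 * (2 : ℝ) ^ (4 / 3 * (k : ℝ)) := by
      push_cast; linarith
    have h3 : (2 : ℝ) ^ (k + 1) - 2 ^ k = 2 ^ k := by ring
    have h4 : 4 * ((4 * (2 ^ j) ^ 2 : ℕ) : ℝ) * (1 + Real.log ((4 * (2 ^ j) ^ 2 : ℕ) : ℝ))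
        ≤ 16 * (2 : ℝ) ^ (4 / 3 * (k : ℝ)) * (3 * (k + 1)) := by gcongr
    have h5 : 0 ≤ (k : ℝ) * (2 : ℝ) ^ (4 / 3 * (k : ℝ)) := by positivity
    rw [h3]
    linarith
  have hB : (((2 ^ j : ℕ) : ℝ) ^ (-0.49 : ℝ)) ^ 4
        * (2 * ((2 ^ j : ℕ) : ℝ) * (1 + Real.log (2 * ((2 ^ j : ℕ) : ℝ)))) ^ 2
      ≤ 16 * (k + 1) ^ 2 * (2 : ℝ) ^ (0.08 / 3 * (k : ℝ)) := by
    have h1 : 1 + Real.log (2 * ((2 ^ j : ℕ) : ℝ)) ≤ 2 * (k + 1) := by linarith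
    have h2 : (((2 ^ j : ℕ) : ℝ) ^ (-0.49 : ℝ)) ^ 4 * (((2 ^ j : ℕ) : ℝ)) ^ 2
        = (2 : ℝ) ^ (0.04 * (j : ℝ)) := by
      rw [Nat.cast_pow, Nat.cast_ofNat, two_pow_rpow, ← Real.rpow_natCast _ 4,
        ← Real.rpow_mul (by norm_num), ← Real.rpow_natCast (2 ^ j) 2, two_pow_rpow,
        ← Real.rpow_add (by norm_num)]
      congr 1
      push_cast
      ring
    calc _ = ((((2 ^ j : ℕ) : ℝ) ^ (-0.49 : ℝ)) ^ 4 * (((2 ^ j : ℕ) : ℝ)) ^ 2) * (4 *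
          (1 + Real.log (2 * ((2 ^ j : ℕ) : ℝ))) ^ 2) := by ring
      _ ≤ (2 : ℝ) ^ (0.08 / 3 * (k : ℝ)) * (4 * (2 * (k + 1)) ^ 2) := by
          rw [h2]
          have := two_rpow_le (x := 0.04 * j) (y := 0.08 / 3 * k) (by linarith)
          gcongr
      _ = _ := by ring
  calc _ ≤ (49 * (k + 1) * (2 : ℝ) ^ (4 / 3 * (k : ℝ)))
        * (16 * (k + 1) ^ 2 * (2 : ℝ) ^ (0.08 / 3 * (k : ℝ))) := by
        gcongr
    _ = 784 * ((k : ℝ) + 1) ^ 3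
        * ((2 : ℝ) ^ (4 / 3 * (k : ℝ)) * (2 : ℝ) ^ (0.08 / 3 * (k : ℝ))) := by ring
    _ = _ := by
        rw [← Real.rpow_add (by norm_num)]
        congr 2
        ring

lemma norm_dyadicBlock_le {M : ℕ} (hM : 1 ≤ M) {t B : ℝ}
    (h : ∀ b, M ≤ b → b ≤ 2 * M →
      ‖∑ n ∈ Ico M b, Complex.exp ((t * Real.log n : ℝ) * Complex.I)‖ ≤ B) :
    ‖dyadicBlock M t‖ ≤ (M : ℝ) ^ (-0.49 : ℝ) * B :=
  norm_sum_mul_le_of_antitone (w := fun n => (n : ℝ) ^ (-0.49 : ℝ)) (fun n _ _ => by positivity)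
    (fun n hn _ => weight_le (hM.trans hn) (Nat.le_succ n)) h (by omega)

/-- Blocks of medium length: the second derivative test bounds one square of the block, the mean
value theorem the other one. -/
lemma integral_dyadicBlock_pow_four_le_of_medium {j k : ℕ} (hjk : 2 * k < 3 * j) (hj : j ≤ k) :
    ∫ t in (2 : ℝ) ^ k..(2 : ℝ) ^ (k + 1), ‖dyadicBlock (2 ^ j) t‖ ^ 4
      ≤ 74052 * ((k : ℝ) + 1) ^ 3 * (2 : ℝ) ^ (1.36 * (k : ℝ)) := by
  have hM : 1 ≤ 2 ^ j := Nat.one_le_two_pow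
  have hk0 : (0 : ℝ) ≤ k := k.cast_nonneg
  have hj0 : (0 : ℝ) ≤ j := j.cast_nonneg
  have hjk' : 2 * (k : ℝ) < 3 * j := by exact_mod_cast hjk
  have hjr : (j : ℝ) ≤ k := by exact_mod_cast hj
  have hTT : (2 : ℝ) ^ k ≤ 2 ^ (k + 1) := pow_le_pow_right₀ (by norm_num) (Nat.le_succ k)
  have hsup : ∀ t ∈ Set.Icc ((2 : ℝ) ^ k) (2 ^ (k + 1)),
      ‖dyadicBlock (2 ^ j) t‖ ^ 2 ≤ 4356 * (2 : ℝ) ^ (k - 0.98 * j : ℝ) := by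
    intro t ht
    have ht0 : 0 < t := lt_of_lt_of_le (by positivity) ht.1
    have hroot : (2 : ℝ) ^ (k / 2 : ℝ) ≤ Real.sqrt t := by
      rw [Real.le_sqrt (by positivity) ht0.le, ← Real.rpow_natCast, ← Real.rpow_mul (by norm_num)]
      refine le_trans (le_of_eq ?_) ht.1
      rw [← Real.rpow_natCast]
      congr 1
      push_cast
      ring
    have hroot2 : Real.sqrt t ≤ 2 * (2 : ℝ) ^ (k / 2 : ℝ) := by
      rw [Real.sqrt_le_left (by positivity), mul_pow, ← Real.rpow_natCast (2 ^ (k / 2 : ℝ)),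
        ← Real.rpow_mul (by norm_num)]
      have e : (2 : ℝ) ^ ((k : ℝ) / 2 * (2 : ℕ)) = 2 ^ k := by
        rw [← Real.rpow_natCast]
        congr 1
        push_cast
        ring
      rw [e]
      have := ht.2
      rw [pow_succ] at this
      have : (0 : ℝ) < 2 ^ k := by positivity
      linarith
    have hquot : ((2 ^ j : ℕ) : ℝ) / Real.sqrt t ≤ (2 : ℝ) ^ (k / 2 : ℝ) := by
      have h1 : ((2 ^ j : ℕ) : ℝ) ≤ (2 : ℝ) ^ (k / 2 : ℝ) * (2 : ℝ) ^ (k / 2 : ℝ) := by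
        rw [← Real.rpow_add (by norm_num), add_halves, Real.rpow_natCast]
        push_cast
        exact pow_le_pow_right₀ (by norm_num) hj
      rw [div_le_iff₀ (Real.sqrt_pos.2 ht0)]
      refine h1.trans ?_
      gcongr
    have hb := norm_dyadicBlock_le hM (t := t) (B := 66 * (2 : ℝ) ^ (k / 2 : ℝ))
      fun b hb1 hb2 => by
        refine (norm_sum_exp_log_le_of_second_derivative hM le_rfl hb1 hb2 ht0 ?_).trans ?_
        · refine ht.2.trans ?_
          push_cast
          rw [mul_pow, ← pow_mul, ← pow_add]
          exact pow_le_pow_right₀ (by norm_num) (by omega)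
        · linarith
    calc ‖dyadicBlock (2 ^ j) t‖ ^ 2
        ≤ (((2 ^ j : ℕ) : ℝ) ^ (-0.49 : ℝ) * (66 * (2 : ℝ) ^ (k / 2 : ℝ))) ^ 2 := by gcongr
      _ = 4356 * ((2 : ℝ) ^ (j * (-0.49) : ℝ) * (2 : ℝ) ^ (k / 2 : ℝ)) ^ 2 := by
          rw [Nat.cast_pow, Nat.cast_ofNat, two_pow_rpow]; ring
      _ = _ := by
          rw [← Real.rpow_add (by norm_num), ← Real.rpow_natCast, ← Real.rpow_mul (by norm_num)]
          congr 2
          push_cast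
          ring
  have hms : ∫ t in (2 : ℝ) ^ k..(2 : ℝ) ^ (k + 1), ‖dyadicBlock (2 ^ j) t‖ ^ 2
      ≤ 17 * (k + 1) * 2 ^ (k : ℝ) * (2 : ℝ) ^ (0.02 * j : ℝ) := by
    set b : ℕ → ℝ := fun n => if 2 ^ j ≤ n then (n : ℝ) ^ (-0.49 : ℝ) else 0 with hb
    have hsub : Ico (2 ^ j) (2 * 2 ^ j) ⊆ Ico 1 (2 * 2 ^ j) := Ico_subset_Ico_left hM
    have hD : ∀ t, dyadicBlock (2 ^ j) t = ∑ n ∈ Ico 1 (2 * 2 ^ j),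
        (b n : ℂ) * Complex.exp ((t * Real.log n : ℝ) * Complex.I) := by
      intro t
      rw [dyadicBlock, ← sum_subset hsub fun n hn hn' => ?_]
      · exact sum_congr rfl fun n hn => by simp only [hb, if_pos (mem_Ico.1 hn).1]
      · have : ¬ 2 ^ j ≤ n := fun h => hn' (mem_Ico.2 ⟨h, (mem_Ico.1 hn).2⟩)
        simp [hb, this]
    simp only [hD]
    have hmv := integral_norm_dirichletPolynomial_sq_le b (N := 2 * 2 ^ j) hTT
    refine hmv.trans ?_
    have hsum : ∑ n ∈ Ico 1 (2 * 2 ^ j), b n ^ 2 ≤ (2 : ℝ) ^ (0.02 * j : ℝ) := by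
      rw [← sum_subset hsub fun n hn hn' => ?_]
      · calc ∑ n ∈ Ico (2 ^ j) (2 * 2 ^ j), b n ^ 2
            ≤ #(Ico (2 ^ j) (2 * 2 ^ j)) • (((2 ^ j : ℕ) : ℝ) ^ (-0.49 : ℝ)) ^ 2 := by
              refine sum_le_card_nsmul _ _ _ fun n hn => ?_
              simp only [hb, if_pos (mem_Ico.1 hn).1]
              gcongr ?_ ^ 2
              exact weight_le hM (mem_Ico.1 hn).1
          _ = _ := by
              rw [Nat.card_Ico, two_mul, Nat.add_sub_cancel, nsmul_eq_mul, Nat.cast_pow,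
                Nat.cast_ofNat, two_pow_rpow, ← Real.rpow_natCast _ 2,
                ← Real.rpow_mul (by norm_num), ← Real.rpow_natCast 2 j,
                ← Real.rpow_add (by norm_num)]
              congr 1
              push_cast
              ring
      · have : ¬ 2 ^ j ≤ n := fun h => hn' (mem_Ico.2 ⟨h, (mem_Ico.1 hn).2⟩)
        simp [hb, this]
    have hlog : Real.log ((2 * 2 ^ j : ℕ) : ℝ) ≤ j + 1 := by
      have e : ((2 * 2 ^ j : ℕ) : ℝ) = (2 : ℝ) ^ (j + 1) := by push_cast; ring
      rw [e]
      exact_mod_cast log_two_pow_le (j + 1)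
    have hpow : (2 : ℝ) ^ j ≤ 2 ^ k := pow_le_pow_right₀ (by norm_num) hj
    have hA : (2 : ℝ) ^ (k + 1) - 2 ^ k + 4 * ((2 * 2 ^ j : ℕ) : ℝ)
        * (1 + Real.log ((2 * 2 ^ j : ℕ) : ℝ)) ≤ 17 * (k + 1) * 2 ^ (k : ℝ) := by
      rw [Real.rpow_natCast]
      have h1 : 1 + Real.log ((2 * 2 ^ j : ℕ) : ℝ) ≤ 2 * (k + 1) := by linarith
      have h2 : 4 * ((2 * 2 ^ j : ℕ) : ℝ) ≤ 8 * (2 : ℝ) ^ k := by push_cast; linarith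
      have h3 : (2 : ℝ) ^ (k + 1) - 2 ^ k = 2 ^ k := by ring
      have h4 : 4 * ((2 * 2 ^ j : ℕ) : ℝ) * (1 + Real.log ((2 * 2 ^ j : ℕ) : ℝ))
          ≤ 8 * (2 : ℝ) ^ k * (2 * (k + 1)) := by gcongr
      have h5 : 0 ≤ (k : ℝ) * (2 : ℝ) ^ k := by positivity
      rw [h3]
      linarith
    have hs0 : 0 ≤ ∑ n ∈ Ico 1 (2 * 2 ^ j), b n ^ 2 := sum_nonneg fun _ _ => sq_nonneg _
    gcongr
  calc ∫ t in (2 : ℝ) ^ k..(2 : ℝ) ^ (k + 1), ‖dyadicBlock (2 ^ j) t‖ ^ 4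
      ≤ ∫ t in (2 : ℝ) ^ k..(2 : ℝ) ^ (k + 1),
          4356 * (2 : ℝ) ^ (k - 0.98 * j : ℝ) * ‖dyadicBlock (2 ^ j) t‖ ^ 2 := by
        refine intervalIntegral.integral_mono_on hTT (Continuous.intervalIntegrable (by fun_prop) _ _)
          (Continuous.intervalIntegrable (by fun_prop) _ _) fun t ht => ?_
        have e : ‖dyadicBlock (2 ^ j) t‖ ^ 4
            = ‖dyadicBlock (2 ^ j) t‖ ^ 2 * ‖dyadicBlock (2 ^ j) t‖ ^ 2 := by ring
        rw [e]
        exact mul_le_mul_of_nonneg_right (hsup t ht) (by positivity)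
    _ ≤ 4356 * (2 : ℝ) ^ (k - 0.98 * j : ℝ)
        * (17 * (k + 1) * 2 ^ (k : ℝ) * (2 : ℝ) ^ (0.02 * j : ℝ)) := by
        rw [intervalIntegral.integral_const_mul]
        gcongr
    _ = 74052 * (k + 1) * ((2 : ℝ) ^ (k - 0.98 * j : ℝ) * 2 ^ (k : ℝ)
          * (2 : ℝ) ^ (0.02 * j : ℝ)) := by ring
    _ = 74052 * (k + 1) * (2 : ℝ) ^ (2 * k - 0.96 * j : ℝ) := by
        rw [← Real.rpow_add (by norm_num), ← Real.rpow_add (by norm_num)]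
        congr 2
        ring
    _ ≤ 74052 * ((k : ℝ) + 1) ^ 3 * (2 : ℝ) ^ (1.36 * (k : ℝ)) := by
        have h1 : (2 : ℝ) ^ (2 * k - 0.96 * j : ℝ) ≤ (2 : ℝ) ^ (1.36 * (k : ℝ)) :=
          two_rpow_le (by linarith)
        have h2 : (k : ℝ) + 1 ≤ ((k : ℝ) + 1) ^ 3 := le_self_pow₀ (by linarith) (by norm_num)
        gcongr

/-- Long blocks: the first derivative test suffices. -/
lemma integral_dyadicBlock_pow_four_le_of_long {j k : ℕ} (hkj : k < j) (hj : j < 2 * k) :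
    ∫ t in (2 : ℝ) ^ k..(2 : ℝ) ^ (k + 1), ‖dyadicBlock (2 ^ j) t‖ ^ 4
      ≤ 28561 * ((k : ℝ) + 1) ^ 3 * (2 : ℝ) ^ (1.36 * (k : ℝ)) := by
  have hM : 1 ≤ 2 ^ j := Nat.one_le_two_pow
  have hk0 : (0 : ℝ) ≤ k := k.cast_nonneg
  have hjr : (j : ℝ) ≤ 2 * k := by exact_mod_cast hj.le
  have hTT : (2 : ℝ) ^ k ≤ 2 ^ (k + 1) := pow_le_pow_right₀ (by norm_num) (Nat.le_succ k)
  have hsup : ∀ t ∈ Set.Icc ((2 : ℝ) ^ k) (2 ^ (k + 1)),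
      ‖dyadicBlock (2 ^ j) t‖ ≤ 13 * (2 : ℝ) ^ (0.02 * k : ℝ) := by
    intro t ht
    have hT0 : (0 : ℝ) < 2 ^ k := by positivity
    have ht0 : 0 < t := lt_of_lt_of_le hT0 ht.1
    have hb := norm_dyadicBlock_le hM (t := t) (B := 13 * ((2 ^ j : ℕ) : ℝ) / 2 ^ k)
      fun b hb1 hb2 => by
        refine (norm_sum_exp_log_le_of_first_derivative hM le_rfl hb2 ht0 ?_).trans ?_
        · refine ht.2.trans ?_
          push_cast
          have : (2 : ℝ) ^ (k + 1) ≤ 2 ^ j := pow_le_pow_right₀ (by norm_num) hkj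
          have : (0 : ℝ) < 2 ^ j := by positivity
          linarith
        · have := ht.1
          gcongr
    refine hb.trans ?_
    have e : ((2 ^ j : ℕ) : ℝ) ^ (-0.49 : ℝ) * (13 * ((2 ^ j : ℕ) : ℝ) / 2 ^ k)
        = 13 * (2 : ℝ) ^ (0.51 * j - k : ℝ) := by
      have e2 : (0.51 * j - k : ℝ) = j * (-0.49) + j + -k := by ring
      rw [Nat.cast_pow, Nat.cast_ofNat, two_pow_rpow, e2, Real.rpow_add (by norm_num),
        Real.rpow_add (by norm_num), Real.rpow_neg (by norm_num), Real.rpow_natCast,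
        Real.rpow_natCast]
      ring
    rw [e]
    gcongr
    · norm_num
    · linarith
  calc ∫ t in (2 : ℝ) ^ k..(2 : ℝ) ^ (k + 1), ‖dyadicBlock (2 ^ j) t‖ ^ 4
      ≤ ∫ t in (2 : ℝ) ^ k..(2 : ℝ) ^ (k + 1), (13 * (2 : ℝ) ^ (0.02 * k : ℝ)) ^ 4 := by
        refine intervalIntegral.integral_mono_on hTT (Continuous.intervalIntegrable (by fun_prop) _ _)
          (Continuous.intervalIntegrable (by fun_prop) _ _) fun t ht => ?_
        exact pow_le_pow_left₀ (norm_nonneg _) (hsup t ht) 4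
    _ = 28561 * (2 : ℝ) ^ (1.08 * k : ℝ) := by
        rw [intervalIntegral.integral_const, smul_eq_mul, mul_pow,
          ← Real.rpow_natCast (2 ^ (0.02 * k : ℝ)) 4, ← Real.rpow_mul (by norm_num)]
        have e : (1.08 * k : ℝ) = k + 0.02 * k * (4 : ℕ) := by push_cast; ring
        rw [e, Real.rpow_add (by norm_num), Real.rpow_natCast 2 k]
        ring
    _ ≤ 28561 * 1 * (2 : ℝ) ^ (1.36 * k : ℝ) := by
        rw [mul_one]
        have := two_rpow_le (x := 1.08 * k) (y := 1.36 * k) (by linarith)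
        gcongr
    _ ≤ _ := by
        have : (1 : ℝ) ≤ ((k : ℝ) + 1) ^ 3 := one_le_pow₀ (by linarith)
        gcongr

lemma integral_dyadicBlock_pow_four_le {j k : ℕ} (hj : j < 2 * k) :
    ∫ t in (2 : ℝ) ^ k..(2 : ℝ) ^ (k + 1), ‖dyadicBlock (2 ^ j) t‖ ^ 4
      ≤ 74052 * ((k : ℝ) + 1) ^ 3 * (2 : ℝ) ^ (1.36 * (k : ℝ)) := by
  rcases le_or_gt (3 * j) (2 * k) with h1 | h1
  · refine (integral_dyadicBlock_pow_four_le_of_short h1).trans ?_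
    gcongr
    norm_num
  · rcases le_or_gt j k with h2 | h2
    · exact integral_dyadicBlock_pow_four_le_of_medium h1 h2
    · refine (integral_dyadicBlock_pow_four_le_of_long h2 hj).trans ?_
      gcongr
      norm_num

lemma sum_Ico_one_two_pow {E : Type*} [AddCommMonoid E] (f : ℕ → E) (J : ℕ) :
    ∑ n ∈ Ico 1 (2 ^ J), f n = ∑ j ∈ range J, ∑ n ∈ Ico (2 ^ j) (2 * 2 ^ j), f n := by
  induction J with
  | zero => simp
  | succ J ih =>
    rw [sum_range_succ, ← ih, pow_succ, mul_comm (2 ^ J) 2]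
    exact (sum_Ico_consecutive f Nat.one_le_two_pow (by omega)).symm

lemma natCast_cpow_eq_weight_mul_exp {n : ℕ} (hn : n ≠ 0) (t : ℝ) :
    (n : ℂ) ^ (-((0.49 : ℝ) - t * Complex.I : ℂ))
      = (((n : ℝ) ^ (-0.49 : ℝ) : ℝ) : ℂ) * Complex.exp ((t * Real.log n : ℝ) * Complex.I) := by
  have hn0 : (n : ℂ) ≠ 0 := by exact_mod_cast hn
  have e : -((0.49 : ℝ) - t * Complex.I : ℂ) = ((-0.49 : ℝ) : ℂ) + t * Complex.I := by
    push_cast; ring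
  rw [e, Complex.cpow_add _ _ hn0, Complex.ofReal_cpow n.cast_nonneg, Complex.ofReal_natCast,
    Complex.cpow_def_of_ne_zero hn0 (t * Complex.I), ← Complex.natCast_log]
  congr 2
  push_cast
  ring

/-- For `2 ^ k ≤ t ≤ 2 ^ (k + 1)`, Euler–Maclaurin summation up to `2 ^ (2 * k)`, about `t ^ 2`,
leaves a remainder of size only `t ^ 0.02`. -/
lemma norm_riemannZeta_le_sum_dyadicBlock {k : ℕ} {t : ℝ} (ht : (2 : ℝ) ^ k ≤ t)
    (ht' : t ≤ 2 ^ (k + 1)) :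
    ‖riemannZeta ((0.49 : ℝ) - t * Complex.I)‖
      ≤ ∑ j ∈ range (2 * k), ‖dyadicBlock (2 ^ j) t‖ + 9 * (2 : ℝ) ^ (0.02 * k : ℝ) := by
  set s : ℂ := (0.49 : ℝ) - t * Complex.I with hs
  have hT1 : (1 : ℝ) ≤ 2 ^ k := one_le_pow₀ (by norm_num)
  have ht0 : 0 < t := by linarith
  have hre : s.re = 0.49 := by simp [hs]
  have him : s.im = -t := by simp [hs]
  have hs1 : s ≠ 1 := by
    intro h
    rw [h] at hre
    norm_num at hre
  have hN : 1 ≤ 2 ^ (2 * k) := Nat.one_le_two_pow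
  have h := norm_riemannZeta₁_sub_le hN (s := s) (by rw [hre]; norm_num)
  have hnorm : (2 : ℝ) ^ k ≤ ‖s - 1‖ := by
    have h1 := Complex.abs_im_le_norm (s - 1)
    rw [Complex.sub_im, him, Complex.one_im, sub_zero, abs_neg, abs_of_pos ht0] at h1
    exact ht.trans h1
  have hpos : 0 < ‖s - 1‖ := by linarith
  have hsn : ‖s‖ ≤ 3 * (2 : ℝ) ^ k := by
    have h1 := Complex.norm_le_abs_re_add_abs_im s
    rw [hre, him, abs_neg, abs_of_pos ht0, abs_of_pos (by norm_num)] at h1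
    rw [pow_succ] at ht'
    linarith
  have hNr : ((2 ^ (2 * k) : ℕ) : ℝ) = (2 : ℝ) ^ (2 * k) := by push_cast; rfl
  have hNpos : (0 : ℝ) < (2 : ℝ) ^ (2 * k) := by positivity
  -- the Dirichlet polynomial splits into the blocks and the term of index `4 ^ k`
  have hsplit : ∑ n ∈ range (2 ^ (2 * k)), ((n + 1 : ℕ) : ℂ) ^ (-s)
      = ∑ j ∈ range (2 * k), dyadicBlock (2 ^ j) t + ((2 ^ (2 * k) : ℕ) : ℂ) ^ (-s) := by
    rw [range_eq_Ico, sum_Ico_add' (fun n : ℕ => (n : ℂ) ^ (-s)) 0 (2 ^ (2 * k)) 1, zero_add,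
      sum_Ico_succ_top hN, sum_Ico_one_two_pow]
    congr 1
    refine sum_congr rfl fun j _ => ?_
    rw [dyadicBlock]
    refine sum_congr rfl fun n hn => natCast_cpow_eq_weight_mul_exp ?_ t
    have := Nat.one_le_two_pow.trans (mem_Ico.1 hn).1
    omega
  have hlast : ‖((2 ^ (2 * k) : ℕ) : ℂ) ^ (-s)‖ ≤ 1 := by
    rw [← Complex.ofReal_natCast, Complex.norm_cpow_eq_rpow_re_of_pos (by positivity),
      Complex.neg_re, hre]
    exact Real.rpow_le_one_of_one_le_of_nonpos (by exact_mod_cast hN) (by norm_num)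
  have hpole : ‖((2 ^ (2 * k) : ℕ) : ℂ) ^ (1 - s)‖
      ≤ ‖s - 1‖ * (2 : ℝ) ^ (0.02 * k : ℝ) := by
    rw [← Complex.ofReal_natCast, Complex.norm_cpow_eq_rpow_re_of_pos (by positivity),
      Complex.sub_re, hre, Complex.one_re, hNr, two_pow_rpow]
    calc (2 : ℝ) ^ (((2 * k : ℕ) : ℝ) * (1 - 0.49)) = 2 ^ k * (2 : ℝ) ^ (0.02 * k : ℝ) := by
          rw [← Real.rpow_natCast 2 k, ← Real.rpow_add (by norm_num)]
          congr 1
          push_cast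
          ring
      _ ≤ _ := by gcongr
  have herr : ‖s - 1‖ * ‖s‖ / s.re * ((2 ^ (2 * k) : ℕ) : ℝ) ^ (-s.re)
      ≤ ‖s - 1‖ * (7 * (2 : ℝ) ^ (0.02 * k : ℝ)) := by
    rw [hre, hNr, two_pow_rpow, mul_div_assoc, mul_assoc]
    refine mul_le_mul_of_nonneg_left ?_ hpos.le
    calc ‖s‖ / 0.49 * (2 : ℝ) ^ (((2 * k : ℕ) : ℝ) * -0.49)
        ≤ 7 * (2 : ℝ) ^ k * (2 : ℝ) ^ (((2 * k : ℕ) : ℝ) * -0.49) := by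
          gcongr
          rw [div_le_iff₀ (by norm_num)]
          linarith
      _ = _ := by
          rw [mul_assoc, ← Real.rpow_natCast 2 k, ← Real.rpow_add (by norm_num)]
          congr 2
          push_cast
          ring
  have hone : (1 : ℝ) ≤ (2 : ℝ) ^ (0.02 * k : ℝ) := Real.one_le_rpow (by norm_num) (by positivity)
  rw [riemannZeta₁_eq_mul hs1, hsplit] at h
  have hmain : ‖s - 1‖ * ‖riemannZeta s‖ ≤ ‖s - 1‖ *
      (∑ j ∈ range (2 * k), ‖dyadicBlock (2 ^ j) t‖ + 9 * (2 : ℝ) ^ (0.02 * k : ℝ)) := by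
    rw [← norm_mul]
    have e : (s - 1) * riemannZeta s = ((s - 1) * riemannZeta s - (s - 1) *
        (∑ j ∈ range (2 * k), dyadicBlock (2 ^ j) t + ((2 ^ (2 * k) : ℕ) : ℂ) ^ (-s))
          - ((2 ^ (2 * k) : ℕ) : ℂ) ^ (1 - s)) + (s - 1) *
        (∑ j ∈ range (2 * k), dyadicBlock (2 ^ j) t + ((2 ^ (2 * k) : ℕ) : ℂ) ^ (-s))
          + ((2 ^ (2 * k) : ℕ) : ℂ) ^ (1 - s) := by ring
    have hS : ‖(s - 1) * (∑ j ∈ range (2 * k), dyadicBlock (2 ^ j) t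
          + ((2 ^ (2 * k) : ℕ) : ℂ) ^ (-s))‖
        ≤ ‖s - 1‖ * (∑ j ∈ range (2 * k), ‖dyadicBlock (2 ^ j) t‖
          + (2 : ℝ) ^ (0.02 * k : ℝ)) := by
      rw [norm_mul]
      gcongr
      exact (norm_add_le _ _).trans (add_le_add (norm_sum_le _ _) (hlast.trans hone))
    rw [e]
    refine norm_add₃_le.trans ?_
    have := h.trans herr
    linarith
  exact le_of_mul_le_mul_left hmain hpos

lemma continuous_riemannZeta_vertical {σ : ℝ} (hσ : σ ≠ 1) :
    Continuous fun t : ℝ => riemannZeta (σ - t * Complex.I) := by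
  rw [continuous_iff_continuousAt]
  intro t
  have h1 : (σ : ℂ) - t * Complex.I ≠ 1 := by
    intro h
    have := congrArg Complex.re h
    simp at this
    exact hσ this
  exact ContinuousAt.comp (f := fun t : ℝ => (σ : ℂ) - t * Complex.I)
    (differentiableAt_riemannZeta h1).continuousAt (by fun_prop)

/-- The fourth moment of `ζ` over a dyadic interval of the line `Re s = 0.49`; the true order
of magnitude is `2^{1.04 k}` up to powers of `k`. -/
lemma integral_norm_riemannZeta_pow_four_le :
    ∃ C : ℝ, 0 ≤ C ∧ ∀ k : ℕ,
      ∫ t in (2 : ℝ) ^ k..(2 : ℝ) ^ (k + 1), ‖riemannZeta ((0.49 : ℝ) - t * Complex.I)‖ ^ 4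
        ≤ C * ((k : ℝ) + 1) ^ 7 * (2 : ℝ) ^ (1.36 * (k : ℝ)) := by
  refine ⟨8 * (16 * 74052 + 6561), by norm_num, fun k => ?_⟩
  have hTT : (2 : ℝ) ^ k ≤ 2 ^ (k + 1) := pow_le_pow_right₀ (by norm_num) (Nat.le_succ k)
  have hcont := continuous_riemannZeta_vertical (σ := 0.49) (by norm_num)
  have hk0 : (0 : ℝ) ≤ k := k.cast_nonneg
  have hpt : ∀ t ∈ Set.Icc ((2 : ℝ) ^ k) (2 ^ (k + 1)),
      ‖riemannZeta ((0.49 : ℝ) - t * Complex.I)‖ ^ 4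
        ≤ 8 * (((2 * k : ℕ) : ℝ) ^ 3 * ∑ j ∈ range (2 * k), ‖dyadicBlock (2 ^ j) t‖ ^ 4
          + 6561 * (2 : ℝ) ^ (0.08 * k : ℝ)) := by
    intro t ht
    have h1 := norm_riemannZeta_le_sum_dyadicBlock ht.1 ht.2
    have hS0 : 0 ≤ ∑ j ∈ range (2 * k), ‖dyadicBlock (2 ^ j) t‖ :=
      sum_nonneg fun _ _ => norm_nonneg _
    have h2 := add_pow_le hS0 (by positivity : 0 ≤ 9 * (2 : ℝ) ^ (0.02 * k : ℝ)) 4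
    have h3 : (∑ j ∈ range (2 * k), ‖dyadicBlock (2 ^ j) t‖) ^ 4
        ≤ ((2 * k : ℕ) : ℝ) ^ 3 * ∑ j ∈ range (2 * k), ‖dyadicBlock (2 ^ j) t‖ ^ 4 := by
      have := pow_sum_le_card_mul_sum_pow (s := range (2 * k))
        (f := fun j => ‖dyadicBlock (2 ^ j) t‖) (fun _ _ => norm_nonneg _) 3
      simpa using this
    have h4 : (9 * (2 : ℝ) ^ (0.02 * k : ℝ)) ^ 4 = 6561 * (2 : ℝ) ^ (0.08 * k : ℝ) := by
      rw [mul_pow, ← Real.rpow_natCast (2 ^ (0.02 * k : ℝ)), ← Real.rpow_mul (by norm_num)]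
      norm_num
      ring_nf
    rw [h4] at h2
    calc _ ≤ (∑ j ∈ range (2 * k), ‖dyadicBlock (2 ^ j) t‖ + 9 * (2 : ℝ) ^ (0.02 * k : ℝ)) ^ 4 := by
          gcongr
      _ ≤ _ := by
          refine h2.trans ?_
          norm_num
          push_cast at h3
          linarith
  have hE : ∫ t in (2 : ℝ) ^ k..(2 : ℝ) ^ (k + 1),
      8 * (((2 * k : ℕ) : ℝ) ^ 3 * ∑ j ∈ range (2 * k), ‖dyadicBlock (2 ^ j) t‖ ^ 4
          + 6561 * (2 : ℝ) ^ (0.08 * k : ℝ))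
      = 8 * (((2 * k : ℕ) : ℝ) ^ 3 * ∑ j ∈ range (2 * k),
          (∫ t in (2 : ℝ) ^ k..(2 : ℝ) ^ (k + 1), ‖dyadicBlock (2 ^ j) t‖ ^ 4)
          + 2 ^ k * (6561 * (2 : ℝ) ^ (0.08 * k : ℝ))) := by
    rw [intervalIntegral.integral_const_mul, intervalIntegral.integral_add
      (Continuous.intervalIntegrable (by fun_prop) _ _)
      (Continuous.intervalIntegrable (by fun_prop) _ _), intervalIntegral.integral_const_mul,
      intervalIntegral.integral_finsetSum fun j _ =>
        (Continuous.intervalIntegrable (by fun_prop) _ _), intervalIntegral.integral_const,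
      smul_eq_mul]
    congr 4
    ring
  calc _ ≤ ∫ t in (2 : ℝ) ^ k..(2 : ℝ) ^ (k + 1),
        8 * (((2 * k : ℕ) : ℝ) ^ 3 * ∑ j ∈ range (2 * k), ‖dyadicBlock (2 ^ j) t‖ ^ 4
          + 6561 * (2 : ℝ) ^ (0.08 * k : ℝ)) :=
        intervalIntegral.integral_mono_on hTT
          (Continuous.intervalIntegrable (hcont.norm.pow 4) _ _)
          (Continuous.intervalIntegrable (by fun_prop) _ _) hpt
    _ ≤ 8 * (((2 * k : ℕ) : ℝ) ^ 3 * (((2 * k : ℕ) : ℝ)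
          * (74052 * ((k : ℝ) + 1) ^ 3 * (2 : ℝ) ^ (1.36 * (k : ℝ))))
          + 6561 * (2 : ℝ) ^ (1.36 * k : ℝ)) := by
        rw [hE]
        have h1 : ∑ j ∈ range (2 * k),
            (∫ t in (2 : ℝ) ^ k..(2 : ℝ) ^ (k + 1), ‖dyadicBlock (2 ^ j) t‖ ^ 4)
            ≤ ((2 * k : ℕ) : ℝ) * (74052 * ((k : ℝ) + 1) ^ 3 * (2 : ℝ) ^ (1.36 * (k : ℝ))) := by
          have := sum_le_card_nsmul (range (2 * k)) _ _ fun j hj =>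
            integral_dyadicBlock_pow_four_le (mem_range.1 hj)
          rwa [card_range, nsmul_eq_mul] at this
        have h2 : (2 : ℝ) ^ k * (6561 * (2 : ℝ) ^ (0.08 * k : ℝ))
            ≤ 6561 * (2 : ℝ) ^ (1.36 * k : ℝ) := by
          have e : (2 : ℝ) ^ k * (6561 * (2 : ℝ) ^ (0.08 * k : ℝ))
              = 6561 * (2 : ℝ) ^ (k + 0.08 * k : ℝ) := by
            rw [Real.rpow_add (by norm_num), Real.rpow_natCast]
            ring
          rw [e]
          have := two_rpow_le (x := k + 0.08 * k) (y := 1.36 * k) (by linarith)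
          gcongr
        gcongr
    _ ≤ _ := by
        have h1 : (k : ℝ) ^ 4 * ((k : ℝ) + 1) ^ 3 ≤ ((k : ℝ) + 1) ^ 7 := by
          calc _ ≤ ((k : ℝ) + 1) ^ 4 * ((k : ℝ) + 1) ^ 3 := by gcongr; linarith
            _ = _ := by ring
        have h2 : (1 : ℝ) ≤ ((k : ℝ) + 1) ^ 7 := one_le_pow₀ (by linarith)
        have h3 : (0 : ℝ) < (2 : ℝ) ^ (1.36 * (k : ℝ)) := by positivity
        have e : 8 * (((2 * k : ℕ) : ℝ) ^ 3 * (((2 * k : ℕ) : ℝ)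
          * (74052 * ((k : ℝ) + 1) ^ 3 * (2 : ℝ) ^ (1.36 * (k : ℝ))))
          + 6561 * (2 : ℝ) ^ (1.36 * k : ℝ)) = 8 * (16 * 74052 * ((k : ℝ) ^ 4 * ((k : ℝ) + 1) ^ 3)
            + 6561 * 1) * (2 : ℝ) ^ (1.36 * (k : ℝ)) := by push_cast; ring
        rw [e]
        calc _ ≤ 8 * (16 * 74052 * ((k : ℝ) + 1) ^ 7
            + 6561 * ((k : ℝ) + 1) ^ 7) * (2 : ℝ) ^ (1.36 * (k : ℝ)) := by gcongr
          _ = _ := by ring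

end FourthMoment

end SubgroupCount

namespace SubgroupCount

open Finset MeasureTheory Filter Topology

/-! ### The kernel of the contour integral -/

noncomputable section ZetaKernel

/-- The Mellin transform of the main arithmetic function: `ζ(z)⁴ ζ(2z - 1)` is the Dirichlet series
of `baseCoeff`, and `1 / z²` is the transform of the logarithmic weight. -/
def zetaKernel (z : ℂ) : ℂ := riemannZeta z ^ 4 * riemannZeta (2 * z - 1) / z ^ 2

/-- The kernel with its pole of order five at `1` removed, `(z - 1)⁵ * zetaKernel z`. -/
def zetaKernelNum (z : ℂ) : ℂ := riemannZeta₁ z ^ 4 * riemannZeta₁ (2 * z - 1) / (2 * z ^ 2)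

lemma zetaKernel_eq_div {z : ℂ} (hz : z ≠ 1) : zetaKernel z = zetaKernelNum z / (z - 1) ^ 5 := by
  have h1 : z - 1 ≠ 0 := sub_ne_zero.2 hz
  have h2 : 2 * z - 1 ≠ 1 := by
    intro h
    apply hz
    linear_combination h / 2
  have e : (2 * z - 1 - 1 : ℂ) = 2 * (z - 1) := by ring
  rw [zetaKernel, zetaKernelNum, riemannZeta_eq_inv_sub_mul hz, riemannZeta_eq_inv_sub_mul h2, e]
  rcases eq_or_ne z 0 with rfl | h0
  · simp
  · field_simp

lemma differentiableAt_zetaKernelNum {z : ℂ} (hz : z ≠ 0) :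
    DifferentiableAt ℂ zetaKernelNum z := by
  unfold zetaKernelNum
  have h := differentiable_riemannZeta₁
  have h2 : DifferentiableAt ℂ (fun z : ℂ => riemannZeta₁ (2 * z - 1)) z :=
    (h _).comp z (by fun_prop)
  refine DifferentiableAt.div (((h z).pow 4).mul h2) (by fun_prop) ?_
  simpa using hz

lemma zetaKernel_conj (z : ℂ) :
    zetaKernel ((starRingEnd ℂ) z) = (starRingEnd ℂ) (zetaKernel z) := by
  have e : 2 * (starRingEnd ℂ) z - 1 = (starRingEnd ℂ) (2 * z - 1) := by
    rw [map_sub, map_mul, map_one, map_ofNat]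
  rw [zetaKernel, zetaKernel, e, riemannZeta_conj, riemannZeta_conj]
  simp

lemma continuous_zetaKernel_vertical {σ : ℝ} (h0 : σ ≠ 0) (h1 : σ ≠ 1) :
    Continuous fun t : ℝ => zetaKernel (σ + t * Complex.I) := by
  have hz1 : ∀ t : ℝ, (σ : ℂ) + t * Complex.I ≠ 1 := fun t h => h1 (by
    have := congrArg Complex.re h
    simpa using this)
  have hz0 : ∀ t : ℝ, (σ : ℂ) + t * Complex.I ≠ 0 := fun t h => h0 (by
    have := congrArg Complex.re h
    simpa using this)
  simp only [fun t => zetaKernel_eq_div (hz1 t)]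
  refine Continuous.div ?_ (by fun_prop) fun t => pow_ne_zero 5 (sub_ne_zero.2 (hz1 t))
  rw [continuous_iff_continuousAt]
  intro t
  exact ContinuousAt.comp (f := fun t : ℝ => (σ : ℂ) + t * Complex.I)
    (differentiableAt_zetaKernelNum (hz0 t)).continuousAt (by fun_prop)

/-- On the left edge of the contour the kernel is a fourth power of `ζ` times an explicit power. -/
lemma norm_zetaKernel_le_on_left_edge :
    ∃ C : ℝ, 0 ≤ C ∧ ∀ t : ℝ, 1 ≤ t →
      ‖zetaKernel ((0.49 : ℝ) + t * Complex.I)‖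
        ≤ C * (‖riemannZeta ((0.49 : ℝ) - t * Complex.I)‖ ^ 4 * t ^ (-1.47 : ℝ)) := by
  obtain ⟨C, hC, h⟩ := norm_riemannZeta₁_le_of_neg_two_hundredths_le
  refine ⟨C * 3 ^ (1.53 : ℝ), by positivity, fun t ht => ?_⟩
  have ht0 : 0 < t := by linarith
  set z : ℂ := (0.49 : ℝ) + t * Complex.I with hz
  have hconj : ((0.49 : ℝ) - t * Complex.I : ℂ) = (starRingEnd ℂ) z := by
    rw [hz, map_add, map_mul, Complex.conj_ofReal, Complex.conj_ofReal, Complex.conj_I]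
    ring
  rw [hconj, riemannZeta_conj, Complex.norm_conj]
  have hzre : z.re = 0.49 := by simp [hz]
  have hzim : z.im = t := by simp [hz]
  have hwre : (2 * z - 1).re = -0.02 := by simp [hz]; norm_num
  have hwim : (2 * z - 1).im = 2 * t := by simp [hz]
  have hw1 : 2 * z - 1 ≠ 1 := by
    intro hh
    rw [hh] at hwre
    norm_num at hwre
  have hw := h (2 * z - 1) hwre.ge (by rw [hwre]; norm_num)
  rw [riemannZeta₁_eq_mul hw1, norm_mul, hwim, abs_of_pos (by linarith)] at hw
  have hn : t ≤ ‖2 * z - 1 - 1‖ := by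
    have := Complex.abs_im_le_norm (2 * z - 1 - 1)
    rw [Complex.sub_im, hwim, Complex.one_im, sub_zero, abs_of_pos (by linarith)] at this
    linarith
  have hzn : t ≤ ‖z‖ := by
    have := Complex.abs_im_le_norm z
    rwa [hzim, abs_of_pos ht0] at this
  have h1 : ‖riemannZeta (2 * z - 1)‖ ≤ C * 3 ^ (1.53 : ℝ) * t ^ (0.53 : ℝ) := by
    have h2 : t * ‖riemannZeta (2 * z - 1)‖ ≤ t * (C * 3 ^ (1.53 : ℝ) * t ^ (0.53 : ℝ)) := by
      calc _ ≤ ‖2 * z - 1 - 1‖ * ‖riemannZeta (2 * z - 1)‖ := by gcongr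
        _ ≤ _ := hw
        _ ≤ C * (3 * t) ^ (1.53 : ℝ) := by gcongr; linarith
        _ = _ := by
            have e : (1.53 : ℝ) = 1 + 0.53 := by norm_num
            rw [Real.mul_rpow (by norm_num) ht0.le]
            nth_rw 2 [e]
            rw [Real.rpow_add ht0, Real.rpow_one]
            ring
    exact le_of_mul_le_mul_left h2 ht0
  have hz0 : 0 < ‖z‖ := by linarith
  rw [zetaKernel, norm_div, norm_mul, norm_pow, norm_pow, div_le_iff₀ (by positivity)]
  have hpow : t ^ (-1.47 : ℝ) * t ^ 2 = t ^ (0.53 : ℝ) := by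
    rw [← Real.rpow_natCast t 2, ← Real.rpow_add ht0]
    norm_num
  calc ‖riemannZeta z‖ ^ 4 * ‖riemannZeta (2 * z - 1)‖
      ≤ ‖riemannZeta z‖ ^ 4 * (C * 3 ^ (1.53 : ℝ) * t ^ (0.53 : ℝ)) := by gcongr
    _ = C * 3 ^ (1.53 : ℝ) * (‖riemannZeta z‖ ^ 4 * t ^ (-1.47 : ℝ)) * t ^ 2 := by
        rw [← hpow]; ring
    _ ≤ _ := by gcongr

/-- Integrals over dyadic intervals that are summable give integrability on a half-line. -/
lemma integrableOn_Ioi_one_of_dyadic {f : ℝ → ℂ} (hf : Continuous f) {B : ℕ → ℝ}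
    (hB0 : ∀ k, 0 ≤ B k) (hB : Summable B)
    (h : ∀ k : ℕ, ∫ t in (2 : ℝ) ^ k..(2 : ℝ) ^ (k + 1), ‖f t‖ ≤ B k) :
    IntegrableOn f (Set.Ioi 1) := by
  refine integrableOn_Ioi_of_intervalIntegral_norm_bounded (b := fun n : ℕ => (2 : ℝ) ^ n)
    (l := atTop) (∑' k, B k) 1 (fun n => hf.integrableOn_Ioc)
    (tendsto_pow_atTop_atTop_of_one_lt (by norm_num)) (Eventually.of_forall fun n => ?_)
  have e : ∫ x in (1 : ℝ)..(2 : ℝ) ^ n, ‖f x‖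
      = ∑ k ∈ range n, ∫ x in (2 : ℝ) ^ k..(2 : ℝ) ^ (k + 1), ‖f x‖ := by
    rw [intervalIntegral.sum_integral_adjacent_intervals fun k _ =>
      hf.norm.intervalIntegrable _ _, pow_zero]
  rw [e]
  exact (sum_le_sum fun k _ => h k).trans (hB.sum_le_tsum _ fun k _ => hB0 k)

lemma summable_pow_mul_two_rpow :
    Summable fun k : ℕ => ((k : ℝ) + 1) ^ 7 * (2 : ℝ) ^ (-0.11 * (k : ℝ)) := by
  obtain ⟨r, hr⟩ : ∃ r : ℝ, r = (2 : ℝ) ^ (-0.11 : ℝ) := ⟨_, rfl⟩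
  have hr0 : 0 < r := by rw [hr]; positivity
  have hr1 : ‖r‖ < 1 := by
    rw [Real.norm_of_nonneg hr0.le, hr]
    exact Real.rpow_lt_one_of_one_lt_of_neg (by norm_num) (by norm_num)
  have h : Summable fun k : ℕ => ((k + 1 : ℕ) : ℝ) ^ 7 * r ^ (k + 1) :=
    (summable_nat_add_iff (f := fun k : ℕ => (k : ℝ) ^ 7 * r ^ k) 1).2
      (summable_pow_mul_geometric_of_norm_lt_one 7 hr1)
  refine (h.mul_left r⁻¹).congr fun k => ?_
  have e : (2 : ℝ) ^ (-0.11 * (k : ℝ)) = r ^ k := by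
    rw [hr, ← Real.rpow_natCast, ← Real.rpow_mul (by norm_num)]
  rw [e]
  push_cast
  field_simp
  ring

lemma integrable_zetaKernel_left_edge :
    Integrable fun t : ℝ => zetaKernel ((0.49 : ℝ) + t * Complex.I) := by
  obtain ⟨C, hC, h⟩ := norm_zetaKernel_le_on_left_edge
  obtain ⟨D, hD, hmom⟩ := integral_norm_riemannZeta_pow_four_le
  have hcont := continuous_zetaKernel_vertical (σ := 0.49) (by norm_num) (by norm_num)
  have hζ := continuous_riemannZeta_vertical (σ := 0.49) (by norm_num)
  set f : ℝ → ℂ := fun t => zetaKernel ((0.49 : ℝ) + t * Complex.I) with hf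
  have hone : IntegrableOn f (Set.Ioi 1) := by
    refine integrableOn_Ioi_one_of_dyadic hcont
      (B := fun k => C * D * (((k : ℝ) + 1) ^ 7 * (2 : ℝ) ^ (-0.11 * (k : ℝ))))
      (fun k => by positivity) (summable_pow_mul_two_rpow.mul_left _) fun k => ?_
    have hTT : (2 : ℝ) ^ k ≤ 2 ^ (k + 1) := pow_le_pow_right₀ (by norm_num) (Nat.le_succ k)
    have hT1 : (1 : ℝ) ≤ 2 ^ k := one_le_pow₀ (by norm_num)
    calc ∫ t in (2 : ℝ) ^ k..(2 : ℝ) ^ (k + 1), ‖f t‖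
        ≤ ∫ t in (2 : ℝ) ^ k..(2 : ℝ) ^ (k + 1), C * (2 : ℝ) ^ (-1.47 * k : ℝ)
            * ‖riemannZeta ((0.49 : ℝ) - t * Complex.I)‖ ^ 4 := by
          refine intervalIntegral.integral_mono_on hTT (hcont.norm.intervalIntegrable _ _)
            (Continuous.intervalIntegrable (by fun_prop) _ _) fun t ht => ?_
          refine (h t (hT1.trans ht.1)).trans ?_
          have h1 : t ^ (-1.47 : ℝ) ≤ (2 : ℝ) ^ (-1.47 * k : ℝ) := by
            have := Real.rpow_le_rpow_of_nonpos (by positivity) ht.1 (by norm_num : (-1.47 : ℝ) ≤ 0)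
            rwa [two_pow_rpow, mul_comm] at this
          calc _ ≤ C * (‖riemannZeta ((0.49 : ℝ) - t * Complex.I)‖ ^ 4
                * (2 : ℝ) ^ (-1.47 * k : ℝ)) := by gcongr
            _ = _ := by ring
      _ ≤ C * (2 : ℝ) ^ (-1.47 * k : ℝ)
            * (D * ((k : ℝ) + 1) ^ 7 * (2 : ℝ) ^ (1.36 * (k : ℝ))) := by
          rw [intervalIntegral.integral_const_mul]
          have := hmom k
          gcongr
      _ = C * D * (((k : ℝ) + 1) ^ 7
            * ((2 : ℝ) ^ (-1.47 * k : ℝ) * (2 : ℝ) ^ (1.36 * (k : ℝ)))) := by ring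
      _ = _ := by
          rw [← Real.rpow_add (by norm_num)]
          congr 4
          ring
  have hpos : IntegrableOn f (Set.Ioi 0) := by
    have := (hcont.integrableOn_Ioc (a := 0) (b := 1) (μ := volume)).union hone
    rwa [Set.Ioc_union_Ioi_eq_Ioi zero_le_one] at this
  have hsymm : ∀ t, f (-t) = (starRingEnd ℂ) (f t) := fun t => by
    simp only [hf]
    rw [← zetaKernel_conj]
    congr 1
    rw [map_add, map_mul, Complex.conj_ofReal, Complex.conj_ofReal, Complex.conj_I]
    push_cast
    ring
  have hneg : IntegrableOn f (Set.Iio 0) := by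
    have h1 : IntegrableOn (fun t => f (-t)) (Set.Ioi 0) := by
      simp only [hsymm]
      exact (Complex.conjCLE : ℂ →L[ℝ] ℂ).integrable_comp hpos
    have h2 : IntegrableOn (fun t => f (-t)) (Set.Ioi (-0)) := by rwa [neg_zero]
    simpa using h2.comp_neg_Iio
  rw [← integrableOn_univ, ← Set.Iic_union_Ioi (a := (0 : ℝ))]
  exact ((integrableOn_Iic_iff_integrableOn_Iio (by simp)).2 hneg).union hpos

lemma integrable_zetaKernel_right_edge :
    Integrable fun t : ℝ => zetaKernel ((3 / 2 : ℝ) + t * Complex.I) := by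
  obtain ⟨C, hC, h⟩ := norm_riemannZeta_le_of_one_lt (σ := 3 / 2) (by norm_num)
  obtain ⟨D, hD, h'⟩ := norm_riemannZeta_le_of_one_lt (σ := 2) (by norm_num)
  have hcont := continuous_zetaKernel_vertical (σ := 3 / 2) (by norm_num) (by norm_num)
  refine Integrable.mono' (integrable_inv_one_add_sq.const_mul (C ^ 4 * D))
    hcont.aestronglyMeasurable (Eventually.of_forall fun t => ?_)
  set z : ℂ := (3 / 2 : ℝ) + t * Complex.I with hz
  have h1 := h z (by simp [hz])
  have h2 := h' (2 * z - 1) (by simp [hz]; norm_num)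
  have h3 : 1 + t ^ 2 ≤ ‖z ^ 2‖ := by
    rw [norm_pow, Complex.sq_norm, Complex.normSq_apply]
    simp [hz]
    nlinarith
  rw [zetaKernel, norm_div, norm_mul, norm_pow, div_eq_mul_inv]
  gcongr

/-- The kernel tends to zero along horizontal segments. -/
lemma norm_zetaKernel_le_of_one_le_abs_im :
    ∃ C : ℝ, 0 ≤ C ∧ ∀ z : ℂ, 0.49 ≤ z.re → z.re ≤ 3 / 2 → 1 ≤ |z.im| →
      ‖zetaKernel z‖ ≤ C * |z.im| ^ (-0.41 : ℝ) := by
  obtain ⟨C, hC, h⟩ := norm_riemannZeta₁_le_of_neg_two_hundredths_le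
  obtain ⟨D, hD, h'⟩ := norm_riemannZeta₁_le_of_forty_nine_hundredths_le
  refine ⟨(D * 2 ^ (1.265 : ℝ)) ^ 4 * (C * 3 ^ (1.53 : ℝ)) / 2, by positivity,
    fun z hz1 hz2 him => ?_⟩
  set t := |z.im| with ht
  have ht0 : 0 < t := by linarith
  have hzne : z ≠ 1 := by
    rintro rfl
    simp [ht] at ht0
  have h1 : ‖riemannZeta₁ z‖ ≤ D * 2 ^ (1.265 : ℝ) * t ^ (1.265 : ℝ) := by
    refine (h' z hz1 (by linarith)).trans ?_
    rw [mul_assoc, ← Real.mul_rpow (by norm_num) ht0.le]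
    gcongr
    linarith
  have hw : (2 * z - 1).im = 2 * z.im := by simp
  have h2 : ‖riemannZeta₁ (2 * z - 1)‖ ≤ C * 3 ^ (1.53 : ℝ) * t ^ (1.53 : ℝ) := by
    refine (h (2 * z - 1) (by simp; linarith) (by simp; linarith)).trans ?_
    rw [mul_assoc, ← Real.mul_rpow (by norm_num) ht0.le, hw, abs_mul, abs_two]
    gcongr
    linarith
  have h3 : t ≤ ‖z‖ := Complex.abs_im_le_norm z
  have h4 : t ≤ ‖z - 1‖ := by
    have := Complex.abs_im_le_norm (z - 1)
    simpa using this
  have e1 : ‖zetaKernel z‖ = ‖riemannZeta₁ z‖ ^ 4 * ‖riemannZeta₁ (2 * z - 1)‖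
      / (2 * ‖z‖ ^ 2 * ‖z - 1‖ ^ 5) := by
    rw [zetaKernel_eq_div hzne, zetaKernelNum]
    simp only [norm_div, norm_mul, norm_pow, Complex.norm_ofNat]
    rw [div_div]
  rw [e1]
  calc _ ≤ (D * 2 ^ (1.265 : ℝ) * t ^ (1.265 : ℝ)) ^ 4 * (C * 3 ^ (1.53 : ℝ) * t ^ (1.53 : ℝ))
        / (2 * t ^ 2 * t ^ 5) := by gcongr
    _ = (D * 2 ^ (1.265 : ℝ)) ^ 4 * (C * 3 ^ (1.53 : ℝ)) / 2
        * ((t ^ (1.265 : ℝ)) ^ 4 * t ^ (1.53 : ℝ) * (t ^ 7)⁻¹) := by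
        field_simp
    _ = _ := by
        rw [← Real.rpow_natCast (t ^ (1.265 : ℝ)), ← Real.rpow_mul ht0.le, ← Real.rpow_natCast t,
          ← Real.rpow_neg ht0.le, ← Real.rpow_add ht0, ← Real.rpow_add ht0]
        norm_num

end ZetaKernel

end SubgroupCount

namespace SubgroupCount

open Finset MeasureTheory Filter Topology

/-! ### Shifting a vertical line of integration across a pole -/

section ContourShift

lemma vertical_ne_zero {c : ℝ} (hc : c ≠ 0) (t : ℝ) : (c : ℂ) + t * Complex.I ≠ 0 := fun h => hc (by
  have := congrArg Complex.re h
  simpa using this)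

lemma continuous_inv_pow_vertical {c : ℝ} (hc : c ≠ 0) (m : ℕ) :
    Continuous fun t : ℝ => (((c : ℂ) + t * Complex.I) ^ m)⁻¹ :=
  Continuous.inv₀ (by fun_prop) fun t => pow_ne_zero m (vertical_ne_zero hc t)

lemma integral_inv_vertical {c : ℝ} (hc : c ≠ 0) (T : ℝ) :
    ∫ t in -T..T, (((c : ℂ) + t * Complex.I))⁻¹ = ((2 * Real.arctan (T / c) : ℝ) : ℂ) := by
  have hcont : Continuous fun t : ℝ => (((c : ℂ) + t * Complex.I))⁻¹ := by
    simpa using continuous_inv_pow_vertical hc 1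
  have hcont' : Continuous fun t : ℝ => (((c : ℂ) + (-t : ℝ) * Complex.I))⁻¹ :=
    hcont.comp continuous_neg
  have hflip : ∫ t in -T..T, (((c : ℂ) + (-t : ℝ) * Complex.I))⁻¹
      = ∫ t in -T..T, (((c : ℂ) + t * Complex.I))⁻¹ := by
    rw [intervalIntegral.integral_comp_neg (fun t : ℝ => (((c : ℂ) + t * Complex.I))⁻¹), neg_neg]
  have hreal : ∀ t : ℝ, (((c : ℂ) + t * Complex.I))⁻¹ + (((c : ℂ) + (-t : ℝ) * Complex.I))⁻¹
      = ((2 * (c⁻¹ * (1 + (t / c) ^ 2)⁻¹) : ℝ) : ℂ) := by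
    intro t
    have h1 := vertical_ne_zero hc t
    have h2 := vertical_ne_zero hc (-t)
    have h3 : (c : ℂ) ≠ 0 := by exact_mod_cast hc
    have h4 : (c : ℂ) ^ 2 + t ^ 2 ≠ 0 := by
      have : c ^ 2 + t ^ 2 ≠ 0 := by positivity
      exact_mod_cast this
    have h5 : (1 : ℂ) + (t / c) ^ 2 ≠ 0 := by
      have e : (1 : ℂ) + (t / c) ^ 2 = (c ^ 2 + t ^ 2) / c ^ 2 := by field_simp
      rw [e]
      exact div_ne_zero h4 (pow_ne_zero 2 h3)
    have e1 : ((c : ℂ) + t * Complex.I) * (c + (-t : ℝ) * Complex.I) = c ^ 2 + t ^ 2 := by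
      push_cast
      linear_combination (-(t : ℂ) ^ 2) * Complex.I_sq
    have e2 : (((c : ℂ) + t * Complex.I))⁻¹ + (((c : ℂ) + (-t : ℝ) * Complex.I))⁻¹
        = 2 * c / (c ^ 2 + t ^ 2) := by
      rw [inv_add_inv h1 h2, e1]
      congr 1
      push_cast
      ring
    rw [e2]
    push_cast
    field_simp
  have hsum : ∫ t in -T..T, ((((c : ℂ) + t * Complex.I))⁻¹ + (((c : ℂ) + (-t : ℝ) * Complex.I))⁻¹)
      = 2 * ∫ t in -T..T, (((c : ℂ) + t * Complex.I))⁻¹ := by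
    rw [intervalIntegral.integral_add (hcont.intervalIntegrable _ _)
      (hcont'.intervalIntegrable _ _), hflip, two_mul]
  have harctan : ∫ t in -T..T, c⁻¹ * (1 + (t / c) ^ 2)⁻¹ = 2 * Real.arctan (T / c) := by
    rw [intervalIntegral.integral_const_mul,
      intervalIntegral.integral_comp_div (fun t => (1 + t ^ 2)⁻¹) hc, integral_inv_one_add_sq,
      smul_eq_mul, inv_mul_cancel_left₀ hc, neg_div, Real.arctan_neg]
    ring
  simp only [hreal] at hsum
  rw [intervalIntegral.integral_ofReal, intervalIntegral.integral_const_mul, harctan] at hsum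
  have h2 : (2 : ℂ) ≠ 0 := two_ne_zero
  apply mul_left_cancel₀ h2
  rw [← hsum]
  push_cast
  ring

lemma tendsto_integral_inv_vertical_of_pos {c : ℝ} (hc : 0 < c) :
    Tendsto (fun T : ℝ => ∫ t in -T..T, (((c : ℂ) + t * Complex.I))⁻¹) atTop (𝓝 Real.pi) := by
  simp only [integral_inv_vertical hc.ne']
  have h := (Real.tendsto_arctan_atTop.mono_right nhdsWithin_le_nhds).comp
    (tendsto_id.atTop_div_const hc)
  have h2 := (Complex.continuous_ofReal.tendsto _).comp (h.const_mul 2)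
  rwa [mul_div_cancel₀ Real.pi two_ne_zero] at h2

lemma tendsto_integral_inv_vertical_of_neg {c : ℝ} (hc : c < 0) :
    Tendsto (fun T : ℝ => ∫ t in -T..T, (((c : ℂ) + t * Complex.I))⁻¹) atTop
      (𝓝 (-Real.pi)) := by
  have h := (tendsto_integral_inv_vertical_of_pos (neg_pos.2 hc)).neg
  refine h.congr fun T => ?_
  rw [integral_inv_vertical hc.ne, integral_inv_vertical (neg_pos.2 hc).ne', div_neg,
    Real.arctan_neg]
  push_cast
  ring

lemma tendsto_integral_inv_pow_vertical {c : ℝ} (hc : c ≠ 0) {m : ℕ} (hm : 1 ≤ m) :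
    Tendsto (fun T : ℝ => ∫ t in -T..T, (((c : ℂ) + t * Complex.I) ^ (m + 1))⁻¹) atTop (𝓝 0) := by
  have hI : (Complex.I * m : ℂ) ≠ 0 :=
    mul_ne_zero Complex.I_ne_zero (by exact_mod_cast (by omega : m ≠ 0))
  set P : ℝ → ℂ := fun t => -(Complex.I * m)⁻¹ * (((c : ℂ) + t * Complex.I) ^ m)⁻¹ with hP
  have hderiv : ∀ t : ℝ, HasDerivAt P ((((c : ℂ) + t * Complex.I) ^ (m + 1))⁻¹) t := by
    intro t
    have hz := vertical_ne_zero hc t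
    have h1 : HasDerivAt (fun t : ℝ => (c : ℂ) + t * Complex.I) Complex.I t := by
      simpa using ((Complex.ofRealCLM.hasDerivAt (x := t)).mul_const Complex.I).const_add (c : ℂ)
    have h2 := (h1.pow m).inv (pow_ne_zero m hz)
    refine (h2.const_mul (-(Complex.I * m)⁻¹)).congr_deriv ?_
    obtain ⟨n, rfl⟩ : ∃ n, m = n + 1 := ⟨m - 1, by omega⟩
    simp only [Nat.add_sub_cancel, Pi.pow_apply]
    generalize (c : ℂ) + t * Complex.I = z at hz
    field_simp
    ring
  have hint : ∀ T : ℝ, ∫ t in -T..T, (((c : ℂ) + t * Complex.I) ^ (m + 1))⁻¹ = P T - P (-T) :=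
    fun T => intervalIntegral.integral_eq_sub_of_hasDerivAt (fun t _ => hderiv t)
      ((continuous_inv_pow_vertical hc (m + 1)).intervalIntegrable _ _)
  simp only [hint]
  have hzero : ∀ ε : ℝ, |ε| = 1 → Tendsto (fun T : ℝ => P (ε * T)) atTop (𝓝 0) := by
    intro ε hε
    have hb : Tendsto (fun T : ℝ => ‖(Complex.I * m : ℂ)⁻¹‖ * T⁻¹) atTop (𝓝 0) := by
      simpa using tendsto_inv_atTop_zero.const_mul ‖(Complex.I * m : ℂ)⁻¹‖
    refine squeeze_zero_norm' ?_ hb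
    filter_upwards [eventually_ge_atTop 1] with T hT
    simp only [hP]
    rw [norm_mul, norm_neg, norm_inv (_ ^ m), norm_pow]
    have h1 : T ≤ ‖(c : ℂ) + (ε * T : ℝ) * Complex.I‖ := by
      have h := Complex.abs_im_le_norm ((c : ℂ) + (ε * T : ℝ) * Complex.I)
      have e : ((c : ℂ) + (ε * T : ℝ) * Complex.I).im = ε * T := by simp
      rwa [e, abs_mul, hε, one_mul, abs_of_pos (by linarith)] at h
    have h2 : T ≤ ‖(c : ℂ) + (ε * T : ℝ) * Complex.I‖ ^ m :=
      h1.trans (le_self_pow₀ (hT.trans h1) (by omega))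
    gcongr
  have h1 := hzero 1 (by simp)
  have h2 := hzero (-1) (by simp)
  simpa using h1.sub h2

/-- Taylor's formula at `1` with remainder `(z - 1) ^ n` times an `n`-fold divided slope. -/
lemma eq_sum_iterate_dslope_add (g : ℂ → ℂ) (n : ℕ) (z : ℂ) :
    g z = ∑ j ∈ range n, ((Function.swap dslope 1)^[j] g) 1 * (z - 1) ^ j
      + (z - 1) ^ n * ((Function.swap dslope 1)^[n] g) z := by
  induction n with
  | zero => simp
  | succ n ih =>
    have h := sub_smul_dslope ((Function.swap dslope 1)^[n] g) 1 z
    rw [smul_eq_mul] at h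
    rw [ih, sum_range_succ, Function.iterate_succ_apply']
    change _ = _ + _ + (z - 1) ^ (n + 1) * dslope ((Function.swap dslope 1)^[n] g) 1 z
    rw [pow_succ (z - 1) n, mul_assoc ((z - 1) ^ n), h]
    ring

lemma differentiableOn_iterate_dslope {g : ℂ → ℂ} {U : Set ℂ} (hU : U ∈ 𝓝 (1 : ℂ))
    (hg : DifferentiableOn ℂ g U) (n : ℕ) :
    DifferentiableOn ℂ ((Function.swap dslope 1)^[n] g) U := by
  induction n with
  | zero => simpa using hg
  | succ n ih =>
    rw [Function.iterate_succ_apply']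
    exact (Complex.differentiableOn_dslope hU).2 ih

/-- The residue theorem for a function with a pole of order five at `1` and vertical lines on both
sides: after the principal part is removed, Cauchy's theorem applies on rectangles, and the
principal part is integrated in closed form. -/
lemma integral_vertical_sub_integral_vertical {g : ℂ → ℂ} {a b : ℝ} (ha : 0 < a) (ha1 : a < 1)
    (hb : 1 < b) (hg : DifferentiableOn ℂ g {z | 0 < z.re})
    (hinta : Integrable fun t : ℝ => g (a + t * Complex.I) / ((a + t * Complex.I : ℂ) - 1) ^ 5)
    (hintb : Integrable fun t : ℝ => g (b + t * Complex.I) / ((b + t * Complex.I : ℂ) - 1) ^ 5)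
    {C δ : ℝ} (hδ : 0 < δ)
    (hhor : ∀ z : ℂ, a ≤ z.re → z.re ≤ b → 1 ≤ |z.im| →
      ‖g z / (z - 1) ^ 5‖ ≤ C * |z.im| ^ (-δ)) :
    (∫ t : ℝ, g (b + t * Complex.I) / ((b + t * Complex.I : ℂ) - 1) ^ 5)
      - ∫ t : ℝ, g (a + t * Complex.I) / ((a + t * Complex.I : ℂ) - 1) ^ 5
      = 2 * Real.pi * ((Function.swap dslope 1)^[4] g) 1 := by
  set U : Set ℂ := {z | 0 < z.re} with hU
  have hUopen : IsOpen U := isOpen_lt continuous_const Complex.continuous_re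
  have hU1 : U ∈ 𝓝 (1 : ℂ) := hUopen.mem_nhds (by simp [hU])
  set h : ℂ → ℂ := (Function.swap dslope 1)^[5] g with hh
  set r : ℕ → ℂ := fun j => ((Function.swap dslope 1)^[j] g) 1 with hr
  have hdiff : DifferentiableOn ℂ h U := differentiableOn_iterate_dslope hU1 hg 5
  have hdecomp : ∀ z : ℂ, z ≠ 1 →
      g z / (z - 1) ^ 5 = h z + ∑ j ∈ range 5, r j * ((z - 1) ^ (5 - j))⁻¹ := by
    intro z hz
    have hz1 : z - 1 ≠ 0 := sub_ne_zero.2 hz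
    rw [eq_sum_iterate_dslope_add g 5 z, add_div, mul_div_cancel_left₀ _ (pow_ne_zero 5 hz1),
      add_comm, sum_div]
    congr 1
    refine sum_congr rfl fun j hj => ?_
    have hj := mem_range.1 hj
    rw [mul_div_assoc]
    congr 1
    have e : (z - 1) ^ 5 = (z - 1) ^ j * (z - 1) ^ (5 - j) := by
      rw [← pow_add]; congr 1; omega
    rw [e]
    field_simp
  have hvert : ∀ c : ℝ, c ≠ 1 → ∀ t : ℝ, (c + t * Complex.I : ℂ) ≠ 1 := fun c hc t hct => hc (by
    have := congrArg Complex.re hct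
    simpa using this)
  have hcont : ∀ c : ℝ, 0 < c → Continuous fun t : ℝ => h (c + t * Complex.I) := by
    intro c hc
    rw [continuous_iff_continuousAt]
    intro t
    refine ContinuousAt.comp (f := fun t : ℝ => (c : ℂ) + t * Complex.I)
      (hdiff.continuousOn.continuousAt (hUopen.mem_nhds ?_)) (by fun_prop)
    simpa [hU] using hc
  -- the truncated integrals of the four ingredients
  have hV : ∀ c : ℝ, 0 < c → c ≠ 1 → ∀ T : ℝ,
      ∫ t in -T..T, g (c + t * Complex.I) / ((c + t * Complex.I : ℂ) - 1) ^ 5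
        = (∫ t in -T..T, h (c + t * Complex.I))
          + ∑ j ∈ range 5, r j * ∫ t in -T..T, ((((c - 1 : ℝ) : ℂ) + t * Complex.I) ^ (5 - j))⁻¹ := by
    intro c hc hc1 T
    have hpole : ∀ j : ℕ, Continuous fun t : ℝ =>
        ((((c - 1 : ℝ) : ℂ) + t * Complex.I) ^ (5 - j))⁻¹ := fun j =>
      continuous_inv_pow_vertical (sub_ne_zero.2 hc1) _
    have e : ∀ t : ℝ, g (c + t * Complex.I) / ((c + t * Complex.I : ℂ) - 1) ^ 5
        = h (c + t * Complex.I)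
          + ∑ j ∈ range 5, r j * ((((c - 1 : ℝ) : ℂ) + t * Complex.I) ^ (5 - j))⁻¹ := by
      intro t
      rw [hdecomp _ (hvert c hc1 t)]
      congr 1
      refine sum_congr rfl fun j _ => ?_
      congr 3
      push_cast
      ring
    have hterm : ∀ j : ℕ, Continuous fun t : ℝ =>
        r j * ((((c - 1 : ℝ) : ℂ) + t * Complex.I) ^ (5 - j))⁻¹ := fun j =>
      continuous_const.mul (hpole j)
    simp only [e]
    rw [intervalIntegral.integral_add ((hcont c hc).intervalIntegrable _ _)
      (Continuous.intervalIntegrable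
        (continuous_finsetSum _ fun j _ => hterm j) _ _),
      intervalIntegral.integral_finsetSum fun j _ => (hterm j).intervalIntegrable _ _]
    simp only [intervalIntegral.integral_const_mul]
  -- Cauchy's theorem for the regular part
  have hreg : Tendsto (fun T : ℝ => (∫ t in -T..T, h (b + t * Complex.I))
      - ∫ t in -T..T, h (a + t * Complex.I)) atTop (𝓝 0) := by
    have hrect : ∀ T : ℝ, (∫ t in -T..T, h (b + t * Complex.I))
        - ∫ t in -T..T, h (a + t * Complex.I)
        = Complex.I * ((∫ x in a..b, h (x + (-T : ℝ) * Complex.I))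
          - ∫ x in a..b, h (x + T * Complex.I)) := by
      intro T
      have hC := Complex.integral_boundary_rect_eq_zero_of_differentiableOn h
        (a + (-T : ℝ) * Complex.I) (b + T * Complex.I) (hdiff.mono fun z hz => by
          rw [Complex.mem_reProdIm] at hz
          have h1 := hz.1
          simp only [Complex.add_re, Complex.ofReal_re, Complex.mul_re, Complex.I_re, mul_zero,
            Complex.ofReal_im, Complex.I_im, mul_one, sub_self, add_zero] at h1
          rw [Set.uIcc_of_le (by linarith)] at h1
          exact lt_of_lt_of_le ha h1.1)
      simp only [Complex.add_re, Complex.ofReal_re, Complex.mul_re, Complex.I_re, mul_zero,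
        Complex.ofReal_im, Complex.I_im, mul_one, sub_self, add_zero, Complex.add_im,
        Complex.mul_im, zero_add, smul_eq_mul] at hC
      linear_combination (-Complex.I) * hC + ((∫ t in -T..T, h (b + t * Complex.I))
        - ∫ t in -T..T, h (a + t * Complex.I)) * Complex.I_sq
    simp only [hrect]
    set S : ℝ := ∑ j ∈ range 5, ‖r j‖ with hS
    have hbound : ∀ T : ℝ, 1 ≤ T → ∀ ε : ℝ, |ε| = 1 →
        ‖∫ x in a..b, h (x + (ε * T : ℝ) * Complex.I)‖ ≤ (C * T ^ (-δ) + S * T⁻¹) * |b - a| := by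
      intro T hT ε hε
      refine intervalIntegral.norm_integral_le_of_norm_le_const fun x hx => ?_
      rw [Set.uIoc_of_le (by linarith)] at hx
      set z : ℂ := x + (ε * T : ℝ) * Complex.I with hz
      have hzre : z.re = x := by simp [hz]
      have hzim : |z.im| = T := by
        have : z.im = ε * T := by simp [hz]
        rw [this, abs_mul, hε, one_mul, abs_of_pos (by linarith)]
      have hz1 : z ≠ 1 := by
        intro h1
        rw [h1] at hzim
        simp at hzim
        linarith
      have hzn : T ≤ ‖z - 1‖ := by
        have := Complex.abs_im_le_norm (z - 1)
        rwa [Complex.sub_im, Complex.one_im, sub_zero, hzim] at this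
      have h1 := hhor z (by rw [hzre]; exact hx.1.le) (by rw [hzre]; exact hx.2)
        (by rw [hzim]; exact hT)
      rw [hzim] at h1
      have e : h z = g z / (z - 1) ^ 5 - ∑ j ∈ range 5, r j * ((z - 1) ^ (5 - j))⁻¹ := by
        rw [hdecomp z hz1]; ring
      rw [e]
      refine (norm_sub_le _ _).trans (add_le_add h1 ?_)
      rw [hS, sum_mul]
      refine norm_sum_le_of_le _ fun j hj => ?_
      have hj := mem_range.1 hj
      rw [norm_mul, norm_inv, norm_pow]
      have h2 : T ≤ ‖z - 1‖ ^ (5 - j) := hzn.trans (le_self_pow₀ (hT.trans hzn) (by omega))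
      gcongr
    have hlim : Tendsto (fun T : ℝ => 2 * ((C * T ^ (-δ) + S * T⁻¹) * |b - a|)) atTop (𝓝 0) := by
      have h1 := (tendsto_rpow_neg_atTop hδ).const_mul C
      have h2 := tendsto_inv_atTop_zero.const_mul S (M := ℝ)
      simpa using ((h1.add h2).mul_const |b - a|).const_mul 2
    refine squeeze_zero_norm' ?_ hlim
    filter_upwards [eventually_ge_atTop 1] with T hT
    have h1 := hbound T hT 1 (by simp)
    have h2 := hbound T hT (-1) (by simp)
    rw [one_mul] at h1
    rw [neg_one_mul] at h2
    rw [norm_mul, Complex.norm_I, one_mul]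
    refine (norm_sub_le _ _).trans ?_
    linarith
  have hpolar : ∀ j ∈ range 5, Tendsto (fun T : ℝ =>
      r j * (∫ t in -T..T, ((((b - 1 : ℝ) : ℂ) + t * Complex.I) ^ (5 - j))⁻¹)
        - r j * ∫ t in -T..T, ((((a - 1 : ℝ) : ℂ) + t * Complex.I) ^ (5 - j))⁻¹) atTop
      (𝓝 (if j = 4 then 2 * Real.pi * r 4 else 0)) := by
    intro j hj
    have hj := mem_range.1 hj
    split_ifs with h4
    · subst h4
      have h1 := tendsto_integral_inv_vertical_of_pos (sub_pos.2 hb)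
      have h2 := tendsto_integral_inv_vertical_of_neg (sub_neg.2 ha1)
      have h3 := (h1.const_mul (r 4)).sub (h2.const_mul (r 4))
      have e : r 4 * Real.pi - r 4 * -Real.pi = 2 * Real.pi * r 4 := by ring
      rw [e] at h3
      simpa using h3
    · obtain ⟨m, hm⟩ : ∃ m, 5 - j = m + 1 := ⟨4 - j, by omega⟩
      rw [hm]
      have h1 := tendsto_integral_inv_pow_vertical (sub_ne_zero.2 hb.ne') (m := m) (by omega)
      have h2 := tendsto_integral_inv_pow_vertical (sub_ne_zero.2 ha1.ne) (m := m) (by omega)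
      simpa using (h1.const_mul (r j)).sub (h2.const_mul (r j))
  have hlim2 : Tendsto (fun T : ℝ =>
      (∫ t in -T..T, g (b + t * Complex.I) / ((b + t * Complex.I : ℂ) - 1) ^ 5)
        - ∫ t in -T..T, g (a + t * Complex.I) / ((a + t * Complex.I : ℂ) - 1) ^ 5) atTop
      (𝓝 (2 * Real.pi * r 4)) := by
    have h1 := hreg.add (tendsto_finsetSum (range 5) hpolar)
    rw [sum_ite_eq' (range 5) 4, if_pos (by simp), zero_add] at h1
    refine h1.congr fun T => ?_
    rw [hV b (by linarith) hb.ne' T, hV a ha ha1.ne T, sum_sub_distrib]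
    ring
  have hlim1 := (intervalIntegral_tendsto_integral hintb tendsto_neg_atTop_atBot tendsto_id).sub
    (intervalIntegral_tendsto_integral hinta tendsto_neg_atTop_atBot tendsto_id)
  exact tendsto_nhds_unique hlim1 hlim2

end ContourShift

end SubgroupCount

namespace SubgroupCount

open Finset MeasureTheory Filter Topology ArithmeticFunction
open scoped ArithmeticFunction.zeta

/-! ### Dirichlet series and a Perron formula for Riesz sums -/

noncomputable section Perron

/-- A real arithmetic function with its values regarded as complex numbers. -/
def toComplex (f : ArithmeticFunction ℝ) : ArithmeticFunction ℂ := ⟨fun n => (f n : ℂ), by simp⟩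

@[simp] lemma toComplex_apply (f : ArithmeticFunction ℝ) (n : ℕ) : toComplex f n = (f n : ℂ) := rfl

lemma toComplex_mul (f g : ArithmeticFunction ℝ) :
    toComplex (f * g) = toComplex f * toComplex g := by
  ext n
  simp only [toComplex_apply, mul_apply]
  push_cast
  rfl

lemma LSeriesSummable_toComplex_mul {f g : ArithmeticFunction ℝ} {z : ℂ}
    (hf : LSeriesSummable (fun n => toComplex f n) z)
    (hg : LSeriesSummable (fun n => toComplex g n) z) :
    LSeriesSummable (fun n => toComplex (f * g) n) z := by
  rw [toComplex_mul]
  exact LSeriesSummable_mul hf hg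

lemma LSeries_toComplex_mul {f g : ArithmeticFunction ℝ} {z : ℂ}
    (hf : LSeriesSummable (fun n => toComplex f n) z)
    (hg : LSeriesSummable (fun n => toComplex g n) z) :
    LSeries (fun n => toComplex (f * g) n) z
      = LSeries (fun n => toComplex f n) z * LSeries (fun n => toComplex g n) z := by
  rw [toComplex_mul]
  exact LSeries_mul' hf hg

lemma toComplex_zeta (n : ℕ) : toComplex (ζ : ArithmeticFunction ℝ) n = ((ζ n : ℕ) : ℂ) := by
  rw [toComplex_apply, natCoe_apply, Complex.ofReal_natCast]

lemma LSeriesSummable_toComplex_zeta {z : ℂ} (hz : 1 < z.re) :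
    LSeriesSummable (fun n => toComplex (ζ : ArithmeticFunction ℝ) n) z := by
  simp only [toComplex_zeta]
  exact LSeriesSummable_zeta_iff.2 hz

lemma LSeries_toComplex_zeta {z : ℂ} (hz : 1 < z.re) :
    LSeries (fun n => toComplex (ζ : ArithmeticFunction ℝ) n) z = riemannZeta z := by
  simp only [toComplex_zeta]
  exact LSeries_zeta_eq_riemannZeta hz

lemma hasSum_squareSupport_idFun {z : ℂ} (hz : 1 < z.re) :
    HasSum (LSeries.term (fun n => toComplex (squareSupport idFun) n) z)
      (riemannZeta (2 * z - 1)) := by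
  have hre : 1 < (2 * z - 1).re := by simp; linarith
  have hinj : Function.Injective fun d : ℕ => d * d := fun a b h => Nat.mul_self_inj.1 h
  rw [← hinj.hasSum_iff]
  · have hs : Summable fun n : ℕ => 1 / (n : ℂ) ^ (2 * z - 1) :=
      Complex.summable_one_div_nat_cpow.2 hre
    rw [zeta_eq_tsum_one_div_nat_cpow hre]
    convert hs.hasSum using 1
    ext d
    rw [Function.comp_apply, LSeries.term_def]
    have hne : 2 * z - 1 ≠ 0 := fun h => by rw [h] at hre; simp at hre; linarith
    rcases eq_or_ne d 0 with rfl | hd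
    · simp [Complex.zero_cpow hne]
    · have hd0 : (d : ℂ) ≠ 0 := by exact_mod_cast hd
      rw [if_neg (Nat.mul_ne_zero hd hd), toComplex_apply, squareSupport_mul_self, idFun_apply,
        Nat.cast_mul, Complex.natCast_mul_natCast_cpow, Complex.cpow_sub _ _ hd0, Complex.cpow_one,
        two_mul, Complex.cpow_add _ _ hd0, Complex.ofReal_natCast]
      field_simp
  · intro n hn
    rw [LSeries.term_def]
    split_ifs with h0
    · rfl
    · have : ¬ IsSquare n := fun ⟨d, hd⟩ => hn ⟨d, hd.symm⟩
      rw [toComplex_apply, squareSupport_of_not_isSquare _ this]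
      simp

lemma LSeriesSummable_baseCoeff {z : ℂ} (hz : 1 < z.re) :
    LSeriesSummable (fun n => toComplex baseCoeff n) z := by
  have h := LSeriesSummable_toComplex_zeta hz
  have e : baseCoeff = (ζ : ArithmeticFunction ℝ) * ζ * ζ * ζ * squareSupport idFun := by
    rw [baseCoeff]; ring
  rw [e]
  exact LSeriesSummable_toComplex_mul (LSeriesSummable_toComplex_mul
    (LSeriesSummable_toComplex_mul (LSeriesSummable_toComplex_mul h h) h) h)
    (hasSum_squareSupport_idFun hz).summable

lemma LSeries_baseCoeff {z : ℂ} (hz : 1 < z.re) :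
    LSeries (fun n => toComplex baseCoeff n) z = riemannZeta z ^ 4 * riemannZeta (2 * z - 1) := by
  have h := LSeriesSummable_toComplex_zeta hz
  have h2 := LSeriesSummable_toComplex_mul h h
  have h3 := LSeriesSummable_toComplex_mul h2 h
  have h4 := LSeriesSummable_toComplex_mul h3 h
  have e : baseCoeff = (ζ : ArithmeticFunction ℝ) * ζ * ζ * ζ * squareSupport idFun := by
    rw [baseCoeff]; ring
  rw [e, LSeries_toComplex_mul h4 (hasSum_squareSupport_idFun hz).summable,
    LSeries_toComplex_mul h3 h, LSeries_toComplex_mul h2 h, LSeries_toComplex_mul h h,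
    LSeries_toComplex_zeta hz, LSeries, (hasSum_squareSupport_idFun hz).tsum_eq]
  ring

lemma integrable_inv_sq_vertical {σ : ℝ} (hσ : 0 < σ) :
    Integrable fun t : ℝ => 1 / ((σ : ℂ) + t * Complex.I) ^ 2 := by
  have hcont : Continuous fun t : ℝ => 1 / ((σ : ℂ) + t * Complex.I) ^ 2 := by
    simpa using continuous_inv_pow_vertical hσ.ne' 2
  refine Integrable.mono' (g := fun t => (1 / σ ^ 2 + 1) * (1 + t ^ 2)⁻¹)
    (integrable_inv_one_add_sq.const_mul _)
    hcont.aestronglyMeasurable (Eventually.of_forall fun t => ?_)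
  have e : ‖1 / ((σ : ℂ) + t * Complex.I) ^ 2‖ = 1 / (σ ^ 2 + t ^ 2) := by
    rw [norm_div, norm_pow, Complex.sq_norm, Complex.normSq_add_mul_I, norm_one]
  rw [e, ← div_eq_mul_inv, div_le_div_iff₀ (by positivity) (by positivity)]
  have e2 : (1 / σ ^ 2 + 1) * (σ ^ 2 + t ^ 2) = 1 + t ^ 2 / σ ^ 2 + (σ ^ 2 + t ^ 2) := by
    field_simp
  rw [e2]
  have : 0 ≤ t ^ 2 / σ ^ 2 := by positivity
  nlinarith [sq_nonneg σ]

/-- The Mellin transform of `max (-log u) 0` is `1 / s²`. -/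
lemma mellin_neg_log_indicator {s : ℂ} (hs : 0 < s.re) :
    MellinConvergent (fun u : ℝ => -(Real.log u • (Set.Ioc 0 1).indicator (fun _ => (1 : ℂ)) u)) s ∧
    mellin (fun u : ℝ => -(Real.log u • (Set.Ioc 0 1).indicator (fun _ => (1 : ℂ)) u)) s
      = 1 / s ^ 2 := by
  set f : ℝ → ℂ := (Set.Ioc 0 1).indicator (fun _ => (1 : ℂ)) with hf
  have htop : f =O[atTop] fun x => x ^ (-(s.re + 1)) := by
    refine Asymptotics.IsBigO.of_bound 1 ?_
    filter_upwards [eventually_gt_atTop 1] with x hx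
    have : x ∉ Set.Ioc (0 : ℝ) 1 := fun h => absurd h.2 (not_le.2 hx)
    rw [hf, Set.indicator_of_notMem this, norm_zero]
    positivity
  have hbot : f =O[𝓝[>] 0] fun x => x ^ (-(0 : ℝ)) := by
    refine Asymptotics.IsBigO.of_bound 1 (Eventually.of_forall fun x => ?_)
    simp only [neg_zero, Real.rpow_zero, norm_one, mul_one, hf]
    exact (norm_indicator_le_norm_self _ _).trans (by simp)
  have hloc : LocallyIntegrableOn f (Set.Ioi 0) := by
    refine LocallyIntegrable.locallyIntegrableOn ?_ _
    exact ((integrable_indicator_iff measurableSet_Ioc).2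
      (integrableOn_const (by simp))).locallyIntegrable
  obtain ⟨h1, h2⟩ := mellin_hasDerivAt_of_isBigO_rpow hloc htop (by linarith) hbot hs
  have hs0 : s ≠ 0 := fun h => by rw [h] at hs; simp at hs
  have h3 : HasDerivAt (mellin f) (-(s ^ 2)⁻¹) s := by
    refine (hasDerivAt_inv hs0).congr_of_eventuallyEq ?_
    filter_upwards [(isOpen_lt continuous_const Complex.continuous_re).mem_nhds hs] with z hz
    rw [(hasMellin_one_Ioc hz).2, one_div]
  have h4 := h2.unique h3
  have h5 : MellinConvergent (fun u : ℝ => -(Real.log u • f u)) s := by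
    simp only [MellinConvergent, smul_neg]
    exact IntegrableOn.neg h1
  refine ⟨h5, ?_⟩
  have e : mellin (fun u : ℝ => -(Real.log u • f u)) s = -mellin (fun u : ℝ => Real.log u • f u) s := by
    simp only [mellin, smul_neg, integral_neg]
  rw [e, h4, neg_neg, one_div]

/-- The Perron integral with kernel `1 / z²`. -/
lemma integral_cpow_div_sq_vertical {σ x : ℝ} (hσ : 0 < σ) (hx : 0 < x) :
    ∫ t : ℝ, (x : ℂ) ^ ((σ : ℂ) + t * Complex.I) / ((σ : ℂ) + t * Complex.I) ^ 2
      = 2 * Real.pi * (max (Real.log x) 0 : ℝ) := by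
  set f : ℝ → ℂ := fun u => -(Real.log u • (Set.Ioc 0 1).indicator (fun _ => (1 : ℂ)) u) with hf
  have hre : ∀ t : ℝ, 0 < ((σ : ℂ) + t * Complex.I).re := fun t => by simpa using hσ
  have hmel : ∀ t : ℝ, mellin f ((σ : ℂ) + t * Complex.I) = 1 / ((σ : ℂ) + t * Complex.I) ^ 2 :=
    fun t => (mellin_neg_log_indicator (hre t)).2
  have hfpos : ∀ u : ℝ, 0 < u → f u = ((max (-Real.log u) 0 : ℝ) : ℂ) := by
    intro u hu
    simp only [hf]
    rcases le_or_gt u 1 with h | h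
    · rw [Set.indicator_of_mem (Set.mem_Ioc.2 ⟨hu, h⟩), max_eq_left (neg_nonneg.2 (Real.log_nonpos hu.le h))]
      simp
    · rw [Set.indicator_of_notMem fun hh => absurd hh.2 (not_le.2 h),
        max_eq_right (neg_nonpos.2 (Real.log_nonneg h.le))]
      simp
  have hx' : 0 < x⁻¹ := inv_pos.2 hx
  have hcont : ContinuousAt f x⁻¹ := by
    have h1 : ContinuousAt (fun u : ℝ => ((max (-Real.log u) 0 : ℝ) : ℂ)) x⁻¹ :=
      Complex.continuous_ofReal.continuousAt.comp
        (((Real.continuousAt_log hx'.ne').neg).max continuousAt_const)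
    refine h1.congr ?_
    filter_upwards [Ioi_mem_nhds hx'] with u hu
    exact (hfpos u hu).symm
  have hinv := mellinInv_mellin_eq σ f hx' (mellin_neg_log_indicator (by simpa using hσ)).1
    (by
      rw [Complex.VerticalIntegrable]
      simp only [hmel]
      exact integrable_inv_sq_vertical hσ) hcont
  rw [hfpos _ hx', Real.log_inv, neg_neg] at hinv
  rw [← hinv, mellinInv]
  simp only [hmel]
  have hpi : (Real.pi : ℂ) ≠ 0 := by exact_mod_cast Real.pi_ne_zero
  have e : ∀ t : ℝ, ((x⁻¹ : ℝ) : ℂ) ^ (-((σ : ℂ) + t * Complex.I))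
      • (1 / ((σ : ℂ) + t * Complex.I) ^ 2)
      = (x : ℂ) ^ ((σ : ℂ) + t * Complex.I) / ((σ : ℂ) + t * Complex.I) ^ 2 := by
    intro t
    rw [Complex.ofReal_inv, Complex.inv_cpow_ofReal_nonneg hx.le, ← Complex.cpow_neg, neg_neg, smul_eq_mul, mul_one_div]
  simp only [e]
  rw [Complex.real_smul]
  push_cast
  rw [← mul_assoc, mul_one_div_cancel (mul_ne_zero two_ne_zero hpi), one_mul]

/-- Perron's formula for Riesz sums, from the termwise formula and absolute convergence. -/
lemma integral_LSeries_mul_cpow_div_sq {b : ArithmeticFunction ℝ} {σ x : ℝ} (hσ : 0 < σ)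
    (hx : 0 < x) (hb : LSeriesSummable (fun n => toComplex b n) σ) :
    ∫ t : ℝ, LSeries (fun n => toComplex b n) ((σ : ℂ) + t * Complex.I)
        * (x : ℂ) ^ ((σ : ℂ) + t * Complex.I) / ((σ : ℂ) + t * Complex.I) ^ 2
      = 2 * Real.pi * (rieszSum b x : ℝ) := by
  set F : ℕ → ℝ → ℂ := fun n t => LSeries.term (fun n => toComplex b n) ((σ : ℂ) + t * Complex.I) n
    * (x : ℂ) ^ ((σ : ℂ) + t * Complex.I) / ((σ : ℂ) + t * Complex.I) ^ 2 with hF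
  have hre : ∀ t : ℝ, ((σ : ℂ) + t * Complex.I).re = σ := fun t => by simp
  have hF0 : ∀ t, F 0 t = 0 := fun t => by simp [hF]
  have hFn : ∀ n : ℕ, n ≠ 0 → ∀ t, F n t = (b n : ℂ) *
      (((x / n : ℝ) : ℂ) ^ ((σ : ℂ) + t * Complex.I) / ((σ : ℂ) + t * Complex.I) ^ 2) := by
    intro n hn t
    have hn0 : (n : ℝ) ≠ 0 := by exact_mod_cast hn
    have hnz : (n : ℂ) ^ ((σ : ℂ) + t * Complex.I) ≠ 0 := by
      rw [Ne, Complex.cpow_eq_zero_iff]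
      exact fun h => hn (by exact_mod_cast h.1)
    have e : (x : ℂ) ^ ((σ : ℂ) + t * Complex.I)
        = ((x / n : ℝ) : ℂ) ^ ((σ : ℂ) + t * Complex.I) * (n : ℂ) ^ ((σ : ℂ) + t * Complex.I) := by
      rw [← Complex.ofReal_natCast n, ← Complex.mul_cpow_ofReal_nonneg (by positivity)
        (by positivity), ← Complex.ofReal_mul, div_mul_cancel₀ _ hn0]
    simp only [hF]
    rw [LSeries.term_of_ne_zero hn, toComplex_apply, e]
    field_simp
  have hnorm : ∀ n t, ‖F n t‖ = ‖LSeries.term (fun n => toComplex b n) σ n‖ * x ^ σ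
      * ‖1 / ((σ : ℂ) + t * Complex.I) ^ 2‖ := by
    intro n t
    simp only [hF]
    rw [mul_div_assoc, norm_mul, norm_div, Complex.norm_cpow_eq_rpow_re_of_pos hx, hre,
      LSeries.norm_term_eq, LSeries.norm_term_eq, hre, Complex.ofReal_re, norm_div, norm_one]
    ring
  have hint : ∀ n, Integrable (F n) := by
    intro n
    rcases eq_or_ne n 0 with rfl | hn
    · simp [show F 0 = fun _ => 0 from funext hF0]
    · have hn0 : (0 : ℝ) < n := by exact_mod_cast Nat.pos_of_ne_zero hn
      refine ((integrable_inv_sq_vertical hσ).norm.const_mul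
        (‖LSeries.term (fun n => toComplex b n) σ n‖ * x ^ σ)).mono' ?_
        (Eventually.of_forall fun t => (hnorm n t).le)
      have hxn : ((x / n : ℝ) : ℂ) ≠ 0 := by
        have : x / n ≠ 0 := (div_pos hx hn0).ne'
        exact_mod_cast this
      refine Continuous.aestronglyMeasurable ?_
      rw [show F n = _ from funext (hFn n hn)]
      refine continuous_const.mul (Continuous.div ?_ (by fun_prop)
        fun t => pow_ne_zero 2 (vertical_ne_zero hσ.ne' t))
      exact Continuous.const_cpow (by fun_prop) (Or.inl hxn)
  have hsum : Summable fun n => ∫ t, ‖F n t‖ := by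
    simp only [hnorm, integral_const_mul]
    exact (hb.norm.mul_right _).mul_right _
  have h1 := hasSum_integral_of_summable_integral_norm hint hsum
  have htsum : ∀ t : ℝ, ∑' n, F n t = LSeries (fun n => toComplex b n) ((σ : ℂ) + t * Complex.I)
        * (x : ℂ) ^ ((σ : ℂ) + t * Complex.I) / ((σ : ℂ) + t * Complex.I) ^ 2 := by
    intro t
    simp only [hF, mul_div_assoc]
    rw [tsum_mul_right, LSeries]
  simp only [htsum] at h1
  have hval : ∀ n : ℕ, n ≠ 0 → ∫ t, F n t
      = b n * (2 * Real.pi * (max (Real.log (x / n)) 0 : ℝ)) := by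
    intro n hn
    have hn0 : (0 : ℝ) < n := by exact_mod_cast Nat.pos_of_ne_zero hn
    simp only [hFn n hn]
    rw [integral_const_mul, integral_cpow_div_sq_vertical hσ (div_pos hx hn0)]
  have h2 : HasSum (fun n => ∫ t, F n t) (∑ n ∈ Ioc 0 ⌊x⌋₊, ∫ t, F n t) := by
    refine hasSum_sum_of_ne_finset_zero fun n hn => ?_
    rcases eq_or_ne n 0 with rfl | hn0
    · simp [hF0]
    · have hnx : x < n := by
        by_contra! h
        exact hn (mem_Ioc.2 ⟨Nat.pos_of_ne_zero hn0, Nat.le_floor h⟩)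
      have hnpos : (0 : ℝ) < n := hx.trans hnx
      rw [hval n hn0, max_eq_right (Real.log_nonpos (by positivity)
        ((div_le_one hnpos).2 hnx.le))]
      simp
  rw [h1.unique h2, rieszSum, Complex.ofReal_sum, mul_sum]
  refine sum_congr rfl fun n hn => ?_
  rw [mem_Ioc] at hn
  have hn0 : (0 : ℝ) < n := by exact_mod_cast hn.1
  have hnx : (n : ℝ) ≤ x := (Nat.le_floor_iff hx.le).1 hn.2
  rw [hval n (by omega), max_eq_left (Real.log_nonneg ((one_le_div hn0).2 hnx))]
  push_cast
  ring

lemma integral_zetaKernel_mul_cpow {x : ℝ} (hx : 0 < x) :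
    ∫ t : ℝ, zetaKernel ((3 / 2 : ℝ) + t * Complex.I) * (x : ℂ) ^ (((3 / 2 : ℝ) : ℂ) + t * Complex.I)
      = 2 * Real.pi * (rieszSum baseCoeff x : ℝ) := by
  rw [← integral_LSeries_mul_cpow_div_sq (σ := 3 / 2) (by norm_num) hx
    (LSeriesSummable_baseCoeff (by simp; norm_num))]
  refine integral_congr_ae (Eventually.of_forall fun t => ?_)
  simp only
  rw [LSeries_baseCoeff (by simp; norm_num), zetaKernel]
  ring

end Perron

end SubgroupCount

namespace SubgroupCount

open Finset MeasureTheory Filter Topology ArithmeticFunction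
open scoped ArithmeticFunction.zeta

/-! ### Taylor series as formal power series -/

noncomputable section Taylor

/-- The Taylor series of `f` at `z₀` as a formal power series. -/
def taylor (f : ℂ → ℂ) (z₀ : ℂ) : PowerSeries ℂ :=
  PowerSeries.mk fun n => iteratedDeriv n f z₀ / (n.factorial : ℂ)

lemma coeff_taylor (f : ℂ → ℂ) (z₀ : ℂ) (n : ℕ) :
    PowerSeries.coeff n (taylor f z₀) = iteratedDeriv n f z₀ / (n.factorial : ℂ) :=
  PowerSeries.coeff_mk _ _

lemma taylor_congr {f g : ℂ → ℂ} {z₀ : ℂ} (h : f =ᶠ[𝓝 z₀] g) : taylor f z₀ = taylor g z₀ := by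
  ext n
  rw [coeff_taylor, coeff_taylor, h.iteratedDeriv_eq]

lemma taylor_mul {f g : ℂ → ℂ} {z₀ : ℂ} (hf : AnalyticAt ℂ f z₀) (hg : AnalyticAt ℂ g z₀) :
    taylor (fun z => f z * g z) z₀ = taylor f z₀ * taylor g z₀ := by
  ext n
  have h := iteratedDeriv_mul (n := n) hf.contDiffAt hg.contDiffAt
  rw [coeff_taylor, PowerSeries.coeff_mul, Nat.sum_antidiagonal_eq_sum_range_succ
    (fun i j => PowerSeries.coeff i (taylor f z₀) * PowerSeries.coeff j (taylor g z₀))]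
  change iteratedDeriv n (f * g) z₀ / _ = _
  rw [h, sum_div]
  refine sum_congr rfl fun i hi => ?_
  have hi : i ≤ n := Nat.lt_succ_iff.1 (mem_range.1 hi)
  have h0 : (n.factorial : ℂ) ≠ 0 := by exact_mod_cast n.factorial_ne_zero
  rw [Nat.cast_choose ℂ hi, coeff_taylor, coeff_taylor]
  field_simp

lemma taylor_pow {f : ℂ → ℂ} {z₀ : ℂ} (hf : AnalyticAt ℂ f z₀) (k : ℕ) :
    taylor (fun z => f z ^ k) z₀ = taylor f z₀ ^ k := by
  induction k with
  | zero =>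
    ext n
    simp only [pow_zero]
    rw [coeff_taylor, iteratedDeriv_const, PowerSeries.coeff_one]
    split_ifs with h <;> simp [h]
  | succ k ih =>
    simp only [pow_succ]
    rw [taylor_mul (f := fun z => f z ^ k) (hf.pow k) hf, ih]

lemma taylor_const (c z₀ : ℂ) : taylor (fun _ => c) z₀ = PowerSeries.C c := by
  ext n
  rw [coeff_taylor, iteratedDeriv_const, PowerSeries.coeff_C]
  split_ifs with h <;> simp [h]

lemma taylor_id_one : taylor (fun z => z) 1 = 1 + PowerSeries.X := by
  ext n
  change PowerSeries.coeff n (taylor id 1) = _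
  rw [coeff_taylor, iteratedDeriv_id, map_add, PowerSeries.coeff_one, PowerSeries.coeff_X]
  rcases n with _ | _ | n <;> simp

lemma taylor_comp_two_mul_sub_one {f : ℂ → ℂ} (hf : Differentiable ℂ f) :
    taylor (fun z => f (2 * z - 1)) 1 = PowerSeries.rescale 2 (taylor f 1) := by
  ext n
  have h1 : ContDiff ℂ n fun w : ℂ => f (w - 1) := by
    have := hf.contDiff (n := n)
    fun_prop
  have h2 := congrFun (iteratedDeriv_comp_const_mul h1 2) 1
  have h3 := congrFun (iteratedDeriv_comp_sub_const n f 1) (2 * 1)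
  rw [coeff_taylor, h2, h3, PowerSeries.coeff_rescale, coeff_taylor]
  norm_num
  ring

lemma taylor_cpow {x : ℝ} (hx : 0 < x) :
    taylor (fun z : ℂ => (x : ℂ) ^ z) 1
      = PowerSeries.C (x : ℂ) * PowerSeries.rescale (Real.log x : ℂ) (PowerSeries.exp ℂ) := by
  have hx0 : (x : ℂ) ≠ 0 := by exact_mod_cast hx.ne'
  have e : (fun z : ℂ => (x : ℂ) ^ z) = fun z => Complex.exp ((Real.log x : ℂ) * z) := by
    ext z
    rw [Complex.cpow_def_of_ne_zero hx0, Complex.ofReal_log hx.le]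
  ext n
  rw [coeff_taylor, e, iteratedDeriv_cexp_const_mul, PowerSeries.coeff_C_mul,
    PowerSeries.coeff_rescale, PowerSeries.coeff_exp]
  simp only [mul_one, Complex.ofReal_log hx.le, Complex.exp_log hx0, map_div₀, map_one, map_natCast]
  ring

/-- The iterated slopes at the centre are the Taylor coefficients. -/
lemma iterate_dslope_eq_coeff_taylor {g : ℂ → ℂ} {z₀ : ℂ} (hg : AnalyticAt ℂ g z₀) (n : ℕ) :
    ((Function.swap dslope z₀)^[n] g) z₀ = PowerSeries.coeff n (taylor g z₀) := by
  have h := (hg.hasFPowerSeriesAt.has_fpower_series_iterate_dslope_fslope n)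
  have h0 := h.coeff_zero 1
  rw [← h0]
  change (FormalMultilinearSeries.fslope^[n] _).coeff 0 = _
  rw [FormalMultilinearSeries.coeff_iterate_fslope, zero_add,
    FormalMultilinearSeries.coeff_ofScalars, coeff_taylor]

lemma iteratedDeriv_conj_symm {f : ℂ → ℂ}
    (hf : ∀ z, f ((starRingEnd ℂ) z) = (starRingEnd ℂ) (f z)) (n : ℕ) (z : ℂ) :
    iteratedDeriv n f ((starRingEnd ℂ) z) = (starRingEnd ℂ) (iteratedDeriv n f z) := by
  induction n generalizing z with
  | zero => simpa using hf z
  | succ n ih =>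
    have e : (starRingEnd ℂ) ∘ iteratedDeriv n f ∘ (starRingEnd ℂ) = iteratedDeriv n f := by
      ext w
      simp [ih w]
    have h := congrFun (deriv_conj_conj (𝕜 := ℂ) (f := iteratedDeriv n f)) ((starRingEnd ℂ) z)
    rw [e] at h
    rw [iteratedDeriv_succ, h]
    simp

/-- Derivatives at real points of functions that commute with conjugation are real. -/
lemma iteratedDeriv_eq_ofReal_re {f : ℂ → ℂ}
    (hf : ∀ z, f ((starRingEnd ℂ) z) = (starRingEnd ℂ) (f z)) (n : ℕ) (x : ℝ) :
    iteratedDeriv n f x = ((iteratedDeriv n f x).re : ℂ) := by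
  have h := iteratedDeriv_conj_symm hf n x
  rw [Complex.conj_ofReal] at h
  exact (Complex.conj_eq_iff_re.1 h.symm).symm

lemma zetaRegularPart_eq : zetaRegularPart = riemannZeta₀ := by
  ext z
  rw [zetaRegularPart, riemannZeta₀, Function.update_apply, one_div]

lemma riemannZeta₀_conj (z : ℂ) :
    riemannZeta₀ ((starRingEnd ℂ) z) = (starRingEnd ℂ) (riemannZeta₀ z) := by
  unfold riemannZeta₀
  by_cases h : z = 1
  · simp [h]
  · have h' : (starRingEnd ℂ) z ≠ 1 := fun hh => h (by
      have := congrArg (starRingEnd ℂ) hh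
      simpa using this)
    rw [if_neg h, if_neg h', riemannZeta_conj]
    simp

lemma taylor_riemannZeta₁ : taylor riemannZeta₁ 1 = PowerSeries.map Complex.ofRealHom seriesA := by
  have han : AnalyticAt ℂ riemannZeta₀ 1 := differentiable_riemannZeta₀.analyticAt 1
  have h0 : taylor riemannZeta₀ 1 = PowerSeries.map Complex.ofRealHom
      (PowerSeries.mk fun n => (-1) ^ n * stieltjes n / (n.factorial : ℝ)) := by
    ext n
    rw [coeff_taylor, PowerSeries.coeff_map, PowerSeries.coeff_mk, stieltjes, zetaRegularPart_eq,
      ← mul_assoc, ← mul_pow]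
    have := iteratedDeriv_eq_ofReal_re riemannZeta₀_conj n 1
    rw [Complex.ofReal_one] at this
    rw [this]
    simp
  have h1 : taylor (fun z => z - 1) 1 = PowerSeries.X := by
    ext n
    have h := congrFun (iteratedDeriv_comp_sub_const n (fun z : ℂ => z) 1) 1
    simp only [sub_self] at h
    rw [coeff_taylor, h, PowerSeries.coeff_X]
    change iteratedDeriv n id 0 / _ = _
    rw [iteratedDeriv_id]
    rcases n with _ | _ | n <;> simp
  have h2 : taylor (fun z => (z - 1) * riemannZeta₀ z) 1
      = PowerSeries.X * taylor riemannZeta₀ 1 := by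
    rw [taylor_mul (by fun_prop) han, h1]
  have h3 : taylor riemannZeta₁ 1 = 1 + taylor (fun z => (z - 1) * riemannZeta₀ z) 1 := by
    ext n
    have hadd : iteratedDeriv n (fun z : ℂ => 1 + (z - 1) * riemannZeta₀ z) 1
        = iteratedDeriv n (fun _ : ℂ => (1 : ℂ)) 1
          + iteratedDeriv n (fun z => (z - 1) * riemannZeta₀ z) 1 := by
      refine iteratedDeriv_fun_add contDiffAt_const ?_
      have : AnalyticAt ℂ (fun z => (z - 1) * riemannZeta₀ z) 1 := by fun_prop
      exact this.contDiffAt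
    have hc := congrArg (PowerSeries.coeff n) (taylor_const 1 1)
    rw [coeff_taylor, map_one] at hc
    rw [map_add, coeff_taylor, coeff_taylor]
    change iteratedDeriv n (fun z : ℂ => 1 + (z - 1) * riemannZeta₀ z) 1 / _ = _
    rw [hadd, add_div, hc]
  rw [h3, h2, h0, seriesA]
  simp

lemma map_rescale (a : ℝ) (F : PowerSeries ℝ) :
    PowerSeries.map Complex.ofRealHom (PowerSeries.rescale a F)
      = PowerSeries.rescale (a : ℂ) (PowerSeries.map Complex.ofRealHom F) := by
  ext n
  simp

lemma constantCoeff_one_add_X_sq :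
    PowerSeries.constantCoeff ((1 + PowerSeries.X) ^ 2 : PowerSeries ℝ) = 1 := by
  simp

lemma taylor_zetaKernelNum :
    taylor zetaKernelNum 1 = PowerSeries.map Complex.ofRealHom (seriesH 0) := by
  have h1 : AnalyticAt ℂ riemannZeta₁ 1 := differentiable_riemannZeta₁.analyticAt 1
  have h2 : AnalyticAt ℂ (fun z => riemannZeta₁ (2 * z - 1)) 1 := by
    have : Differentiable ℂ fun z : ℂ => riemannZeta₁ (2 * z - 1) :=
      differentiable_riemannZeta₁.comp (by fun_prop)
    exact this.analyticAt 1
  have hN : AnalyticAt ℂ zetaKernelNum 1 := by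
    unfold zetaKernelNum
    exact ((h1.pow 4).mul h2).div (by fun_prop) (by norm_num)
  have hprod : taylor zetaKernelNum 1 * (PowerSeries.C 2 * (1 + PowerSeries.X) ^ 2)
      = taylor riemannZeta₁ 1 ^ 4 * PowerSeries.rescale 2 (taylor riemannZeta₁ 1) := by
    rw [← taylor_comp_two_mul_sub_one differentiable_riemannZeta₁, ← taylor_pow h1,
      ← taylor_mul (f := fun z => riemannZeta₁ z ^ 4) (h1.pow 4) h2, ← taylor_id_one, ← taylor_pow (by fun_prop), ← taylor_const 2 1,
      ← taylor_mul (by fun_prop) (by fun_prop), ← taylor_mul hN (by fun_prop)]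
    refine taylor_congr ?_
    filter_upwards [isOpen_ne.mem_nhds (one_ne_zero : (1 : ℂ) ≠ 0)] with z hz
    have hz : z ≠ 0 := hz
    rw [zetaKernelNum]
    field_simp
  have hreal : seriesH 0 * (PowerSeries.C 2 * (1 + PowerSeries.X) ^ 2)
      = seriesA ^ 4 * PowerSeries.rescale 2 seriesA := by
    have hinv := PowerSeries.mul_inv_cancel ((1 + PowerSeries.X) ^ 2 : PowerSeries ℝ)
      (by rw [constantCoeff_one_add_X_sq]; norm_num)
    have hC : (PowerSeries.C (1 / 2 : ℝ) * PowerSeries.C 2 : PowerSeries ℝ) = 1 := by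
      rw [← map_mul]; norm_num
    rw [seriesH, pow_zero, one_mul]
    linear_combination (seriesA ^ 4 * PowerSeries.rescale 2 seriesA) * hC
      + (seriesA ^ 4 * (PowerSeries.C (1 / 2 : ℝ) * PowerSeries.rescale 2 seriesA)
        * PowerSeries.C 2) * hinv
  have hmap := congrArg (PowerSeries.map Complex.ofRealHom) hreal
  simp only [map_mul, map_pow, map_add, map_one, PowerSeries.map_C, PowerSeries.map_X,
    map_rescale] at hmap
  rw [← taylor_riemannZeta₁] at hmap
  have e2 : Complex.ofRealHom 2 = 2 := by simp
  have e2' : ((2 : ℝ) : ℂ) = 2 := by simp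
  rw [e2, e2', ← hprod] at hmap
  refine (mul_right_cancel₀ ?_ hmap).symm
  intro h
  have := congrArg PowerSeries.constantCoeff h
  simp at this

/-- The coefficient of `t⁴` in `e^{ut} H(t)`, as a function of `u`. -/
def residueCoeff (H : PowerSeries ℝ) (u : ℝ) : ℝ :=
  PowerSeries.coeff 4 (PowerSeries.rescale u (PowerSeries.exp ℝ) * H)

lemma residueCoeff_eq_sum (H : PowerSeries ℝ) (u : ℝ) :
    residueCoeff H u
      = ∑ k ∈ range 5, u ^ k / (k.factorial : ℝ) * PowerSeries.coeff (4 - k) H := by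
  rw [residueCoeff, PowerSeries.coeff_mul, Nat.sum_antidiagonal_eq_sum_range_succ
    (fun i j => PowerSeries.coeff i (PowerSeries.rescale u (PowerSeries.exp ℝ))
      * PowerSeries.coeff j H)]
  refine sum_congr rfl fun k _ => ?_
  rw [PowerSeries.coeff_rescale, PowerSeries.coeff_exp, map_div₀, map_one, map_natCast]
  ring

lemma eval_mainPoly (j : ℕ) (u : ℝ) : (mainPoly j).eval u = residueCoeff (seriesH j) u := by
  rw [residueCoeff_eq_sum, mainPoly, Polynomial.eval_finsetSum]
  refine sum_congr rfl fun k _ => ?_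
  rw [Polynomial.eval_monomial]
  ring

lemma coeff_taylor_zetaKernelNum_mul_cpow {x : ℝ} (hx : 0 < x) :
    PowerSeries.coeff 4 (taylor (fun z : ℂ => zetaKernelNum z * (x : ℂ) ^ z) 1)
      = ((x * residueCoeff (seriesH 0) (Real.log x) : ℝ) : ℂ) := by
  have hN : AnalyticAt ℂ zetaKernelNum 1 := by
    have : DifferentiableOn ℂ zetaKernelNum {0}ᶜ := fun z hz =>
      (differentiableAt_zetaKernelNum hz).differentiableWithinAt
    exact this.analyticAt (isOpen_compl_singleton.mem_nhds (by simp))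
  have hx0 : (x : ℂ) ≠ 0 := by exact_mod_cast hx.ne'
  have hp : AnalyticAt ℂ (fun z : ℂ => (x : ℂ) ^ z) 1 := by
    have : Differentiable ℂ fun z : ℂ => (x : ℂ) ^ z := fun z =>
      differentiableAt_id.const_cpow (Or.inl hx0)
    exact this.analyticAt 1
  have e : taylor zetaKernelNum 1 * (PowerSeries.C (x : ℂ)
      * PowerSeries.rescale (Real.log x : ℂ) (PowerSeries.exp ℂ))
      = PowerSeries.map Complex.ofRealHom (PowerSeries.C x *
        (PowerSeries.rescale (Real.log x) (PowerSeries.exp ℝ) * seriesH 0)) := by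
    rw [map_mul, map_mul, map_rescale, taylor_zetaKernelNum, PowerSeries.map_C,
      PowerSeries.map_exp]
    simp only [Complex.ofRealHom_eq_coe]
    ring
  rw [taylor_mul hN hp, taylor_cpow hx, e, PowerSeries.coeff_map, PowerSeries.coeff_C_mul]
  rfl

end Taylor

/-! ### The asymptotic formula before the Möbius inversion -/

noncomputable section BaseAsymptotics

lemma integrable_zetaKernel_mul_cpow {σ x : ℝ} (hx : 0 < x) (h0 : σ ≠ 0) (h1 : σ ≠ 1)
    (h : Integrable fun t : ℝ => zetaKernel (σ + t * Complex.I)) :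
    Integrable fun t : ℝ => zetaKernel (σ + t * Complex.I) * (x : ℂ) ^ ((σ : ℂ) + t * Complex.I) := by
  have hx0 : (x : ℂ) ≠ 0 := by exact_mod_cast hx.ne'
  refine (h.norm.mul_const (x ^ σ)).mono' ?_ (Eventually.of_forall fun t => ?_)
  · refine Continuous.aestronglyMeasurable ((continuous_zetaKernel_vertical h0 h1).mul ?_)
    exact Continuous.const_cpow (by fun_prop) (Or.inl hx0)
  · rw [norm_mul, Complex.norm_cpow_eq_rpow_re_of_pos hx]
    simp

/-- The contour is moved from `Re z = 3/2` to `Re z = 0.49`; the fourth moment estimate is what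
makes the integral on the new line converge. -/
lemma abs_rieszSum_baseCoeff_sub_le :
    ∃ K : ℝ, ∀ x : ℝ, 1 ≤ x →
      |rieszSum baseCoeff x - x * residueCoeff (seriesH 0) (Real.log x)| ≤ K * x ^ (0.49 : ℝ) := by
  obtain ⟨C, hC, hhor⟩ := norm_zetaKernel_le_of_one_le_abs_im
  refine ⟨(∫ t : ℝ, ‖zetaKernel ((0.49 : ℝ) + t * Complex.I)‖) / (2 * Real.pi), fun x hx => ?_⟩
  have hx0 : 0 < x := by linarith
  have hxc : (x : ℂ) ≠ 0 := by exact_mod_cast hx0.ne'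
  set g : ℂ → ℂ := fun z => zetaKernelNum z * (x : ℂ) ^ z with hg
  have hgdiff : DifferentiableOn ℂ g {z | 0 < z.re} := by
    intro z hz
    have hz0 : z ≠ 0 := fun h => by simp [h] at hz
    exact ((differentiableAt_zetaKernelNum hz0).mul
      (differentiableAt_id.const_cpow (Or.inl hxc))).differentiableWithinAt
  have hgdiv : ∀ z : ℂ, z ≠ 1 → g z / (z - 1) ^ 5 = zetaKernel z * (x : ℂ) ^ z := by
    intro z hz
    rw [zetaKernel_eq_div hz]
    simp only [hg]
    ring
  have hline : ∀ σ : ℝ, σ ≠ 1 → ∀ t : ℝ, g (σ + t * Complex.I) / ((σ + t * Complex.I : ℂ) - 1) ^ 5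
      = zetaKernel (σ + t * Complex.I) * (x : ℂ) ^ ((σ : ℂ) + t * Complex.I) := by
    intro σ hσ t
    refine hgdiv _ fun h => hσ ?_
    have := congrArg Complex.re h
    simpa using this
  have hL := hline 0.49 (by norm_num)
  have hR := hline (3 / 2) (by norm_num)
  have hshift := integral_vertical_sub_integral_vertical (g := g) (a := 0.49) (b := 3 / 2)
    (by norm_num) (by norm_num) (by norm_num) hgdiff
    (by
      simp only [hL]
      exact integrable_zetaKernel_mul_cpow hx0 (by norm_num) (by norm_num)
        integrable_zetaKernel_left_edge)
    (by
      simp only [hR]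
      exact integrable_zetaKernel_mul_cpow hx0 (by norm_num) (by norm_num)
        integrable_zetaKernel_right_edge)
    (C := C * x ^ (3 / 2 : ℝ)) (δ := 0.41) (by norm_num) (by
      intro z hz1 hz2 him
      have hz : z ≠ 1 := by
        rintro rfl
        norm_num at him
      rw [hgdiv z hz, norm_mul, Complex.norm_cpow_eq_rpow_re_of_pos hx0]
      calc ‖zetaKernel z‖ * x ^ z.re ≤ C * |z.im| ^ (-0.41 : ℝ) * x ^ (3 / 2 : ℝ) := by
            have := hhor z hz1 hz2 him
            gcongr
        _ = _ := by ring)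
  have han : AnalyticAt ℂ g 1 := hgdiff.analyticAt
    ((isOpen_lt continuous_const Complex.continuous_re).mem_nhds (by simp))
  simp only [hL, hR] at hshift
  rw [integral_zetaKernel_mul_cpow hx0, iterate_dslope_eq_coeff_taylor han,
    coeff_taylor_zetaKernelNum_mul_cpow hx0] at hshift
  set J : ℂ := ∫ t : ℝ, zetaKernel ((0.49 : ℝ) + t * Complex.I)
    * (x : ℂ) ^ (((0.49 : ℝ) : ℂ) + t * Complex.I) with hJ
  have hJn : ‖J‖ ≤ (∫ t : ℝ, ‖zetaKernel ((0.49 : ℝ) + t * Complex.I)‖) * x ^ (0.49 : ℝ) := by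
    rw [← integral_mul_const]
    refine (norm_integral_le_integral_norm _).trans (le_of_eq ?_)
    refine integral_congr_ae (Eventually.of_forall fun t => ?_)
    simp only
    rw [norm_mul, Complex.norm_cpow_eq_rpow_re_of_pos hx0]
    simp
  have hJeq : J = ((2 * Real.pi * (rieszSum baseCoeff x
      - x * residueCoeff (seriesH 0) (Real.log x)) : ℝ) : ℂ) := by
    push_cast
    push_cast at hshift
    linear_combination -hshift
  rw [hJeq, Complex.norm_real, Real.norm_eq_abs, abs_mul, abs_of_pos Real.two_pi_pos] at hJn
  rw [div_mul_eq_mul_div, le_div_iff₀ Real.two_pi_pos, mul_comm]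
  exact hJn

end BaseAsymptotics

end SubgroupCount

namespace SubgroupCount

open Finset Filter Topology ArithmeticFunction
open scoped ArithmeticFunction.Moebius

/-! ### The Dirichlet series of the Möbius function at `2` -/

noncomputable section MoebiusSeries

/-- The expansion of `∑ μ(m) m^{-(2+2t)} = 1 / ζ(2+2t)` at `t = 0`. -/
def moebiusSeries : PowerSeries ℝ :=
  PowerSeries.mk fun k =>
    ∑' m : ℕ, moebiusR m / (m : ℝ) ^ 2 * ((-2 * Real.log m) ^ k / (k.factorial : ℝ))

lemma moebiusR_apply (m : ℕ) : moebiusR m = ((μ m : ℤ) : ℝ) := by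
  rw [intCoe_apply]

lemma abs_moebiusR_le_one (m : ℕ) : |moebiusR m| ≤ 1 := by
  rw [moebiusR_apply]
  exact_mod_cast abs_moebius_le_one

lemma iterate_logMul (k n : ℕ) :
    LSeries.logMul^[k] (fun n => ((μ n : ℤ) : ℂ)) n = Complex.log n ^ k * ((μ n : ℤ) : ℂ) := by
  induction k with
  | zero => simp
  | succ k ih =>
    rw [Function.iterate_succ_apply']
    change Complex.log n * _ = _
    rw [ih, pow_succ]
    ring

lemma abscissaOfAbsConv_moebius_lt : LSeries.abscissaOfAbsConv (fun n => ((μ n : ℤ) : ℂ))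
    < ((2 : ℂ).re : EReal) := by
  rw [abscissaOfAbsConv_moebius]
  norm_num
  exact_mod_cast (by norm_num : (1 : ℝ) < 2)

lemma term_logMul_moebius (k m : ℕ) :
    LSeries.term (LSeries.logMul^[k] (fun n => ((μ n : ℤ) : ℂ))) 2 m
      = ((Real.log m ^ k * (moebiusR m / (m : ℝ) ^ 2) : ℝ) : ℂ) := by
  rcases eq_or_ne m 0 with rfl | hm
  · simp
  · rw [LSeries.term_of_ne_zero hm, iterate_logMul, moebiusR_apply, ← Complex.natCast_log]
    have e : (m : ℂ) ^ (2 : ℂ) = (m : ℂ) ^ 2 := by exact_mod_cast Complex.cpow_natCast (m : ℂ) 2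
    rw [e]
    push_cast
    ring

lemma summable_log_pow_mul_moebius (k : ℕ) :
    Summable fun m : ℕ => Real.log m ^ k * (moebiusR m / (m : ℝ) ^ 2) := by
  have h : LSeriesSummable (LSeries.logMul^[k] (fun n => ((μ n : ℤ) : ℂ))) 2 := by
    apply LSeriesSummable_of_abscissaOfAbsConv_lt_re
    rw [LSeries.absicssaOfAbsConv_logPowMul]
    exact abscissaOfAbsConv_moebius_lt
  have h2 : Summable fun m : ℕ => ((Real.log m ^ k * (moebiusR m / (m : ℝ) ^ 2) : ℝ) : ℂ) :=
    h.congr fun m => term_logMul_moebius k m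
  exact Complex.summable_ofReal.1 h2

lemma hasSum_moebiusSeries (k : ℕ) :
    HasSum (fun m : ℕ => moebiusR m / (m : ℝ) ^ 2 * ((-2 * Real.log m) ^ k / (k.factorial : ℝ)))
      (PowerSeries.coeff k moebiusSeries) := by
  rw [moebiusSeries, PowerSeries.coeff_mk]
  refine Summable.hasSum (((summable_log_pow_mul_moebius k).mul_left
    ((-2) ^ k / (k.factorial : ℝ))).congr fun m => ?_)
  rw [mul_pow]
  ring

lemma map_moebiusSeries : PowerSeries.map Complex.ofRealHom moebiusSeries
    = PowerSeries.rescale 2 (taylor (LSeries fun n => ((μ n : ℤ) : ℂ)) 2) := by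
  ext k
  rw [PowerSeries.coeff_map, PowerSeries.coeff_rescale, coeff_taylor,
    LSeries_iteratedDeriv k abscissaOfAbsConv_moebius_lt, LSeries,
    tsum_congr (term_logMul_moebius k), ← Complex.ofReal_tsum, moebiusSeries,
    PowerSeries.coeff_mk]
  have e : ∀ m : ℕ, moebiusR m / (m : ℝ) ^ 2 * ((-2 * Real.log m) ^ k / (k.factorial : ℝ))
      = (-2) ^ k / (k.factorial : ℝ) * (Real.log m ^ k * (moebiusR m / (m : ℝ) ^ 2)) := by
    intro m
    rw [mul_pow]
    ring
  rw [tsum_congr e, tsum_mul_left, Complex.ofRealHom_eq_coe, neg_pow]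
  push_cast
  ring

lemma map_seriesZ : PowerSeries.map Complex.ofRealHom seriesZ
    = PowerSeries.rescale 2 (taylor riemannZeta 2) := by
  ext k
  have h := iteratedDeriv_eq_ofReal_re riemannZeta_conj k 2
  rw [Complex.ofReal_ofNat] at h
  rw [PowerSeries.coeff_map, PowerSeries.coeff_rescale, coeff_taylor, h, seriesZ,
    PowerSeries.coeff_mk, zetaDerivTwo]
  simp
  ring

lemma moebiusSeries_mul_seriesZ : moebiusSeries * seriesZ = 1 := by
  have hinj : Function.Injective (PowerSeries.map Complex.ofRealHom) :=
    PowerSeries.map_injective _ Complex.ofReal_injective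
  apply hinj
  have hζ : AnalyticAt ℂ riemannZeta 2 := by
    have : DifferentiableOn ℂ riemannZeta {1}ᶜ := fun z hz =>
      (differentiableAt_riemannZeta hz).differentiableWithinAt
    exact this.analyticAt (isOpen_compl_singleton.mem_nhds (by simp))
  have hμ : AnalyticAt ℂ (LSeries fun n => ((μ n : ℤ) : ℂ)) 2 :=
    LSeries_analyticOnNhd _ 2 abscissaOfAbsConv_moebius_lt
  rw [map_mul, map_one, map_moebiusSeries, map_seriesZ, ← map_mul, ← taylor_mul hμ hζ]
  have hone : (fun z => LSeries (fun n => ((μ n : ℤ) : ℂ)) z * riemannZeta z)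
      =ᶠ[𝓝 2] fun _ => 1 := by
    filter_upwards [(isOpen_lt continuous_const Complex.continuous_re).mem_nhds
      (show (1 : ℝ) < (2 : ℂ).re by norm_num)] with z hz
    have hz : 1 < z.re := hz
    rw [← LSeries_zeta_eq_riemannZeta hz, mul_comm]
    exact LSeries_zeta_mul_Lseries_moebius hz
  rw [taylor_congr hone, taylor_const, map_one, map_one]

lemma constantCoeff_seriesZ_ne_zero : PowerSeries.constantCoeff seriesZ ≠ 0 := by
  intro h
  have := congrArg PowerSeries.constantCoeff moebiusSeries_mul_seriesZ
  rw [map_mul, h, mul_zero, map_one] at this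
  exact zero_ne_one this

/-- Inserting one more factor `1 / ζ(2z)` multiplies the main-term series by `1 / Z(t)`. -/
lemma seriesH_succ (j : ℕ) : seriesH (j + 1) = seriesH j * moebiusSeries := by
  have h : moebiusSeries = seriesZ⁻¹ :=
    (PowerSeries.eq_inv_iff_mul_eq_one constantCoeff_seriesZ_ne_zero).2 moebiusSeries_mul_seriesZ
  rw [seriesH, seriesH, h, pow_succ seriesZ, mul_right_comm (seriesZ ^ j),
    PowerSeries.mul_inv_rev _ seriesZ]
  ring

lemma natDegree_mainPoly (j : ℕ) : (mainPoly j).natDegree = 4 := by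
  refine Polynomial.natDegree_eq_of_le_of_coeff_ne_zero ?_ ?_
  · refine Polynomial.natDegree_sum_le_of_forall_le _ _ fun k hk => ?_
    exact (Polynomial.natDegree_monomial_le _).trans (by have := mem_range.1 hk; omega)
  · have hA : PowerSeries.constantCoeff seriesA = 1 := by simp [seriesA]
    have e : (mainPoly j).coeff 4 = PowerSeries.coeff 0 (seriesH j) / 24 := by
      rw [mainPoly, Polynomial.finsetSum_coeff, sum_eq_single 4]
      · rw [Polynomial.coeff_monomial, if_pos rfl]
        norm_num [Nat.factorial]
      · intro k _ hk
        rw [Polynomial.coeff_monomial, if_neg hk]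
      · intro h
        simp at h
    rw [e, PowerSeries.coeff_zero_eq_constantCoeff_apply, seriesH, map_mul, map_mul, map_mul,
      map_pow, PowerSeries.constantCoeff_inv, map_mul, map_pow, constantCoeff_one_add_X_sq, hA,
      ← PowerSeries.coeff_zero_eq_constantCoeff_apply (PowerSeries.rescale 2 seriesA),
      PowerSeries.coeff_rescale, PowerSeries.coeff_zero_eq_constantCoeff_apply, hA]
    have := pow_ne_zero j constantCoeff_seriesZ_ne_zero
    simp [this]

lemma residueCoeff_add (H : PowerSeries ℝ) (u v : ℝ) :
    residueCoeff H (u + v)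
      = residueCoeff (PowerSeries.rescale u (PowerSeries.exp ℝ) * H) v := by
  rw [residueCoeff, residueCoeff, ← PowerSeries.exp_mul_exp_eq_exp_add]
  congr 1
  ring

/-- Summing the main terms at `x / m ^ 2` against `μ(m)` amounts to multiplying the power series
by `∑ μ(m) m⁻² e^{-2 t log m}`, the Taylor series of `1 / ζ(2 + 2t)`. -/
lemma hasSum_moebius_mul_residueCoeff (H : PowerSeries ℝ) (u : ℝ) :
    HasSum (fun m : ℕ => moebiusR m / (m : ℝ) ^ 2 * residueCoeff H (u + -2 * Real.log m))
      (residueCoeff (H * moebiusSeries) u) := by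
  set F : PowerSeries ℝ := PowerSeries.rescale u (PowerSeries.exp ℝ) * H with hF
  have e : residueCoeff (H * moebiusSeries) u
      = ∑ k ∈ range 5, PowerSeries.coeff k moebiusSeries * PowerSeries.coeff (4 - k) F := by
    rw [residueCoeff, ← mul_assoc, ← hF, mul_comm, PowerSeries.coeff_mul,
      Nat.sum_antidiagonal_eq_sum_range_succ
        (fun i j => PowerSeries.coeff i moebiusSeries * PowerSeries.coeff j F)]
  rw [e]
  have h := hasSum_sum fun k (_ : k ∈ range 5) =>
    (hasSum_moebiusSeries k).mul_right (PowerSeries.coeff (4 - k) F)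
  refine h.congr_fun fun m => ?_
  rw [residueCoeff_add, residueCoeff_eq_sum, mul_sum]
  exact sum_congr rfl fun k _ => by ring

end MoebiusSeries

/-! ### Inserting the Möbius factor into an asymptotic formula -/

noncomputable section MoebiusStep

lemma abs_mul_residueCoeff_le (H : PowerSeries ℝ) :
    ∃ D : ℝ, 0 ≤ D ∧ ∀ y : ℝ, 0 < y → y ≤ 1 →
      |y * residueCoeff H (Real.log y)| ≤ D * y ^ (3 / 4 : ℝ) := by
  refine ⟨∑ k ∈ range 5, (16 : ℝ) ^ k / (k.factorial : ℝ) * |PowerSeries.coeff (4 - k) H|,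
    sum_nonneg fun _ _ => by positivity, fun y hy hy1 => ?_⟩
  have hlog : |Real.log y| * y ^ (1 / 16 : ℝ) ≤ 16 := by
    have h := Real.abs_log_mul_self_rpow_lt y (1 / 16) hy hy1 (by norm_num)
    rw [abs_mul, abs_of_pos (Real.rpow_pos_of_pos hy _)] at h
    norm_num at h ⊢
    exact h.le
  have hpow : ∀ k ∈ range 5, |Real.log y| ^ k * y ^ (1 / 4 : ℝ) ≤ 16 ^ k := by
    intro k hk
    have hk : (k : ℝ) ≤ 4 := by exact_mod_cast Nat.lt_succ_iff.1 (mem_range.1 hk)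
    have h1 : y ^ (1 / 4 : ℝ) ≤ (y ^ (1 / 16 : ℝ)) ^ k := by
      rw [← Real.rpow_natCast, ← Real.rpow_mul hy.le]
      exact Real.rpow_le_rpow_of_exponent_ge hy hy1 (by linarith)
    calc _ ≤ |Real.log y| ^ k * (y ^ (1 / 16 : ℝ)) ^ k := by gcongr
      _ = (|Real.log y| * y ^ (1 / 16 : ℝ)) ^ k := by rw [mul_pow]
      _ ≤ _ := by gcongr
  have e : y = y ^ (1 / 4 : ℝ) * y ^ (3 / 4 : ℝ) := by
    rw [← Real.rpow_add hy]; norm_num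
  rw [abs_mul, abs_of_pos hy, residueCoeff_eq_sum]
  calc y * |∑ k ∈ range 5, Real.log y ^ k / (k.factorial : ℝ) * PowerSeries.coeff (4 - k) H|
      ≤ y * ∑ k ∈ range 5, |Real.log y| ^ k / (k.factorial : ℝ)
          * |PowerSeries.coeff (4 - k) H| := by
        gcongr
        refine (abs_sum_le_sum_abs _ _).trans (sum_le_sum fun k _ => ?_)
        rw [abs_mul, abs_div, abs_pow, Nat.abs_cast]
    _ = ∑ k ∈ range 5, (|Real.log y| ^ k * y ^ (1 / 4 : ℝ)) / (k.factorial : ℝ)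
          * |PowerSeries.coeff (4 - k) H| * y ^ (3 / 4 : ℝ) := by
        rw [mul_sum]
        refine sum_congr rfl fun k _ => ?_
        nth_rw 1 [e]
        ring
    _ ≤ ∑ k ∈ range 5, (16 : ℝ) ^ k / (k.factorial : ℝ)
          * |PowerSeries.coeff (4 - k) H| * y ^ (3 / 4 : ℝ) := by
        refine sum_le_sum fun k hk => ?_
        have := hpow k hk
        gcongr
    _ = _ := by rw [sum_mul]

lemma sum_rpow_le (Q : ℕ) :
    ∑ m ∈ Icc 1 Q, (m : ℝ) ^ (-0.98 : ℝ) ≤ 50 * (Q : ℝ) ^ (0.02 : ℝ) := by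
  induction Q with
  | zero =>
    rw [Icc_eq_empty (by norm_num), sum_empty]
    positivity
  | succ Q ih =>
    rw [sum_Icc_succ_top (by omega)]
    set m : ℝ := ((Q + 1 : ℕ) : ℝ) with hm
    have hm0 : 0 < m := by positivity
    have hQ : (Q : ℝ) = m * (1 + -m⁻¹) := by
      have : (Q : ℝ) = m - 1 := by rw [hm]; push_cast; ring
      rw [this]
      field_simp
      ring
    have hm1 : m⁻¹ ≤ 1 := inv_le_one_of_one_le₀ (by rw [hm]; push_cast; linarith [Q.cast_nonneg (α := ℝ)])
    have hb := rpow_one_add_le_one_add_mul_self (s := -m⁻¹) (by linarith) (p := 0.02) (by norm_num)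
      (by norm_num)
    have h1 : (Q : ℝ) ^ (0.02 : ℝ) ≤ m ^ (0.02 : ℝ) * (1 + 0.02 * -m⁻¹) := by
      rw [hQ, Real.mul_rpow hm0.le (by linarith)]
      gcongr
    have h2 : m ^ (0.02 : ℝ) * m⁻¹ = m ^ (-0.98 : ℝ) := by
      rw [← Real.rpow_neg_one, ← Real.rpow_add hm0]; norm_num
    have h3 : m ^ (0.02 : ℝ) * (1 + 0.02 * -m⁻¹) = m ^ (0.02 : ℝ) - 0.02 * m ^ (-0.98 : ℝ) := by
      rw [← h2]; ring
    rw [h3] at h1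
    linarith

lemma inv_sqrt_cube_le {m : ℕ} (hm : 2 ≤ m) :
    1 / Real.sqrt m ^ 3 ≤ 2 * (1 / Real.sqrt ((m - 1 : ℕ) : ℝ) - 1 / Real.sqrt m) := by
  have hm0 : (0 : ℝ) < ((m - 1 : ℕ) : ℝ) := by exact_mod_cast (by omega : 0 < m - 1)
  have hm1 : (0 : ℝ) < m := by exact_mod_cast (by omega : 0 < m)
  set a := Real.sqrt ((m - 1 : ℕ) : ℝ) with ha
  set b := Real.sqrt (m : ℝ) with hb
  have ha0 : 0 < a := Real.sqrt_pos.2 hm0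
  have hb0 : 0 < b := Real.sqrt_pos.2 hm1
  have ha2 : a ^ 2 = m - 1 := by
    rw [ha, Real.sq_sqrt hm0.le, Nat.cast_sub (by omega), Nat.cast_one]
  have hb2 : b ^ 2 = m := Real.sq_sqrt hm1.le
  have hab : a ≤ b := by
    rw [ha, hb]
    exact Real.sqrt_le_sqrt (by exact_mod_cast Nat.sub_le m 1)
  have e : 2 * (1 / a - 1 / b) = 2 / (a * b * (a + b)) := by
    have : (b - a) * (a + b) = 1 := by linarith [show (b - a) * (a + b) = b ^ 2 - a ^ 2 by ring]
    field_simp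
    linarith
  rw [e, div_le_div_iff₀ (by positivity) (by positivity)]
  have h1 : a * b * (a + b) ≤ b * b * (b + b) := by gcongr
  nlinarith

lemma sum_inv_sqrt_cube_le {Q N : ℕ} (hQ : 1 ≤ Q) (hQN : Q + 1 ≤ N) :
    ∑ m ∈ Ico (Q + 1) N, 1 / Real.sqrt m ^ 3 ≤ 2 / Real.sqrt Q := by
  have h : ∀ N, Q + 1 ≤ N → ∑ m ∈ Ico (Q + 1) N, 1 / Real.sqrt m ^ 3
      ≤ 2 * (1 / Real.sqrt Q - 1 / Real.sqrt ((N - 1 : ℕ) : ℝ)) := by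
    intro N hN
    induction N, hN using Nat.le_induction with
    | base => simp
    | succ N hN ih =>
      rw [sum_Ico_succ_top hN]
      have := inv_sqrt_cube_le (m := N) (by omega)
      simp only [Nat.add_sub_cancel]
      linarith
  refine (h N hQN).trans ?_
  have : 0 ≤ 1 / Real.sqrt ((N - 1 : ℕ) : ℝ) := by positivity
  have e : 2 / Real.sqrt Q = 2 * (1 / Real.sqrt Q) := by ring
  rw [e]
  linarith

lemma half_sqrt_le_floor {x : ℝ} (hx : 1 ≤ x) : Real.sqrt x / 2 ≤ ⌊Real.sqrt x⌋₊ := by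
  have h1 : 1 ≤ Real.sqrt x := Real.one_le_sqrt.2 hx
  have h2 := Nat.lt_floor_add_one (Real.sqrt x)
  have h3 : (1 : ℝ) ≤ ⌊Real.sqrt x⌋₊ := by exact_mod_cast Nat.one_le_floor_iff _ |>.2 h1
  linarith

lemma le_floor_sqrt_iff {m : ℕ} {x : ℝ} (hx : 0 ≤ x) :
    m ≤ ⌊Real.sqrt x⌋₊ ↔ (m : ℝ) ^ 2 ≤ x := by
  rw [Nat.le_floor_iff (Real.sqrt_nonneg x), Real.le_sqrt m.cast_nonneg hx]

lemma sum_tail_le {x : ℝ} (hx : 1 ≤ x) (N : ℕ) :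
    ∑ m ∈ Ico (⌊Real.sqrt x⌋₊ + 1) N, (x / (m : ℝ) ^ 2) ^ (3 / 4 : ℝ) ≤ 4 * x ^ (1 / 2 : ℝ) := by
  set Q := ⌊Real.sqrt x⌋₊ with hQ
  have hx0 : 0 < x := by linarith
  rcases le_or_gt (Q + 1) N with hN | hN
  swap
  · rw [Ico_eq_empty_of_le hN.le, sum_empty]
    positivity
  have hQ1 : 1 ≤ Q := (Nat.one_le_floor_iff _).2 (Real.one_le_sqrt.2 hx)
  have hterm : ∀ m ∈ Ico (Q + 1) N,
      (x / (m : ℝ) ^ 2) ^ (3 / 4 : ℝ) = x ^ (3 / 4 : ℝ) * (1 / Real.sqrt m ^ 3) := by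
    intro m _
    rw [Real.div_rpow hx0.le (by positivity), Real.sqrt_eq_rpow, ← Real.rpow_natCast (m : ℝ) 2,
      ← Real.rpow_mul m.cast_nonneg, ← Real.rpow_natCast _ 3, ← Real.rpow_mul m.cast_nonneg]
    norm_num
    rw [div_eq_mul_inv]
  rw [sum_congr rfl hterm, ← mul_sum]
  have hq := half_sqrt_le_floor hx
  rw [← hQ] at hq
  have hs : x ^ (1 / 4 : ℝ) ≤ 2 * Real.sqrt Q := by
    have h1 : x ^ (1 / 4 : ℝ) = Real.sqrt (Real.sqrt x) := by
      rw [Real.sqrt_eq_rpow, Real.sqrt_eq_rpow, ← Real.rpow_mul hx0.le]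
      norm_num
    rw [h1]
    refine Real.sqrt_le_iff.2 ⟨by positivity, ?_⟩
    rw [mul_pow, Real.sq_sqrt (by positivity)]
    have := Real.sqrt_nonneg x
    linarith
  have hQs : 0 < Real.sqrt Q := Real.sqrt_pos.2 (by exact_mod_cast hQ1)
  calc x ^ (3 / 4 : ℝ) * ∑ m ∈ Ico (Q + 1) N, 1 / Real.sqrt m ^ 3
      ≤ x ^ (3 / 4 : ℝ) * (2 / Real.sqrt Q) := by
        gcongr
        exact sum_inv_sqrt_cube_le hQ1 hN
    _ = x ^ (1 / 2 : ℝ) * (x ^ (1 / 4 : ℝ) * (2 / Real.sqrt Q)) := by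
        rw [← mul_assoc, ← Real.rpow_add hx0]
        norm_num
    _ ≤ x ^ (1 / 2 : ℝ) * (2 * Real.sqrt Q * (2 / Real.sqrt Q)) := by gcongr
    _ = _ := by
        field_simp
        ring

/-- Passing from the coefficients `b` to their convolution with `μ` supported on squares multiplies
the generating series of the main term by `1 / ζ(2 + 2t)`. The main term is used for all `m`, also
where `x / m² < 1` and the Riesz sum vanishes; there it is at most a multiple of
`(x / m²)^{3/4}`, and the sum over these `m` is `O(x^{1/2})`. -/
lemma abs_rieszSum_mul_moebius_sub_le {b : ArithmeticFunction ℝ} {H : PowerSeries ℝ} {K θ : ℝ}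
    (h : ∀ y : ℝ, 1 ≤ y →
      |rieszSum b y - y * residueCoeff H (Real.log y)| ≤ K * y ^ θ) :
    ∃ D : ℝ, ∀ x : ℝ, 1 ≤ x →
      |rieszSum (b * squareSupport moebiusR) x
          - x * residueCoeff (H * moebiusSeries) (Real.log x)|
        ≤ K * ∑ m ∈ Icc 1 ⌊Real.sqrt x⌋₊, (x / (m : ℝ) ^ 2) ^ θ + D * x ^ (1 / 2 : ℝ) := by
  obtain ⟨D, hD, hsmall⟩ := abs_mul_residueCoeff_le H
  refine ⟨D * 4, fun x hx => ?_⟩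
  have hx0 : 0 < x := by linarith
  have hK : 0 ≤ K := by
    have h1 := (abs_nonneg _).trans (h 1 le_rfl)
    rwa [Real.one_rpow, mul_one] at h1
  set Q := ⌊Real.sqrt x⌋₊ with hQ
  set E : ℕ → ℝ := fun m => rieszSum b (x / (m : ℝ) ^ 2)
    - x / (m : ℝ) ^ 2 * residueCoeff H (Real.log (x / (m : ℝ) ^ 2)) with hE
  have hmain : HasSum (fun m : ℕ => moebiusR m * (x / (m : ℝ) ^ 2
      * residueCoeff H (Real.log (x / (m : ℝ) ^ 2))))
      (x * residueCoeff (H * moebiusSeries) (Real.log x)) := by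
    refine ((hasSum_moebius_mul_residueCoeff H (Real.log x)).mul_left x).congr_fun fun m => ?_
    rcases eq_or_ne m 0 with rfl | hm
    · simp
    · have hm0 : (m : ℝ) ≠ 0 := by exact_mod_cast hm
      have e : Real.log (x / (m : ℝ) ^ 2) = Real.log x + -2 * Real.log m := by
        rw [Real.log_div hx0.ne' (pow_ne_zero 2 hm0), Real.log_pow]
        push_cast
        ring
      rw [e]
      ring
  have hriesz : HasSum (fun m : ℕ => moebiusR m * rieszSum b (x / (m : ℝ) ^ 2))
      (rieszSum (b * squareSupport moebiusR) x) := by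
    rw [rieszSum_mul_squareSupport _ _ hx0.le]
    refine hasSum_sum_of_ne_finset_zero fun m hm => ?_
    rcases eq_or_ne m 0 with rfl | hm0
    · simp
    · have hxm : x < m := by
        by_contra! hle
        exact hm (mem_Ioc.2 ⟨Nat.pos_of_ne_zero hm0, Nat.le_floor hle⟩)
      have hm1 : (1 : ℝ) ≤ m := by linarith
      rw [rieszSum_eq_zero _ ((div_lt_one (by positivity)).2 (by nlinarith)), mul_zero]
  have hdiff : HasSum (fun m : ℕ => moebiusR m * E m)
      (rieszSum (b * squareSupport moebiusR) x
        - x * residueCoeff (H * moebiusSeries) (Real.log x)) :=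
    (hriesz.sub hmain).congr_fun fun m => by simp only [hE]; ring
  have hbig : ∀ m ∈ Icc 1 Q, |moebiusR m * E m| ≤ K * (x / (m : ℝ) ^ 2) ^ θ := by
    intro m hm
    rw [mem_Icc] at hm
    have hm0 : (0 : ℝ) < m := by exact_mod_cast hm.1
    have hle : (m : ℝ) ^ 2 ≤ x := (le_floor_sqrt_iff hx0.le).1 hm.2
    rw [abs_mul]
    calc |moebiusR m| * |E m| ≤ 1 * |E m| := by gcongr; exact abs_moebiusR_le_one m
      _ ≤ _ := by
        rw [one_mul]
        exact h _ ((one_le_div (by positivity)).2 hle)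
  have htail : ∀ m, Q + 1 ≤ m → |moebiusR m * E m| ≤ D * (x / (m : ℝ) ^ 2) ^ (3 / 4 : ℝ) := by
    intro m hm
    have hm0 : (0 : ℝ) < m := by exact_mod_cast (by omega : 0 < m)
    have hlt : x < (m : ℝ) ^ 2 := by
      by_contra! hle
      have := (le_floor_sqrt_iff hx0.le).2 hle
      omega
    have h1 : x / (m : ℝ) ^ 2 < 1 := (div_lt_one (by positivity)).2 hlt
    rw [abs_mul]
    calc |moebiusR m| * |E m| ≤ 1 * |E m| := by gcongr; exact abs_moebiusR_le_one m
      _ ≤ _ := by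
        simp only [hE]
        rw [one_mul, rieszSum_eq_zero _ h1, zero_sub, abs_neg]
        exact hsmall _ (by positivity) h1.le
  have hlim := hdiff.tendsto_sum_nat.abs
  refine le_of_tendsto hlim ?_
  filter_upwards [eventually_ge_atTop (Q + 1)] with N hN
  have hsplit : ∑ m ∈ range N, moebiusR m * E m
      = ∑ m ∈ Icc 1 Q, moebiusR m * E m + ∑ m ∈ Ico (Q + 1) N, moebiusR m * E m := by
    have e1 : Icc 1 Q = Ico 1 (Q + 1) := by ext; simp
    rw [range_eq_Ico, sum_eq_sum_Ico_succ_bot (by omega : 0 < N), e1,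
      sum_Ico_consecutive _ (by omega) hN]
    simp
  rw [hsplit]
  refine (abs_add_le _ _).trans (add_le_add ?_ ?_)
  · rw [mul_sum]
    exact (abs_sum_le_sum_abs _ _).trans (sum_le_sum hbig)
  · calc _ ≤ ∑ m ∈ Ico (Q + 1) N, D * (x / (m : ℝ) ^ 2) ^ (3 / 4 : ℝ) :=
        (abs_sum_le_sum_abs _ _).trans (sum_le_sum fun m hm => htail m (mem_Ico.1 hm).1)
      _ ≤ D * (4 * x ^ (1 / 2 : ℝ)) := by
          rw [← mul_sum]
          gcongr
          exact sum_tail_le hx N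
      _ = _ := by ring

lemma sum_div_sq_rpow_le {x : ℝ} (hx : 1 ≤ x) :
    ∑ m ∈ Icc 1 ⌊Real.sqrt x⌋₊, (x / (m : ℝ) ^ 2) ^ (0.49 : ℝ) ≤ 50 * x ^ (1 / 2 : ℝ) := by
  have hx0 : 0 < x := by linarith
  have hterm : ∀ m ∈ Icc 1 ⌊Real.sqrt x⌋₊,
      (x / (m : ℝ) ^ 2) ^ (0.49 : ℝ) = x ^ (0.49 : ℝ) * (m : ℝ) ^ (-0.98 : ℝ) := by
    intro m _
    rw [Real.div_rpow hx0.le (by positivity), ← Real.rpow_natCast (m : ℝ) 2,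
      ← Real.rpow_mul m.cast_nonneg, div_eq_mul_inv, ← Real.rpow_neg m.cast_nonneg]
    norm_num
  rw [sum_congr rfl hterm, ← mul_sum]
  have h1 := sum_rpow_le ⌊Real.sqrt x⌋₊
  have h2 : (⌊Real.sqrt x⌋₊ : ℝ) ^ (0.02 : ℝ) ≤ x ^ (0.01 : ℝ) := by
    calc _ ≤ (Real.sqrt x) ^ (0.02 : ℝ) := by
          have := Nat.floor_le (Real.sqrt_nonneg x)
          gcongr
      _ = _ := by
          rw [Real.sqrt_eq_rpow, ← Real.rpow_mul hx0.le]
          norm_num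
  calc x ^ (0.49 : ℝ) * ∑ m ∈ Icc 1 ⌊Real.sqrt x⌋₊, (m : ℝ) ^ (-0.98 : ℝ)
      ≤ x ^ (0.49 : ℝ) * (50 * x ^ (0.01 : ℝ)) := by
        have := h1.trans (mul_le_mul_of_nonneg_left h2 (by norm_num))
        gcongr
    _ = 50 * (x ^ (0.49 : ℝ) * x ^ (0.01 : ℝ)) := by ring
    _ = _ := by
        rw [← Real.rpow_add hx0]
        norm_num

lemma sum_div_sq_sqrt_le {x : ℝ} (hx : 1 ≤ x) :
    ∑ m ∈ Icc 1 ⌊Real.sqrt x⌋₊, (x / (m : ℝ) ^ 2) ^ (1 / 2 : ℝ)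
      ≤ x ^ (1 / 2 : ℝ) * (1 + Real.log x) := by
  have hx0 : 0 < x := by linarith
  have hQ1 : 1 ≤ ⌊Real.sqrt x⌋₊ := (Nat.one_le_floor_iff _).2 (Real.one_le_sqrt.2 hx)
  have hterm : ∀ m ∈ Icc 1 ⌊Real.sqrt x⌋₊,
      (x / (m : ℝ) ^ 2) ^ (1 / 2 : ℝ) = x ^ (1 / 2 : ℝ) * (m : ℝ)⁻¹ := by
    intro m _
    rw [Real.div_rpow hx0.le (by positivity), ← Real.rpow_natCast (m : ℝ) 2,
      ← Real.rpow_mul m.cast_nonneg, div_eq_mul_inv]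
    norm_num
  rw [sum_congr rfl hterm, ← mul_sum]
  gcongr
  have e1 : Icc 1 ⌊Real.sqrt x⌋₊ = Ico (0 + 1) (⌊Real.sqrt x⌋₊ + 1) := by ext; simp
  rw [e1, ← sum_Ico_add' (fun m : ℕ => (m : ℝ)⁻¹), ← range_eq_Ico]
  have h := sum_range_inv_le (N := ⌊Real.sqrt x⌋₊)
  push_cast
  refine h.trans ?_
  gcongr
  calc (⌊Real.sqrt x⌋₊ : ℝ) ≤ Real.sqrt x := Nat.floor_le (Real.sqrt_nonneg x)
    _ ≤ x := Real.sqrt_le_iff.2 ⟨hx0.le, by nlinarith⟩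

lemma abs_rieszSum_subgroups_sub_le :
    ∃ K : ℝ, ∀ x : ℝ, 1 ≤ x →
      |rieszSum (baseCoeff * squareSupport moebiusR) x
        - x * residueCoeff (seriesH 1) (Real.log x)| ≤ K * x ^ (1 / 2 : ℝ) := by
  obtain ⟨K, hK⟩ := abs_rieszSum_baseCoeff_sub_le
  obtain ⟨D, hD⟩ := abs_rieszSum_mul_moebius_sub_le hK
  have hK0 : 0 ≤ K := by
    have h1 := (abs_nonneg _).trans (hK 1 le_rfl)
    rwa [Real.one_rpow, mul_one] at h1
  refine ⟨K * 50 + D, fun x hx => ?_⟩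
  rw [seriesH_succ 0]
  refine (hD x hx).trans ?_
  have := mul_le_mul_of_nonneg_left (sum_div_sq_rpow_le hx) hK0
  linarith

lemma abs_rieszSum_cyclic_sub_le :
    ∃ K : ℝ, ∀ x : ℝ, 1 ≤ x →
      |rieszSum (baseCoeff * squareSupport moebiusR * squareSupport moebiusR) x
        - x * residueCoeff (seriesH 2) (Real.log x)|
        ≤ K * (x ^ (1 / 2 : ℝ) * (1 + Real.log x)) := by
  obtain ⟨K, hK⟩ := abs_rieszSum_subgroups_sub_le
  obtain ⟨D, hD⟩ := abs_rieszSum_mul_moebius_sub_le hK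
  have hK0 : 0 ≤ K := by
    have h1 := (abs_nonneg _).trans (hK 1 le_rfl)
    rwa [Real.one_rpow, mul_one] at h1
  refine ⟨K + |D|, fun x hx => ?_⟩
  rw [seriesH_succ 1]
  refine (hD x hx).trans ?_
  have h1 := mul_le_mul_of_nonneg_left (sum_div_sq_sqrt_le hx) hK0
  have hl := Real.log_nonneg hx
  have hs : 0 ≤ x ^ (1 / 2 : ℝ) := by positivity
  have h2 : D * x ^ (1 / 2 : ℝ) ≤ |D| * (x ^ (1 / 2 : ℝ) * (1 + Real.log x)) := by
    calc D * x ^ (1 / 2 : ℝ) ≤ |D| * (x ^ (1 / 2 : ℝ) * 1) := by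
          rw [mul_one]
          gcongr
          exact le_abs_self D
      _ ≤ _ := by gcongr; linarith
  linarith

end MoebiusStep

end SubgroupCount

theorem theorem1 :
    (SubgroupCount.polyP.natDegree = 4 ∧
      ∃ K : ℝ, ∀ x : ℝ, 2 < x →
        |SubgroupCount.logWeightedSum SubgroupCount.s x
            - x * SubgroupCount.polyP.eval (Real.log x)|
          ≤ K * (x ^ (1 / 2 : ℝ) * Real.log x)) ∧
    (SubgroupCount.polyR.natDegree = 4 ∧
      ∃ K : ℝ, ∀ x : ℝ, 2 < x →
        |SubgroupCount.logWeightedSum SubgroupCount.c x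
            - x * SubgroupCount.polyR.eval (Real.log x)|
          ≤ K * (x ^ (1 / 2 : ℝ) * Real.log x)) := by
  have hlog : ∀ x : ℝ, 2 < x → 1 + Real.log x ≤ 3 * Real.log x := by
    intro x hx
    have h1 := Real.log_two_gt_d9
    have h2 := Real.log_le_log (by norm_num) hx.le
    linarith
  refine ⟨⟨SubgroupCount.natDegree_mainPoly 1, ?_⟩, ⟨SubgroupCount.natDegree_mainPoly 2, ?_⟩⟩
  · obtain ⟨K, hK⟩ := SubgroupCount.abs_rieszSum_subgroups_sub_le
    refine ⟨|K| * 3, fun x hx => ?_⟩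
    have hx0 : 0 < x := by linarith
    rw [SubgroupCount.logWeightedSum_s hx0.le, SubgroupCount.polyP, SubgroupCount.eval_mainPoly]
    have hl := hlog x hx
    calc _ ≤ K * x ^ (1 / 2 : ℝ) := hK x (by linarith)
      _ ≤ |K| * (x ^ (1 / 2 : ℝ) * (3 * Real.log x)) := by
          have h1 : (1 : ℝ) ≤ 3 * Real.log x := by
            have := Real.log_nonneg (by linarith : 1 ≤ x)
            linarith
          calc K * x ^ (1 / 2 : ℝ) ≤ |K| * (x ^ (1 / 2 : ℝ) * 1) := by
                rw [mul_one]
                gcongr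
                exact le_abs_self K
            _ ≤ _ := by gcongr
      _ = _ := by ring
  · obtain ⟨K, hK⟩ := SubgroupCount.abs_rieszSum_cyclic_sub_le
    refine ⟨|K| * 3, fun x hx => ?_⟩
    have hx0 : 0 < x := by linarith
    rw [SubgroupCount.logWeightedSum_c hx0.le, SubgroupCount.polyR, SubgroupCount.eval_mainPoly]
    have hl := hlog x hx
    have hl0 : 0 ≤ 1 + Real.log x := by
      have := Real.log_nonneg (by linarith : 1 ≤ x)
      linarith
    calc _ ≤ K * (x ^ (1 / 2 : ℝ) * (1 + Real.log x)) := hK x (by linarith)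
      _ ≤ |K| * (x ^ (1 / 2 : ℝ) * (3 * Real.log x)) := by
          gcongr
          exact le_abs_self K
      _ = _ := by ring
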